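/- Work in the upper half-space model $\mathbb{H}^3=\{(z,t): z\in\mathbb{C},\,t>0\}$. Let $\omega=\frac12(1+i\sqrt3)$. The regular ideal tetrahedron in standard position has ideal vertices $0,1,\omega,\infty$; the regular ideal octahedron in standard position has ideal vertices $0,1,1+i,i,\frac12(1+i),\infty$; regular ideal tetrahedra and octahedra in general are the isometric images of these. Tilings of $\mathbb{H}^3$ are locally finite and face-to-face. A hyperbolic $3$-orbifold $\mathbb{H}^3/\Gamma$, where $\Gamma$ is a discrete group of isometries of finite covolume (not necessarily orientation-preserving), is *mixed-platonic* if there is a $\Gamma$-invariant tiling of $\mathbb{H}^3$ consisting of $n_1\ge 1$ $\Gamma$-orbits of regular ideal tetrahedra and $n_2\ge 1$ $\Gamma$-orbits of regular ideal octahedra (with $n_1,n_2$ finite). It is *one-cusped* if the parabolic fixed points of $\Gamma$ form exactly one $\Gamma$-orbit. A tiling $\mathcal{T}$ of $\mathbb{C}$ is a *peripheral tiling* of the mixed-platonic orbifold $\mathbb{H}^3/\Gamma$ if, after replacing $\Gamma$ by a conjugate in $\mathrm{Isom}(\mathbb{H}^3)$, there is a $\Gamma$-invariant tiling $\mathcal{P}$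 as above that has a tile in standard position and such that $\mathcal{T}$ is the collection of nonempty intersections of the tiles of $\mathcal{P}$ with the horosphere $\partial B_\infty=\{t=1\}$, identified with $\mathbb{C}$, where $B_\infty=\{(z,t): t\ge 1\}$. (Its tiles are equilateral triangles and squares of sidelength $1$.) A triangular tile of $\mathcal{T}$ is of type TTT, OTT, OOT or OOO if along its three edges it abuts, respectively, three triangles, one square and two triangles, two squares and one triangle, or three squares of $\mathcal{T}$. **Proposition and Corollary.** Let $\mathbb{H}^3/\Gamma$ be a one-cusped mixed-platonic orbifold. 1. Let $\mathcal{T}$ be a peripheral tiling of $\mathbb{H}^3/\Gamma$. If $\mathcal{T}$ contains a triangle of type OOT, then it also contains one of type OOO or one of type OTT; and if $\mathcal{T}$ contains a triangle of type OTT, then it also contains one of type OOT or one of type TTT. 2. Neither of the following two tilings of $\mathbb{C}$, nor the image of either under any isometry of $\mathbb{C}$, is a peripheral tiling of $\mathbb{H}^3/\Gamma$. Put $\zeta=e^{i\pi/6}$. For points $p_1,\dots,p_k$ let $[p_1,\dots,p_k]$ denote their convex hull. - The tiling that consists of all translates, under the lattice generated by $(1+\sqrt3)\bar\zeta$ and $(1+\sqrt3)\zeta$,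 of the six triangles $[0,\omega^k,\omega^{k+1}]$ ($0\le k\le5$), the three squares $[\omega^k,\,\omega^{k+1},\,\omega^{k+1}+\zeta\omega^k,\,\omega^k+\zeta\omega^k]$ ($0\le k\le 2$), and the two triangles $[1,1+\zeta,1+\bar\zeta]$ and $[\omega,\omega+\zeta,\omega+i]$. - The tiling that consists of all translates, under the lattice generated by $\mu=1+\zeta$ and $\lambda=i\mu$, of the two squares $[0,1,1+i,i]$ and $[1+i,\mu+i,\mu+\lambda,1+\lambda]$ and the four triangles $[i,\lambda,1+\lambda]$, $[i,1+\lambda,1+i]$, $[1+i,\mu+i,\mu]$, $[1,\mu,1+i]$. -/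

import Mathlib

open Set Filter Topology MeasureTheory OnePoint
open scoped Pointwise ComplexConjugate

namespace MixedPlatonic

noncomputable section

/-! ## Hyperbolic 3-space -/

/-- The upper half-space model of hyperbolic 3-space: pairs `(z, t)` with `z ∈ ℂ` and `t > 0`. -/
def H3 : Type := {p : ℂ × ℝ // 0 < p.2}

instance : TopologicalSpace H3 := inferInstanceAs (TopologicalSpace {p : ℂ × ℝ // 0 < p.2})

instance : MeasurableSpace H3 := inferInstanceAs (MeasurableSpace {p : ℂ × ℝ // 0 < p.2})

/-- The horizontal coordinate. -/
def H3.z (x : H3) : ℂ := x.1.1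

/-- The height. -/
def H3.t (x : H3) : ℝ := x.1.2

/-- The hyperbolic distance of the upper half-space model. -/
def hdist (x y : H3) : ℝ :=
  2 * Real.arsinh (√(‖x.z - y.z‖ ^ 2 + (x.t - y.t) ^ 2) / (2 * √(x.t * y.t)))

/-- The full isometry group of hyperbolic 3-space (orientation-reversing isometries included). -/
def Isom : Subgroup (Equiv.Perm H3) where
  carrier := {g | ∀ x y, hdist (g x) (g y) = hdist x y}
  mul_mem' := by
    intro f g hf hg x y
    exact (hf (g x) (g y)).trans (hg x y)
  one_mem' := by
    intro x y
    rfl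
  inv_mem' := by
    intro g hg x y
    have h : hdist (g (g.symm x)) (g (g.symm y)) = hdist (g.symm x) (g.symm y) :=
      hg (g.symm x) (g.symm y)
    rw [Equiv.apply_symm_apply, Equiv.apply_symm_apply] at h
    exact h.symm

/-- The hyperbolic volume `dz dt / t ^ 3`. -/
def hvol : Measure H3 :=
  (Measure.comap (Subtype.val : {p : ℂ × ℝ // 0 < p.2} → ℂ × ℝ) volume).withDensity
    (fun x : H3 => ENNReal.ofReal (1 / x.t ^ 3))

/-! ## The sphere at infinity -/

/-- The neighbourhood filter in hyperbolic space of an ideal point `p ∈ ℂ ∪ {∞}`: the closed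
half-space together with `∞` sits inside the one-point compactification of `ℂ × ℝ`, where
`w ∈ ℂ` is the point `(w, 0)`. -/
def idealNhds (p : OnePoint ℂ) : Filter H3 :=
  comap (fun x : H3 => (((x.z, x.t) : ℂ × ℝ) : OnePoint (ℂ × ℝ)))
    (𝓝 (OnePoint.map (fun w : ℂ => ((w, 0) : ℂ × ℝ)) p))

/-- The extension of `g` to the sphere at infinity sends `p` to `q`. -/
def SendsIdeal (g : Equiv.Perm H3) (p q : OnePoint ℂ) : Prop :=
  Tendsto g (idealNhds p) (idealNhds q)

/-- `p` is a parabolic fixed point of `Γ`: some element of `Γ` has no fixed point in hyperbolic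
space and has `p` as its one and only fixed point at infinity. -/
def IsParabolicFixedPoint (Γ : Subgroup (Equiv.Perm H3)) (p : OnePoint ℂ) : Prop :=
  ∃ g ∈ Γ, (∀ x, g x ≠ x) ∧ SendsIdeal g p p ∧ ∀ q, SendsIdeal g q q → q = p

/-- The quotient of hyperbolic space by `Γ` has exactly one cusp: the parabolic fixed points of `Γ`
form exactly one `Γ`-orbit. -/
def OneCusped (Γ : Subgroup (Equiv.Perm H3)) : Prop :=
  ∃ p, IsParabolicFixedPoint Γ p ∧
    ∀ q, IsParabolicFixedPoint Γ q → ∃ g ∈ Γ, SendsIdeal g q p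

/-! ## Half-spaces and ideal polyhedra -/

/-- Coefficients of a hyperbolic plane `a (|z|² + t²) + 2 Re (conj b * z) + c = 0`. The condition
says that the plane is not empty: it is a vertical plane if `a = 0`, and a hemisphere centred on
`ℂ` otherwise. -/
structure Plane where
  a : ℝ
  b : ℂ
  c : ℝ
  nondeg : a * c < ‖b‖ ^ 2

/-- The affine function that defines a plane. -/
def Plane.eval (S : Plane) (z : ℂ) (t : ℝ) : ℝ :=
  S.a * (‖z‖ ^ 2 + t ^ 2) + 2 * (conj S.b * z).re + S.c

/-- The closed half-space on the nonnegative side of a plane. -/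
def Plane.halfSpace (S : Plane) : Set H3 := {x | 0 ≤ S.eval x.z x.t}

/-- The plane itself, as a set of points. -/
def Plane.carrier (S : Plane) : Set H3 := {x | S.eval x.z x.t = 0}

/-- The ideal point `p` lies at infinity of the closed half-space. -/
def Plane.HasIdeal (S : Plane) (p : OnePoint ℂ) : Prop :=
  p.elim (0 ≤ S.a) (fun w => 0 ≤ S.eval w 0)

/-- The (closed) hyperbolic convex hull of a set of ideal points: the intersection of all closed
half-spaces that have these points at infinity. -/
def idealHull (V : Set (OnePoint ℂ)) : Set H3 :=
  {x | ∀ S : Plane, (∀ p ∈ V, S.HasIdeal p) → x ∈ S.halfSpace}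

/-- `ω = (1 + i √3) / 2`. -/
def omega : ℂ := (1 + Complex.I * (√3 : ℝ)) / 2

/-- The regular ideal tetrahedron in standard position. -/
def stdTetrahedron : Set H3 :=
  idealHull {((0 : ℂ) : OnePoint ℂ), ((1 : ℂ) : OnePoint ℂ), (omega : OnePoint ℂ), ∞}

/-- The regular ideal octahedron in standard position. -/
def stdOctahedron : Set H3 :=
  idealHull {((0 : ℂ) : OnePoint ℂ), ((1 : ℂ) : OnePoint ℂ), ((1 + Complex.I : ℂ) : OnePoint ℂ),
    (Complex.I : OnePoint ℂ), (((1 + Complex.I) / 2 : ℂ) : OnePoint ℂ), ∞}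

/-- Regular ideal tetrahedra are the isometric images of the standard one. -/
def IsRegularIdealTetrahedron (P : Set H3) : Prop := ∃ g ∈ Isom, P = g '' stdTetrahedron

/-- Regular ideal octahedra are the isometric images of the standard one. -/
def IsRegularIdealOctahedron (P : Set H3) : Prop := ∃ g ∈ Isom, P = g '' stdOctahedron

/-- `F` is a proper face (of any dimension, possibly empty) of the convex polyhedron `P`: the
intersection of `P` with a plane that has `P` on one side. -/
def IsFace (P F : Set H3) : Prop := ∃ S : Plane, P ⊆ S.halfSpace ∧ F = P ∩ S.carrier

/-- A (locally finite, face-to-face) tiling of hyperbolic space by regular ideal tetrahedra and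
regular ideal octahedra. -/
structure IsTiling (𝒬 : Set (Set H3)) : Prop where
  tile : ∀ P ∈ 𝒬, IsRegularIdealTetrahedron P ∨ IsRegularIdealOctahedron P
  cover : ⋃₀ 𝒬 = univ
  locallyFinite : LocallyFinite (fun P : 𝒬 => (P : Set H3))
  faceToFace : ∀ P ∈ 𝒬, ∀ Q ∈ 𝒬, P ≠ Q → IsFace P (P ∩ Q) ∧ IsFace Q (P ∩ Q)

/-! ## Mixed-platonic orbifolds -/

/-- `𝒬` is a `Γ`-invariant tiling with `n₁ ≥ 1` orbits of regular ideal tetrahedra and `n₂ ≥ 1`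
orbits of regular ideal octahedra. -/
structure IsMixedTiling (Γ : Subgroup (Equiv.Perm H3)) (𝒬 : Set (Set H3)) : Prop where
  tiling : IsTiling 𝒬
  invariant : ∀ γ : Γ, ∀ P ∈ 𝒬, γ • P ∈ 𝒬
  orbits : ∃ n₁ n₂ : ℕ, 1 ≤ n₁ ∧ 1 ≤ n₂ ∧
    (MulAction.orbit Γ '' {P ∈ 𝒬 | IsRegularIdealTetrahedron P}).encard = n₁ ∧
    (MulAction.orbit Γ '' {P ∈ 𝒬 | IsRegularIdealOctahedron P}).encard = n₂

/-- The quotient of hyperbolic space by `Γ` is a mixed-platonic orbifold: `Γ` is a discrete group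
of isometries of finite covolume that leaves invariant a tiling as above. -/
structure IsMixedPlatonic (Γ : Subgroup (Equiv.Perm H3)) : Prop where
  isometries : Γ ≤ Isom
  discrete : ProperlyDiscontinuousSMul Γ H3
  finiteVolume : ∃ D : Set H3, IsFundamentalDomain Γ D hvol ∧ hvol D < ⊤
  tiling : ∃ 𝒬, IsMixedTiling Γ 𝒬

/-- A tiling is in standard position if it has a tile in standard position. -/
def InStandardPosition (𝒬 : Set (Set H3)) : Prop := stdTetrahedron ∈ 𝒬 ∨ stdOctahedron ∈ 𝒬

/-! ## Peripheral tilings -/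

/-- The intersection of `P` with the boundary `t = 1` of the horoball
`B_∞ = {(z, t) | t ≥ 1}`, as a subset of `ℂ`. -/
def crossSection (P : Set H3) : Set ℂ := {w | ∃ x ∈ P, x.z = w ∧ x.t = 1}

/-- The collection of the nonempty intersections of tiles of `𝒬` with the boundary of `B_∞`. -/
def induced (𝒬 : Set (Set H3)) : Set (Set ℂ) := {s | s.Nonempty ∧ ∃ P ∈ 𝒬, s = crossSection P}

/-- `𝒯` is a peripheral tiling of the quotient of hyperbolic space by `Γ`: some conjugate of `Γ` in
the isometry group leaves invariant a tiling `𝒬` in standard position, as in the definition of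
mixed-platonic orbifolds, and `𝒯` is the collection of intersections of the tiles of `𝒬` with the
boundary of `B_∞`. -/
def IsPeripheralTiling (Γ : Subgroup (Equiv.Perm H3)) (𝒯 : Set (Set ℂ)) : Prop :=
  ∃ φ ∈ Isom, ∃ 𝒬, IsMixedTiling (Γ.map (MulAut.conj φ).toMonoidHom) 𝒬 ∧
    InStandardPosition 𝒬 ∧ 𝒯 = induced 𝒬

/-! ## Types of triangles in a planar tiling -/

/-- `a`, `b`, `c` are the vertices of an equilateral triangle of sidelength 1. -/
def UnitTriangle (a b c : ℂ) : Prop := dist a b = 1 ∧ dist b c = 1 ∧ dist c a = 1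

/-- `s` is an equilateral triangle of sidelength 1. -/
def IsTriangle (s : Set ℂ) : Prop :=
  ∃ a b c, UnitTriangle a b c ∧ s = convexHull ℝ {a, b, c}

/-- `s` is a square of sidelength 1. -/
def IsSquare (s : Set ℂ) : Prop :=
  ∃ a u : ℂ, ‖u‖ = 1 ∧ s = convexHull ℝ {a, a + u, a + u + Complex.I * u, a + Complex.I * u}

/-- In `𝒯`, the tile `s` abuts a triangle along its edge from `a` to `b`. -/
def AbutsTriangle (𝒯 : Set (Set ℂ)) (s : Set ℂ) (a b : ℂ) : Prop :=
  ∃ s' ∈ 𝒯, s' ≠ s ∧ IsTriangle s' ∧ s ∩ s' = segment ℝ a b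

/-- In `𝒯`, the tile `s` abuts a square along its edge from `a` to `b`. -/
def AbutsSquare (𝒯 : Set (Set ℂ)) (s : Set ℂ) (a b : ℂ) : Prop :=
  ∃ s' ∈ 𝒯, s' ≠ s ∧ IsSquare s' ∧ s ∩ s' = segment ℝ a b

/-- `s` is a triangular tile of `𝒯` that abuts three triangles. -/
def IsTTT (𝒯 : Set (Set ℂ)) (s : Set ℂ) : Prop :=
  s ∈ 𝒯 ∧ ∃ a b c, UnitTriangle a b c ∧ s = convexHull ℝ {a, b, c} ∧
    AbutsTriangle 𝒯 s a b ∧ AbutsTriangle 𝒯 s b c ∧ AbutsTriangle 𝒯 s c a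

/-- `s` is a triangular tile of `𝒯` that abuts a square and two triangles. -/
def IsOTT (𝒯 : Set (Set ℂ)) (s : Set ℂ) : Prop :=
  s ∈ 𝒯 ∧ ∃ a b c, UnitTriangle a b c ∧ s = convexHull ℝ {a, b, c} ∧
    AbutsSquare 𝒯 s a b ∧ AbutsTriangle 𝒯 s b c ∧ AbutsTriangle 𝒯 s c a

/-- `s` is a triangular tile of `𝒯` that abuts two squares and a triangle. -/
def IsOOT (𝒯 : Set (Set ℂ)) (s : Set ℂ) : Prop :=
  s ∈ 𝒯 ∧ ∃ a b c, UnitTriangle a b c ∧ s = convexHull ℝ {a, b, c} ∧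
    AbutsSquare 𝒯 s a b ∧ AbutsSquare 𝒯 s b c ∧ AbutsTriangle 𝒯 s c a

/-- `s` is a triangular tile of `𝒯` that abuts three squares. -/
def IsOOO (𝒯 : Set (Set ℂ)) (s : Set ℂ) : Prop :=
  s ∈ 𝒯 ∧ ∃ a b c, UnitTriangle a b c ∧ s = convexHull ℝ {a, b, c} ∧
    AbutsSquare 𝒯 s a b ∧ AbutsSquare 𝒯 s b c ∧ AbutsSquare 𝒯 s c a

/-! ## Two periodic tilings of the plane -/

/-- All translates of the members of `D` by the lattice that `μ` and `l` generate. -/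
def latticeTranslates (μ l : ℂ) (D : Set (Set ℂ)) : Set (Set ℂ) :=
  {s | ∃ m n : ℤ, ∃ d ∈ D, s = (fun z : ℂ => z + (m * μ + n * l)) '' d}

/-- `e ^ (i π / 6) = (√3 + i) / 2`. -/
def zeta : ℂ := ((√3 : ℝ) + Complex.I) / 2

/-- The tiling with translation lattice generated by `(1 + √3) e ^ (∓ i π / 6)`. A fundamental set
of tiles consists of the six triangles around `0`, the squares on three consecutive sides of the
hexagon which these triangles form, and two triangles between squares. -/
def hexagonTiling : Set (Set ℂ) :=
  latticeTranslates ((1 + (√3 : ℝ)) * conj zeta) ((1 + (√3 : ℝ)) * zeta)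
    ({s | ∃ k < 6, s = convexHull ℝ {0, omega ^ k, omega ^ (k + 1)}} ∪
      {s | ∃ k < 3, s = convexHull ℝ {omega ^ k, omega ^ (k + 1),
        omega ^ (k + 1) + zeta * omega ^ k, omega ^ k + zeta * omega ^ k}} ∪
      {convexHull ℝ {1, 1 + zeta, 1 + conj zeta},
        convexHull ℝ {omega, omega + zeta, omega + Complex.I}})

/-- The tiling with translation lattice generated by `μ = 1 + e ^ (i π / 6)` and `i μ`. A
fundamental set of tiles consists of two squares and four triangles. -/
def snubSquareTiling : Set (Set ℂ) :=
  latticeTranslates (1 + zeta) (Complex.I * (1 + zeta))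
    {convexHull ℝ {0, 1, 1 + Complex.I, Complex.I},
      convexHull ℝ {1 + Complex.I, 1 + zeta + Complex.I, 1 + zeta + Complex.I * (1 + zeta),
        1 + Complex.I * (1 + zeta)},
      convexHull ℝ {Complex.I, Complex.I * (1 + zeta), 1 + Complex.I * (1 + zeta)},
      convexHull ℝ {Complex.I, 1 + Complex.I * (1 + zeta), 1 + Complex.I},
      convexHull ℝ {1 + Complex.I, 1 + zeta + Complex.I, 1 + zeta},
      convexHull ℝ {1, 1 + zeta, 1 + Complex.I}}

end

end MixedPlatonic

/-! A triangle of a peripheral tiling is the cross-section near `∞` of a regular ideal tetrahedron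
`P` with an ideal vertex at `∞`, and the polygons that it abuts are cross-sections of the tiles
across the three vertical faces of `P`. The tile `X` across the fourth face cannot be seen from `∞`.
Since there is only one cusp, some `γ ∈ Γ` moves any other ideal vertex `v` of `P` to `∞`, and `γ P`
then lies over a triangle of the same peripheral tiling. The faces of `P` at `v` are the two
vertical faces that meet in the edge from `v` to `∞`, and the hidden face. So if the edges at `v`
abut polygons of kinds `K₁` and `K₂`, some triangle abuts polygons of kinds `K₁`, `K₂` and `X`; this
is `Config.exists_triangle`.

The rest is choice of `v`. For a triangle of type OOT, if `X` is an octahedron, the vertex between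
the two squares gives OOO; if `X` is a tetrahedron, a vertex between a square and a triangle gives
OTT. For OTT, the same game gives OOT or TTT. In the first periodic tiling all triangles are OTT or
OOO and OTT occurs; in the second all are OOT. Both contradict these implications.

Three points need care. The ideal vertices of the tetrahedra must be parabolic fixed points:
otherwise the stabiliser of `∞` has bounded orbits on `ℂ`, while infinitely many tiles at `∞` fall
into finitely many classes modulo it (`Config.isParabolicFixedPoint_infty`). The element `γ` must
respect the height one: all tiles with a vertex at `∞` have the same size
(`IsTiling.exists_unitTile_mem`, `IsTiling.scale_eq_one`). And the type of a triangle must be well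
defined (`IsTiling.abuts_unique`, `IsTiling.weight_eq`). The geometry rests on
`isometry_classification`: every isometry is a similarity, or a similarity after an inversion. -/

namespace MixedPlatonic

noncomputable section

/-! ## Points of hyperbolic space and the generators of its isometry group -/

/-- The point with coordinates `z` and `t`. -/
def pt (z : ℂ) (t : ℝ) (h : 0 < t) : H3 := ⟨(z, t), h⟩

@[simp] lemma pt_z (z : ℂ) (t : ℝ) (h : 0 < t) : (pt z t h).z = z := rfl

@[simp] lemma pt_t (z : ℂ) (t : ℝ) (h : 0 < t) : (pt z t h).t = t := rfl

lemma t_pos (x : H3) : 0 < x.t := x.2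

lemma H3_ext {x y : H3} (hz : x.z = y.z) (ht : x.t = y.t) : x = y :=
  Subtype.ext (Prod.ext hz ht)

lemma continuous_z : Continuous H3.z := continuous_fst.comp continuous_subtype_val

lemma continuous_t : Continuous H3.t := continuous_snd.comp continuous_subtype_val

lemma continuous_H3 {X : Type*} [TopologicalSpace X] {f : X → H3}
    (hz : Continuous fun x => (f x).z) (ht : Continuous fun x => (f x).t) : Continuous f :=
  Continuous.subtype_mk (hz.prodMk ht) _

/-- The squared norm of a point of the half-space. -/
def H3.R (x : H3) : ℝ := ‖x.z‖ ^ 2 + x.t ^ 2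

lemma R_pos (x : H3) : 0 < x.R := by
  have := t_pos x
  unfold H3.R
  positivity

/-- Four times the squared hyperbolic sine of half the distance. -/
def chord (x y : H3) : ℝ := (‖x.z - y.z‖ ^ 2 + (x.t - y.t) ^ 2) / (x.t * y.t)

lemma chord_nonneg (x y : H3) : 0 ≤ chord x y := by
  have := t_pos x
  have := t_pos y
  unfold chord
  positivity

lemma hdist_eq_chord (x y : H3) : hdist x y = 2 * Real.arsinh (√(chord x y) / 2) := by
  have hx := t_pos x
  have hy := t_pos y
  unfold hdist chord
  rw [Real.sqrt_div (by positivity), div_div, mul_comm (√(x.t * y.t)) 2]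

lemma hdist_eq_hdist_iff (x y x' y' : H3) : hdist x y = hdist x' y' ↔ chord x y = chord x' y' := by
  rw [hdist_eq_chord, hdist_eq_chord]
  constructor
  · intro h
    have h1 := Real.arsinh_injective (mul_left_cancel₀ two_ne_zero h)
    have h2 : √(chord x y) = √(chord x' y') := by linarith
    exact (Real.sqrt_inj (chord_nonneg _ _) (chord_nonneg _ _)).1 h2
  · intro h
    rw [h]

/-- Trading the distance for `chord` removes the square root and `arsinh`, so that being an isometry
becomes a rational identity in the coordinates. -/
lemma mem_Isom_iff (g : Equiv.Perm H3) : g ∈ Isom ↔ ∀ x y, chord (g x) (g y) = chord x y :=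
  forall₂_congr fun _ _ => hdist_eq_hdist_iff _ _ _ _

/-- The extension of an isometry of `ℂ` to hyperbolic space. -/
def ext (e : ℂ ≃ᵢ ℂ) : Equiv.Perm H3 where
  toFun x := pt (e x.z) x.t (t_pos x)
  invFun x := pt (e.symm x.z) x.t (t_pos x)
  left_inv x := H3_ext (by simp) (by simp)
  right_inv x := H3_ext (by simp) (by simp)

@[simp] lemma ext_z (e : ℂ ≃ᵢ ℂ) (x : H3) : (ext e x).z = e x.z := rfl

@[simp] lemma ext_t (e : ℂ ≃ᵢ ℂ) (x : H3) : (ext e x).t = x.t := rfl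

lemma ext_mul (e f : ℂ ≃ᵢ ℂ) : ext e * ext f = ext (f.trans e) := rfl

lemma ext_refl : ext (IsometryEquiv.refl ℂ) = 1 := rfl

/-- The dilation with factor `k`. -/
def dil (k : ℝ) (hk : 0 < k) : Equiv.Perm H3 where
  toFun x := pt (k * x.z) (k * x.t) (mul_pos hk (t_pos x))
  invFun x := pt (k⁻¹ * x.z) (k⁻¹ * x.t) (mul_pos (inv_pos.2 hk) (t_pos x))
  left_inv x := by
    have : (k : ℂ) ≠ 0 := by exact_mod_cast hk.ne'
    exact H3_ext (by simp [this]) (by simp [hk.ne'])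
  right_inv x := by
    have : (k : ℂ) ≠ 0 := by exact_mod_cast hk.ne'
    exact H3_ext (by simp [this]) (by simp [hk.ne'])

@[simp] lemma dil_z (k : ℝ) (hk : 0 < k) (x : H3) : (dil k hk x).z = k * x.z := rfl

@[simp] lemma dil_t (k : ℝ) (hk : 0 < k) (x : H3) : (dil k hk x).t = k * x.t := rfl

lemma dil_one : dil 1 one_pos = 1 := by
  ext x : 1
  exact H3_ext (by simp) (by simp)

/-- Inversion in the unit sphere, as a function. -/
def invFun (x : H3) : H3 := pt (x.z / x.R) (x.t / x.R) (div_pos (t_pos x) (R_pos x))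

lemma invFun_R (x : H3) : (invFun x).R = 1 / x.R := by
  have h : x.R ≠ 0 := (R_pos x).ne'
  have h2 : x.R = ‖x.z‖ ^ 2 + x.t ^ 2 := rfl
  change ‖x.z / (x.R : ℂ)‖ ^ 2 + (x.t / x.R) ^ 2 = 1 / x.R
  rw [norm_div, Complex.norm_real, Real.norm_of_nonneg (R_pos x).le, div_pow, div_pow, ← add_div,
    ← h2]
  field_simp

lemma invFun_invFun (x : H3) : invFun (invFun x) = x := by
  have h : x.R ≠ 0 := (R_pos x).ne'
  have h' : (x.R : ℂ) ≠ 0 := by exact_mod_cast h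
  refine H3_ext ?_ ?_
  · change (x.z / x.R) / ((invFun x).R : ℂ) = x.z
    rw [invFun_R]
    push_cast
    field_simp
  · change (x.t / x.R) / (invFun x).R = x.t
    rw [invFun_R]
    field_simp

/-- Inversion in the unit sphere. -/
def inv : Equiv.Perm H3 where
  toFun := invFun
  invFun := invFun
  left_inv := invFun_invFun
  right_inv := invFun_invFun

lemma inv_z (x : H3) : (inv x).z = x.z / x.R := rfl

lemma inv_t (x : H3) : (inv x).t = x.t / x.R := rfl

lemma inv_R (x : H3) : (inv x).R = 1 / x.R := invFun_R x

lemma inv_inv_apply (x : H3) : inv (inv x) = x := invFun_invFun x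

lemma inv_mul_inv : inv * inv = 1 := by
  ext x : 1
  exact inv_inv_apply x

lemma ext_mem (e : ℂ ≃ᵢ ℂ) : ext e ∈ Isom := by
  rw [mem_Isom_iff]
  intro x y
  simp only [chord, ext_z, ext_t]
  rw [← dist_eq_norm, e.dist_eq, dist_eq_norm]

lemma dil_mem (k : ℝ) (hk : 0 < k) : dil k hk ∈ Isom := by
  rw [mem_Isom_iff]
  intro x y
  have hx := (t_pos x).ne'
  have hy := (t_pos y).ne'
  simp only [chord, dil_z, dil_t, ← mul_sub, norm_mul, Complex.norm_real,
    Real.norm_of_nonneg hk.le]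
  field_simp

lemma norm_sub_sq' (z w : ℂ) : ‖z - w‖ ^ 2 = ‖z‖ ^ 2 + ‖w‖ ^ 2 - 2 * (conj w * z).re := by
  rw [← Complex.normSq_eq_norm_sq, ← Complex.normSq_eq_norm_sq, ← Complex.normSq_eq_norm_sq]
  simp only [Complex.normSq_apply, Complex.sub_re, Complex.sub_im, Complex.mul_re,
    Complex.conj_re, Complex.conj_im]
  ring

/-- This is the Lorentzian form in disguise: the right-hand side is bilinear in the hyperboloid
coordinates `1 / t`, `z / t`, `R / t`. Inversion merely exchanges the first and the last of them. -/
lemma chord_add_two (x y : H3) :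
    chord x y + 2 = (x.R + y.R - 2 * (conj y.z * x.z).re) / (x.t * y.t) := by
  have hx := (t_pos x).ne'
  have hy := (t_pos y).ne'
  unfold chord H3.R
  rw [norm_sub_sq']
  field_simp
  ring

lemma re_conj_div_mul_div (z w : ℂ) (r s : ℝ) :
    (conj (w / s) * (z / r)).re = (conj w * z).re / (r * s) := by
  have : conj (w / (s : ℂ)) * (z / r) = (conj w * z) / ((r * s : ℝ) : ℂ) := by
    rw [map_div₀, Complex.conj_ofReal, div_mul_div_comm]
    push_cast
    ring
  rw [this, Complex.div_ofReal_re]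

lemma inv_mem : inv ∈ Isom := by
  rw [mem_Isom_iff]
  intro x y
  have hx := (t_pos x).ne'
  have hy := (t_pos y).ne'
  have hX := (R_pos x).ne'
  have hY := (R_pos y).ne'
  have : chord (inv x) (inv y) + 2 = chord x y + 2 := by
    rw [chord_add_two, chord_add_two, inv_R, inv_R, inv_z, inv_z, inv_t, inv_t,
      re_conj_div_mul_div]
    field_simp
    ring
  linarith

/-! ## Classification of the isometries -/

/-- If heights are scaled by `k`, preservation of `chord` forces horizontal distances to be scaled
by `k` as well. For two points of one vertical line this shows that the image of `z` does not depend
on the height. -/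
lemma similarity_form {g : Equiv.Perm H3} (hg : g ∈ Isom) {k : ℝ} (hk : ∀ x, (g x).t = k * x.t) :
    ∃ (hk : 0 < k) (e : ℂ ≃ᵢ ℂ), g = dil k hk * ext e := by
  have hk0 : 0 < k := by
    have h1 := t_pos (g (pt 0 1 one_pos))
    rw [hk] at h1
    simpa using h1
  rw [mem_Isom_iff] at hg
  have key : ∀ x y : H3, ‖(g x).z - (g y).z‖ = k * ‖x.z - y.z‖ := by
    intro x y
    have h := hg x y
    have hx := (t_pos x).ne'
    have hy := (t_pos y).ne'
    unfold chord at h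
    rw [hk, hk] at h
    field_simp at h
    have h2 : ‖(g x).z - (g y).z‖ ^ 2 = (k * ‖x.z - y.z‖) ^ 2 := by linarith
    exact (pow_left_inj₀ (norm_nonneg _) (by positivity) two_ne_zero).1 h2
  let f : ℂ → ℂ := fun z => (k : ℂ)⁻¹ * (g (pt z 1 one_pos)).z
  have hf : ∀ x, (g x).z = k * f x.z := by
    intro x
    have h1 := key x (pt x.z 1 one_pos)
    have hkc : (k : ℂ) ≠ 0 := by exact_mod_cast hk0.ne'
    simp only [pt_z, sub_self, norm_zero, mul_zero, norm_eq_zero] at h1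
    simp only [f]
    rw [mul_inv_cancel_left₀ hkc]
    exact sub_eq_zero.1 h1
  have hiso : Isometry f := by
    refine Isometry.of_dist_eq fun z w => ?_
    rw [dist_eq_norm, dist_eq_norm]
    have h1 := key (pt z 1 one_pos) (pt w 1 one_pos)
    simp only [pt_z] at h1
    simp only [f]
    rw [← mul_sub, norm_mul, h1, norm_inv, Complex.norm_real, Real.norm_of_nonneg hk0.le,
      inv_mul_cancel_left₀ hk0.ne']
  have hsurj : Function.Surjective f := by
    intro w
    obtain ⟨x, hx⟩ := g.surjective (pt (k * w) 1 one_pos)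
    refine ⟨x.z, ?_⟩
    have hkc : (k : ℂ) ≠ 0 := by exact_mod_cast hk0.ne'
    have h1 := hf x
    rw [hx] at h1
    exact (mul_left_cancel₀ hkc h1).symm
  refine ⟨hk0, IsometryEquiv.mk (Equiv.ofBijective f ⟨hiso.injective, hsurj⟩) hiso, ?_⟩
  ext x : 1
  exact H3_ext (hf x) (hk x)

/-- The translation by `w`. -/
abbrev trans (w : ℂ) : ℂ ≃ᵢ ℂ := IsometryEquiv.addRight w

/-- Isometries act linearly in hyperboloid coordinates, so `1 / (g x).t` is a linear function of `1
/ x.t`, `x.z / x.t` and `x.R / x.t`. The relation `a * c = ‖b‖ ^ 2` says that this functional comes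
from a point at infinity, the preimage of `∞`. -/
lemma height_formula {g : Equiv.Perm H3} (hg : g ∈ Isom) :
    ∃ (a c : ℝ) (b : ℂ), a * c = ‖b‖ ^ 2 ∧
      ∀ x : H3, x.t / (g x).t = a * x.R + 2 * (conj b * x.z).re + c := by
  rw [mem_Isom_iff] at hg
  obtain ⟨x₁, h₁⟩ := g.surjective (pt 0 1 one_pos)
  obtain ⟨x₂, h₂⟩ := g.surjective (pt 0 2 two_pos)
  have t1 := (t_pos x₁).ne'
  have t2 := (t_pos x₂).ne'
  have h12 := hg x₁ x₂
  rw [h₁, h₂] at h12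
  have e12 : chord (pt 0 1 one_pos) (pt 0 2 two_pos) + 2 = 5 / 2 := by
    rw [chord_add_two]
    simp [H3.R]
    norm_num
  rw [h12, chord_add_two] at e12
  -- The `chord` relations of `g x` with the points at heights 1 and 2 over `0` involve `((g x).R +
  -- 1) / (g x).t` and `((g x).R + 4) / (2 * (g x).t)`. Twice the second minus the first is `3 / (g
  -- x).t`, which gives these coefficients.
  refine ⟨(2 / x₂.t - 1 / x₁.t) / 3, (2 * x₂.R / x₂.t - x₁.R / x₁.t) / 3,
    ((x₁.z / x₁.t) - 2 * x₂.z / x₂.t) / 3, ?_, ?_⟩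
  · have hb : ‖((x₁.z / x₁.t) - 2 * x₂.z / x₂.t) / 3‖ ^ 2 =
        (‖x₁.z‖ ^ 2 / x₁.t ^ 2 + 4 * ‖x₂.z‖ ^ 2 / x₂.t ^ 2
          - 4 * (conj x₂.z * x₁.z).re / (x₁.t * x₂.t)) / 9 := by
      rw [norm_div, div_pow, norm_sub_sq']
      rw [mul_div_assoc, map_mul, mul_assoc, Complex.conj_ofNat]
      have : ((2 : ℂ) * (conj (x₂.z / x₂.t) * (x₁.z / x₁.t))).re =
          2 * ((conj x₂.z * x₁.z).re / (x₁.t * x₂.t)) := by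
        rw [← re_conj_div_mul_div]
        simp [Complex.mul_re]
      rw [this]
      simp only [norm_mul, norm_div, Complex.norm_real, Complex.norm_ofNat, mul_pow, div_pow,
        Real.norm_eq_abs, sq_abs]
      ring
    rw [hb]
    unfold H3.R at e12 ⊢
    field_simp at e12 ⊢
    linear_combination (-9 * x₁.t * x₂.t) * e12
  · intro x
    have hx := (t_pos x).ne'
    have hgx := (t_pos (g x)).ne'
    have k1 := hg x x₁
    have k2 := hg x x₂
    have e1 := chord_add_two (g x) (g x₁)
    have e2 := chord_add_two (g x) (g x₂)
    rw [k1, chord_add_two, h₁] at e1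
    rw [k2, chord_add_two, h₂] at e2
    simp only [H3.R, pt_z, pt_t, map_zero, zero_mul, Complex.zero_re, norm_zero] at e1 e2
    have hb : (conj (((x₁.z / x₁.t) - 2 * x₂.z / x₂.t) / 3) * x.z).re =
        ((conj x₁.z * x.z).re / x₁.t - 2 * (conj x₂.z * x.z).re / x₂.t) / 3 := by
      have : conj (((x₁.z / (x₁.t : ℂ)) - 2 * x₂.z / x₂.t) / 3) * x.z =
          ((conj x₁.z * x.z) / (x₁.t : ℂ) - 2 * (conj x₂.z * x.z) / (x₂.t : ℂ)) / (3 : ℝ) := by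
        simp only [map_div₀, map_sub, map_mul, Complex.conj_ofReal, Complex.conj_ofNat]
        push_cast
        ring
      rw [this, Complex.div_ofReal_re, Complex.sub_re, Complex.div_ofReal_re, mul_div_assoc]
      have h2 : (2 * (conj x₂.z * x.z / (x₂.t : ℂ))).re = 2 * ((conj x₂.z * x.z / (x₂.t : ℂ))).re := by
        simp [Complex.mul_re]
      rw [h2, Complex.div_ofReal_re]
      ring
    rw [hb]
    unfold H3.R
    field_simp at e1 e2 ⊢
    linear_combination x₂.t * e1 - x₁.t * e2

/-- By `height_formula` the ratio of heights is either constant, and `similarity_form` applies, or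
it is `a` times the squared Euclidean distance to a point `w` of `ℂ`. In the second case composition
with the inversion centred at `w` reduces to the first. -/
theorem isometry_classification {g : Equiv.Perm H3} (hg : g ∈ Isom) :
    (∃ (k : ℝ) (hk : 0 < k) (e : ℂ ≃ᵢ ℂ), g = dil k hk * ext e) ∨
      ∃ (k : ℝ) (hk : 0 < k) (e : ℂ ≃ᵢ ℂ) (w : ℂ),
        g = dil k hk * ext e * inv * ext (trans (-w)) := by
  obtain ⟨a, c, b, habc, h⟩ := height_formula hg
  by_cases ha : a = 0
  · left
    have hb : b = 0 := by
      rw [ha, zero_mul] at habc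
      simpa using habc.symm
    have h' : ∀ x : H3, x.t / (g x).t = c := fun x => by simpa [ha, hb] using h x
    have hc : 0 < c := by
      rw [← h' (pt 0 1 one_pos)]
      exact div_pos (t_pos _) (t_pos _)
    obtain ⟨hk, e, he⟩ := similarity_form hg (k := c⁻¹) (fun x => by
      have h1 := h' x
      have h2 := (t_pos (g x)).ne'
      field_simp at h1 ⊢
      linarith)
    exact ⟨_, hk, e, he⟩
  · right
    -- The only zero on `ℂ` of the quadratic function of `height_formula`, that is, the point that
    -- goes to `∞`.
    let w : ℂ := -(b / a)
    let q : Equiv.Perm H3 := inv * ext (trans (-w))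
    have hq : q ∈ Isom := Isom.mul_mem inv_mem (ext_mem _)
    have hac : (a : ℂ) ≠ 0 := by exact_mod_cast ha
    have hR : ∀ x : H3, a * x.R + 2 * (conj b * x.z).re + c = a * (ext (trans (-w)) x).R := by
      intro x
      have e1 : ‖x.z - w‖ ^ 2 = ‖x.z‖ ^ 2 + ‖b‖ ^ 2 / a ^ 2 + 2 * ((conj b * x.z).re / a) := by
        rw [norm_sub_sq']
        have : conj w * x.z = -((conj b * x.z) / (a : ℂ)) := by
          simp only [w, map_neg, map_div₀, Complex.conj_ofReal]
          ring
        rw [this, Complex.neg_re, Complex.div_ofReal_re]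
        simp only [w, norm_neg, norm_div, Complex.norm_real, div_pow, Real.norm_eq_abs, sq_abs]
        ring
      have e2 : (ext (trans (-w)) x).R = ‖x.z - w‖ ^ 2 + x.t ^ 2 := by
        simp [H3.R, sub_eq_add_neg]
      rw [e2, e1, ← habc]
      unfold H3.R
      field_simp
      ring
    have hk : ∀ x, ((g * q⁻¹) x).t = a⁻¹ * x.t := by
      intro y
      obtain ⟨x, rfl⟩ := q.surjective y
      have e1 : (g * q⁻¹) (q x) = g x := by simp [Equiv.Perm.mul_apply]
      have e2 : (q x).t = x.t / (ext (trans (-w)) x).R := rfl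
      have h1 := h x
      rw [hR] at h1
      rw [e1, e2]
      have h2 := (t_pos (g x)).ne'
      have h3 := (R_pos (ext (trans (-w)) x)).ne'
      field_simp at h1 ⊢
      linarith
    obtain ⟨hk', e, he⟩ := similarity_form (Isom.mul_mem hg (Isom.inv_mem hq)) hk
    refine ⟨_, hk', e, w, ?_⟩
    rw [mul_assoc _ inv, ← he]
    exact (inv_mul_cancel_right g q).symm

/-! ## Planes under isometries, continuity of isometries -/

lemma isometry_form (e : ℂ ≃ᵢ ℂ) :
    ∃ u b : ℂ, ‖u‖ = 1 ∧ ((∀ z, e z = u * z + b) ∨ ∀ z, e z = u * conj z + b) := by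
  let A := e.toRealAffineIsometryEquiv
  have hA : ∀ z, e z = A.linearIsometryEquiv z + e 0 := by
    intro z
    have h1 := A.map_vadd 0 z
    simpa [A] using h1
  obtain ⟨u, hu⟩ := linear_isometry_complex A.linearIsometryEquiv
  refine ⟨u, e 0, Circle.norm_coe u, ?_⟩
  rcases hu with hu | hu
  · left
    intro z
    rw [hA, hu]
    simp
  · right
    intro z
    rw [hA, hu]
    simp

/-- `g` pulls planes back to planes. -/
def PullsBackPlanes (g : Equiv.Perm H3) : Prop :=
  ∀ S : Plane, ∃ S' : Plane, g ⁻¹' S.halfSpace = S'.halfSpace ∧ g ⁻¹' S.carrier = S'.carrier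

lemma PullsBackPlanes.mul {g h : Equiv.Perm H3} (hg : PullsBackPlanes g) (hh : PullsBackPlanes h) :
    PullsBackPlanes (g * h) := by
  intro S
  obtain ⟨S', h1, h2⟩ := hg S
  obtain ⟨S'', h3, h4⟩ := hh S'
  refine ⟨S'', ?_, ?_⟩
  · rw [← h3, ← h1]
    rfl
  · rw [← h4, ← h2]
    rfl

lemma pullsBackPlanes_of_eval {g : Equiv.Perm H3}
    (h : ∀ S : Plane, ∃ S' : Plane, ∀ x : H3, ∃ m > 0,
      S.eval (g x).z (g x).t = m * S'.eval x.z x.t) : PullsBackPlanes g := by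
  intro S
  obtain ⟨S', hS⟩ := h S
  refine ⟨S', ?_, ?_⟩
  · ext x
    obtain ⟨m, hm, hx⟩ := hS x
    simp only [Plane.halfSpace, mem_preimage, mem_ofPred_eq, hx, mul_nonneg_iff_of_pos_left hm]
  · ext x
    obtain ⟨m, hm, hx⟩ := hS x
    simp only [Plane.carrier, mem_preimage, mem_ofPred_eq, hx, mul_eq_zero, hm.ne', false_or]

lemma eval_eq (S : Plane) (x : H3) :
    S.eval x.z x.t = S.a * x.R + 2 * (conj S.b * x.z).re + S.c := rfl

/-- The image of a plane under the inversion. -/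
def Plane.swap (S : Plane) : Plane := ⟨S.c, S.b, S.a, by rw [mul_comm]; exact S.nondeg⟩

lemma eval_inv (S : Plane) (x : H3) :
    S.eval (inv x).z (inv x).t = (1 / x.R) * S.swap.eval x.z x.t := by
  have hx := (R_pos x).ne'
  have h : (conj S.b * (x.z / x.R)).re = (conj S.b * x.z).re / x.R := by
    rw [← mul_div_assoc, Complex.div_ofReal_re]
  rw [eval_eq, eval_eq, inv_R, inv_z, h]
  simp only [Plane.swap]
  field_simp
  ring

lemma pullsBackPlanes_inv : PullsBackPlanes inv :=
  pullsBackPlanes_of_eval fun S => ⟨S.swap, fun x => ⟨1 / x.R, one_div_pos.2 (R_pos x), eval_inv S x⟩⟩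

lemma pullsBackPlanes_dil (k : ℝ) (hk : 0 < k) : PullsBackPlanes (dil k hk) := by
  refine pullsBackPlanes_of_eval fun S => ⟨⟨S.a * k ^ 2, S.b * k, S.c, ?_⟩, fun x => ⟨1, one_pos, ?_⟩⟩
  · have := S.nondeg
    rw [norm_mul, Complex.norm_real, Real.norm_of_nonneg hk.le]
    have := pow_pos hk 2
    nlinarith
  · simp only [Plane.eval, dil_z, dil_t, norm_mul, Complex.norm_real, Real.norm_of_nonneg hk.le,
      map_mul, Complex.conj_ofReal]
    rw [mul_assoc (conj S.b)]
    ring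

lemma exists_plane_eval_isometry (e : ℂ ≃ᵢ ℂ) (S : Plane) :
    ∃ S' : Plane, ∀ z t, S.eval (e z) t = S'.eval z t := by
  obtain ⟨u, b, hu, h⟩ := isometry_form e
  have hu2 : u.re * u.re + u.im * u.im = 1 := by
    rw [← Complex.normSq_apply, Complex.normSq_eq_norm_sq, hu, one_pow]
  have hS := S.nondeg
  -- The difference of the two sides equals `‖S.b‖ ^ 2 - S.a * S.c`: the discriminant is invariant
  -- under translation.
  have key : S.a * (S.a * ‖b‖ ^ 2 + 2 * (conj S.b * b).re + S.c) < ‖S.a * b + S.b‖ ^ 2 := by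
    simp only [← Complex.normSq_eq_norm_sq, Complex.normSq_apply, Complex.mul_re, Complex.mul_im,
      Complex.conj_re, Complex.conj_im, Complex.add_re, Complex.add_im, Complex.ofReal_re,
      Complex.ofReal_im] at hS ⊢
    nlinarith
  rcases h with h | h
  · refine ⟨⟨S.a, conj u * (S.a * b + S.b), S.a * ‖b‖ ^ 2 + 2 * (conj S.b * b).re + S.c, ?_⟩,
      fun z t => ?_⟩
    · rw [norm_mul, RCLike.norm_conj, hu, one_mul]
      exact key
    · simp only [Plane.eval, h, ← Complex.normSq_eq_norm_sq, Complex.normSq_apply, Complex.mul_re,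
        Complex.mul_im, Complex.conj_re, Complex.conj_im, Complex.add_re, Complex.add_im,
        Complex.ofReal_re, Complex.ofReal_im]
      linear_combination S.a * (z.re * z.re + z.im * z.im) * hu2
  · refine ⟨⟨S.a, u * conj (S.a * b + S.b), S.a * ‖b‖ ^ 2 + 2 * (conj S.b * b).re + S.c, ?_⟩,
      fun z t => ?_⟩
    · rw [norm_mul, RCLike.norm_conj, hu, one_mul]
      exact key
    · simp only [Plane.eval, h, ← Complex.normSq_eq_norm_sq, Complex.normSq_apply, Complex.mul_re,
        Complex.mul_im, Complex.conj_re, Complex.conj_im, Complex.add_re, Complex.add_im,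
        Complex.ofReal_re, Complex.ofReal_im]
      linear_combination S.a * (z.re * z.re + z.im * z.im) * hu2

lemma pullsBackPlanes_ext (e : ℂ ≃ᵢ ℂ) : PullsBackPlanes (ext e) := by
  refine pullsBackPlanes_of_eval fun S => ?_
  obtain ⟨S', h⟩ := exists_plane_eval_isometry e S
  exact ⟨S', fun x => ⟨1, one_pos, by simp [h]⟩⟩

lemma pullsBackPlanes {g : Equiv.Perm H3} (hg : g ∈ Isom) : PullsBackPlanes g := by
  rcases isometry_classification hg with ⟨k, hk, e, rfl⟩ | ⟨k, hk, e, w, rfl⟩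
  · exact (pullsBackPlanes_dil k hk).mul (pullsBackPlanes_ext e)
  · exact (((pullsBackPlanes_dil k hk).mul (pullsBackPlanes_ext e)).mul pullsBackPlanes_inv).mul
      (pullsBackPlanes_ext _)

lemma continuous_R : Continuous H3.R :=
  ((continuous_z.norm).pow 2).add (continuous_t.pow 2)

lemma continuous_ext (e : ℂ ≃ᵢ ℂ) : Continuous (ext e) :=
  continuous_H3 (e.continuous.comp continuous_z) continuous_t

lemma continuous_dil (k : ℝ) (hk : 0 < k) : Continuous (dil k hk) :=
  continuous_H3 (continuous_const.mul continuous_z) (continuous_const.mul continuous_t)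

lemma continuous_inv : Continuous inv := by
  refine continuous_H3 (f := inv) (continuous_z.div (Complex.continuous_ofReal.comp continuous_R)
    fun x => ?_) (continuous_t.div continuous_R fun x => (R_pos x).ne')
  exact_mod_cast (R_pos x).ne'

lemma continuous_of_mem_Isom {g : Equiv.Perm H3} (hg : g ∈ Isom) : Continuous g := by
  rcases isometry_classification hg with ⟨k, hk, e, rfl⟩ | ⟨k, hk, e, w, rfl⟩
  · exact (continuous_dil k hk).comp (continuous_ext e)
  · exact (((continuous_dil k hk).comp (continuous_ext e)).comp continuous_inv).comp
      (continuous_ext _)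

/-! ## The action of isometries on the sphere at infinity -/

lemma idealNhds_coe (w : ℂ) :
    idealNhds (w : OnePoint ℂ) = comap (fun x : H3 => (x.z, x.t)) (𝓝 (w, 0)) := by
  unfold idealNhds
  rw [OnePoint.map_some, ← OnePoint.comap_coe_nhds ((w, 0) : ℂ × ℝ), comap_comap]
  rfl

lemma tendsto_idealNhds_coe {α : Type*} {l : Filter α} {f : α → H3} {w : ℂ} :
    Tendsto f l (idealNhds (w : OnePoint ℂ)) ↔
      Tendsto (fun a => (f a).z) l (𝓝 w) ∧ Tendsto (fun a => (f a).t) l (𝓝 0) := by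
  rw [idealNhds_coe, tendsto_comap_iff]
  exact Prod.tendsto_iff _ _

lemma tendsto_norm_atTop_iff_R {α : Type*} {l : Filter α} {f : α → H3} :
    Tendsto (fun a => ‖((f a).z, (f a).t)‖) l atTop ↔ Tendsto (fun a => (f a).R) l atTop := by
  constructor
  · intro h
    refine tendsto_atTop_mono (fun a => ?_) ((tendsto_pow_atTop two_ne_zero).comp h)
    rw [Function.comp_apply, Prod.norm_def]
    unfold H3.R
    rcases max_choice ‖(f a).z‖ ‖(f a).t‖ with h | h
    · rw [h]
      exact le_add_of_nonneg_right (sq_nonneg _)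
    · rw [h, Real.norm_eq_abs, sq_abs]
      exact le_add_of_nonneg_left (sq_nonneg _)
  · intro h
    refine tendsto_atTop_mono (fun a => ?_) ((Real.tendsto_sqrt_atTop.comp h).atTop_div_const two_pos)
    rw [Function.comp_apply, div_le_iff₀ two_pos]
    refine Real.sqrt_le_iff.2 ⟨by positivity, ?_⟩
    have h1 : ‖(f a).z‖ ≤ ‖((f a).z, (f a).t)‖ := norm_fst_le _
    have h2 : ‖(f a).t‖ ≤ ‖((f a).z, (f a).t)‖ := norm_snd_le ((f a).z, (f a).t)
    rw [Real.norm_of_nonneg (t_pos _).le] at h2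
    unfold H3.R
    have := norm_nonneg (f a).z
    have := t_pos (f a)
    nlinarith

lemma tendsto_idealNhds_infty {α : Type*} {l : Filter α} {f : α → H3} :
    Tendsto f l (idealNhds ∞) ↔ Tendsto (fun a => (f a).R) l atTop := by
  rw [← tendsto_norm_atTop_iff_R]
  have : idealNhds ∞ = comap (fun x : H3 => (x.z, x.t)) (cocompact (ℂ × ℝ)) := by
    unfold idealNhds
    rw [OnePoint.map_infty, ← coclosedCompact_eq_cocompact, ← OnePoint.comap_coe_nhds_infty,
      comap_comap]
    rfl
  rw [this, tendsto_comap_iff, ← Metric.cobounded_eq_cocompact, ← comap_norm_atTop,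
    tendsto_comap_iff]
  rfl

instance (p : OnePoint ℂ) : (idealNhds p).NeBot := by
  have h0 : Tendsto (fun n : ℕ => 1 / ((n : ℝ) + 1)) atTop (𝓝 0) :=
    tendsto_one_div_add_atTop_nhds_zero_nat
  induction p using OnePoint.rec with
  | infty =>
    have h : Tendsto (fun n : ℕ => pt 0 ((n : ℝ) + 1) (by positivity)) atTop (idealNhds ∞) := by
      rw [tendsto_idealNhds_infty]
      refine tendsto_atTop_mono (fun n => ?_) tendsto_natCast_atTop_atTop
      simp only [H3.R, pt_z, pt_t, norm_zero]
      nlinarith [Nat.cast_nonneg (α := ℝ) n]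
    exact NeBot.mono inferInstance h
  | coe w =>
    have h : Tendsto (fun n : ℕ => pt w (1 / ((n : ℝ) + 1)) (by positivity)) atTop
        (idealNhds (w : OnePoint ℂ)) := by
      rw [tendsto_idealNhds_coe]
      exact ⟨tendsto_const_nhds, h0⟩
    exact NeBot.mono inferInstance h

lemma SendsIdeal.unique {g : Equiv.Perm H3} {p q q' : OnePoint ℂ} (h : SendsIdeal g p q)
    (h' : SendsIdeal g p q') : q = q' := by
  have h1 := tendsto_comap_iff.1 h
  have h2 := tendsto_comap_iff.1 h'
  have h3 := tendsto_nhds_unique h1 h2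
  induction q using OnePoint.rec with
  | infty =>
    induction q' using OnePoint.rec with
    | infty => rfl
    | coe w => simp at h3
  | coe v =>
    induction q' using OnePoint.rec with
    | infty => simp at h3
    | coe w =>
      rw [OnePoint.map_some, OnePoint.map_some, OnePoint.coe_eq_coe, Prod.mk.injEq] at h3
      rw [h3.1]

lemma SendsIdeal.mul {g h : Equiv.Perm H3} {p q r : OnePoint ℂ} (hg : SendsIdeal g q r)
    (hh : SendsIdeal h p q) : SendsIdeal (g * h) p r :=
  Filter.Tendsto.comp (g := g) hg hh

lemma sendsIdeal_one (p : OnePoint ℂ) : SendsIdeal 1 p p := tendsto_id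

lemma tendsto_z_coe (w : ℂ) : Tendsto H3.z (idealNhds (w : OnePoint ℂ)) (𝓝 w) :=
  (tendsto_idealNhds_coe.1 tendsto_id).1

lemma tendsto_t_coe (w : ℂ) : Tendsto H3.t (idealNhds (w : OnePoint ℂ)) (𝓝 0) :=
  (tendsto_idealNhds_coe.1 tendsto_id).2

lemma tendsto_R_infty : Tendsto H3.R (idealNhds ∞) atTop :=
  tendsto_idealNhds_infty.1 tendsto_id

lemma tendsto_R_coe (w : ℂ) : Tendsto H3.R (idealNhds (w : OnePoint ℂ)) (𝓝 (‖w‖ ^ 2)) := by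
  have h := ((tendsto_z_coe w).norm.pow 2).add ((tendsto_t_coe w).pow 2)
  rw [zero_pow two_ne_zero, add_zero] at h
  exact h

lemma sendsIdeal_ext_coe (e : ℂ ≃ᵢ ℂ) (w : ℂ) : SendsIdeal (ext e) w (e w) :=
  tendsto_idealNhds_coe.2 ⟨(e.continuous.tendsto w).comp (tendsto_z_coe w), tendsto_t_coe w⟩

lemma sendsIdeal_ext_infty (e : ℂ ≃ᵢ ℂ) : SendsIdeal (ext e) ∞ ∞ := by
  unfold SendsIdeal
  rw [tendsto_idealNhds_infty]
  -- From `‖z‖ ≤ ‖e z‖ + ‖e 0‖` and `(p + q) ^ 2 ≤ 2 * p ^ 2 + 2 * q ^ 2`.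
  have h : ∀ x : H3, x.R / 2 - ‖e 0‖ ^ 2 ≤ (ext e x).R := by
    intro x
    simp only [H3.R, ext_z, ext_t]
    have h1 : ‖x.z‖ = ‖e x.z - e 0‖ := by
      rw [← dist_eq_norm, e.dist_eq, dist_eq_norm, sub_zero]
    have h2 : ‖x.z‖ ≤ ‖e x.z‖ + ‖e 0‖ := h1 ▸ norm_sub_le _ _
    have := norm_nonneg x.z
    nlinarith [sq_nonneg (‖e x.z‖ - ‖e 0‖), sq_nonneg x.t]
  exact tendsto_atTop_mono h
    (tendsto_atTop_add_const_right _ _ (tendsto_R_infty.atTop_div_const two_pos))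

lemma sendsIdeal_dil_coe (k : ℝ) (hk : 0 < k) (w : ℂ) :
    SendsIdeal (dil k hk) w ((k * w : ℂ) : OnePoint ℂ) := by
  refine tendsto_idealNhds_coe.2 ⟨(tendsto_z_coe w).const_mul _, ?_⟩
  simpa using (tendsto_t_coe w).const_mul k

lemma sendsIdeal_dil_infty (k : ℝ) (hk : 0 < k) : SendsIdeal (dil k hk) ∞ ∞ := by
  unfold SendsIdeal
  rw [tendsto_idealNhds_infty]
  have h : ∀ x : H3, (dil k hk x).R = k ^ 2 * x.R := by
    intro x
    simp only [H3.R, dil_z, dil_t, norm_mul, Complex.norm_real, Real.norm_of_nonneg hk.le]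
    ring
  simp only [h]
  exact tendsto_R_infty.const_mul_atTop (by positivity)

lemma sendsIdeal_inv_infty : SendsIdeal inv ∞ (0 : ℂ) := by
  have h0 : Tendsto (fun x : H3 => 1 / √x.R) (idealNhds ∞) (𝓝 0) := by
    have := (Real.tendsto_sqrt_atTop.comp tendsto_R_infty).inv_tendsto_atTop
    simp only [one_div]
    exact this
  have hz : ∀ x : H3, ‖(inv x).z‖ ≤ 1 / √x.R ∧ (inv x).t ≤ 1 / √x.R := by
    intro x
    have hR := R_pos x
    have hs := Real.sqrt_pos.2 hR
    have h1 : ‖x.z‖ ≤ √x.R := Real.le_sqrt_of_sq_le (le_add_of_nonneg_right (sq_nonneg _))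
    have h2 : x.t ≤ √x.R := Real.le_sqrt_of_sq_le (le_add_of_nonneg_left (sq_nonneg _))
    rw [inv_z, inv_t, norm_div, Complex.norm_real, Real.norm_of_nonneg hR.le]
    constructor
    · rw [div_le_div_iff₀ hR hs, one_mul]
      calc ‖x.z‖ * √x.R ≤ √x.R * √x.R := by gcongr
        _ = x.R := Real.mul_self_sqrt hR.le
    · rw [div_le_div_iff₀ hR hs, one_mul]
      calc x.t * √x.R ≤ √x.R * √x.R := by gcongr
        _ = x.R := Real.mul_self_sqrt hR.le
  refine tendsto_idealNhds_coe.2 ⟨squeeze_zero_norm (fun x => (hz x).1) h0,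
    squeeze_zero (fun x => (t_pos _).le) (fun x => (hz x).2) h0⟩

lemma sendsIdeal_inv_zero : SendsIdeal inv (0 : ℂ) ∞ := by
  unfold SendsIdeal
  rw [tendsto_idealNhds_infty]
  simp only [inv_R, one_div]
  refine tendsto_inv_nhdsGT_zero.comp (tendsto_nhdsWithin_iff.2 ⟨?_, .of_forall R_pos⟩)
  simpa using tendsto_R_coe 0

lemma sendsIdeal_inv_coe {w : ℂ} (hw : w ≠ 0) :
    SendsIdeal inv w ((w / (‖w‖ ^ 2 : ℝ) : ℂ) : OnePoint ℂ) := by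
  have hn : ‖w‖ ^ 2 ≠ 0 := by simpa using hw
  refine tendsto_idealNhds_coe.2 ⟨?_, ?_⟩
  · exact (tendsto_z_coe w).div ((Complex.continuous_ofReal.tendsto _).comp (tendsto_R_coe w))
      (by exact_mod_cast hn)
  · have h := (tendsto_t_coe w).div (tendsto_R_coe w) hn
    rw [zero_div] at h
    exact h

lemma exists_sendsIdeal_inv (p : OnePoint ℂ) : ∃ q, SendsIdeal inv p q := by
  induction p using OnePoint.rec with
  | infty => exact ⟨_, sendsIdeal_inv_infty⟩
  | coe w =>
    by_cases hw : w = 0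
    · subst hw
      exact ⟨_, sendsIdeal_inv_zero⟩
    · exact ⟨_, sendsIdeal_inv_coe hw⟩

lemma exists_sendsIdeal_ext (e : ℂ ≃ᵢ ℂ) (p : OnePoint ℂ) : ∃ q, SendsIdeal (ext e) p q := by
  induction p using OnePoint.rec with
  | infty => exact ⟨_, sendsIdeal_ext_infty e⟩
  | coe w => exact ⟨_, sendsIdeal_ext_coe e w⟩

lemma exists_sendsIdeal_dil (k : ℝ) (hk : 0 < k) (p : OnePoint ℂ) :
    ∃ q, SendsIdeal (dil k hk) p q := by
  induction p using OnePoint.rec with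
  | infty => exact ⟨_, sendsIdeal_dil_infty k hk⟩
  | coe w => exact ⟨_, sendsIdeal_dil_coe k hk w⟩

lemma exists_sendsIdeal {g : Equiv.Perm H3} (hg : g ∈ Isom) (p : OnePoint ℂ) :
    ∃ q, SendsIdeal g p q := by
  rcases isometry_classification hg with ⟨k, hk, e, rfl⟩ | ⟨k, hk, e, w, rfl⟩
  · obtain ⟨q, hq⟩ := exists_sendsIdeal_ext e p
    obtain ⟨r, hr⟩ := exists_sendsIdeal_dil k hk q
    exact ⟨r, hr.mul hq⟩
  · obtain ⟨q, hq⟩ := exists_sendsIdeal_ext (trans (-w)) p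
    obtain ⟨r, hr⟩ := exists_sendsIdeal_inv q
    obtain ⟨s, hs⟩ := exists_sendsIdeal_ext e r
    obtain ⟨u, hu⟩ := exists_sendsIdeal_dil k hk s
    exact ⟨u, ((hu.mul hs).mul hr).mul hq⟩

lemma SendsIdeal.inv {g : Equiv.Perm H3} (hg : g ∈ Isom) {p q : OnePoint ℂ}
    (h : SendsIdeal g p q) : SendsIdeal g⁻¹ q p := by
  obtain ⟨p', hp'⟩ := exists_sendsIdeal (Isom.inv_mem hg) q
  have h1 := hp'.mul h
  rw [inv_mul_cancel] at h1
  rwa [(sendsIdeal_one p).unique h1]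

/-- The isometries that fix `∞` are the similarities. -/
lemma similarity_of_sendsIdeal {g : Equiv.Perm H3} (hg : g ∈ Isom) (h : SendsIdeal g ∞ ∞) :
    ∃ (k : ℝ) (hk : 0 < k) (e : ℂ ≃ᵢ ℂ), g = dil k hk * ext e := by
  rcases isometry_classification hg with h1 | ⟨k, hk, e, w, rfl⟩
  · exact h1
  · have h2 := (((sendsIdeal_dil_coe k hk _).mul (sendsIdeal_ext_coe e 0)).mul
      sendsIdeal_inv_infty).mul (sendsIdeal_ext_infty (trans (-w)))
    exact absurd (h.unique h2) (OnePoint.infty_ne_coe _)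

/-! ## Parabolic fixed points under conjugation -/

/-- The conjugate of `Γ` by `φ`. -/
abbrev conjBy (φ : Equiv.Perm H3) (Γ : Subgroup (Equiv.Perm H3)) : Subgroup (Equiv.Perm H3) :=
  Γ.map (MulAut.conj φ).toMonoidHom

lemma mem_conjBy {φ g : Equiv.Perm H3} {Γ : Subgroup (Equiv.Perm H3)} :
    g ∈ conjBy φ Γ ↔ ∃ γ ∈ Γ, φ * γ * φ⁻¹ = g := by
  simp [conjBy, Subgroup.mem_map]

lemma conjBy_le {φ : Equiv.Perm H3} (hφ : φ ∈ Isom) {Γ : Subgroup (Equiv.Perm H3)}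
    (hΓ : Γ ≤ Isom) : conjBy φ Γ ≤ Isom := by
  intro g hg
  obtain ⟨γ, hγ, rfl⟩ := mem_conjBy.1 hg
  exact Isom.mul_mem (Isom.mul_mem hφ (hΓ hγ)) (Isom.inv_mem hφ)

lemma conjBy_conjBy (φ ψ : Equiv.Perm H3) (Γ : Subgroup (Equiv.Perm H3)) :
    conjBy φ (conjBy ψ Γ) = conjBy (φ * ψ) Γ := by
  ext g
  simp only [mem_conjBy]
  constructor
  · rintro ⟨_, ⟨γ, hγ, rfl⟩, rfl⟩
    exact ⟨γ, hγ, by group⟩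
  · rintro ⟨γ, hγ, rfl⟩
    exact ⟨_, ⟨γ, hγ, rfl⟩, by group⟩

lemma conjBy_one (Γ : Subgroup (Equiv.Perm H3)) : conjBy 1 Γ = Γ := by
  ext g
  simp

lemma conjBy_inv_conjBy (φ : Equiv.Perm H3) (Γ : Subgroup (Equiv.Perm H3)) :
    conjBy φ⁻¹ (conjBy φ Γ) = Γ := by
  rw [conjBy_conjBy, inv_mul_cancel, conjBy_one]

lemma IsParabolicFixedPoint.conjBy {φ : Equiv.Perm H3} (hφ : φ ∈ Isom)
    {Γ : Subgroup (Equiv.Perm H3)} {p q : OnePoint ℂ} (hp : IsParabolicFixedPoint Γ p)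
    (hpq : SendsIdeal φ p q) : IsParabolicFixedPoint (conjBy φ Γ) q := by
  obtain ⟨g, hg, hfix, hgp, huniq⟩ := hp
  refine ⟨φ * g * φ⁻¹, mem_conjBy.2 ⟨g, hg, rfl⟩, fun x hx => ?_,
    (hpq.mul hgp).mul (hpq.inv hφ), fun r hr => ?_⟩
  · refine hfix (φ⁻¹ x) (φ.injective ?_)
    exact hx.trans (φ.apply_symm_apply x).symm
  · obtain ⟨s, hs⟩ := exists_sendsIdeal (Isom.inv_mem hφ) r
    have hs' := hs.inv (Isom.inv_mem hφ)
    rw [inv_inv] at hs'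
    have h1 := (hs.mul hr).mul hs'
    have h2 : φ⁻¹ * (φ * g * φ⁻¹) * φ = g := by group
    rw [h2] at h1
    rw [huniq s h1] at hs'
    exact hs'.unique hpq

lemma OneCusped.conjBy {φ : Equiv.Perm H3} (hφ : φ ∈ Isom) {Γ : Subgroup (Equiv.Perm H3)}
    (h : OneCusped Γ) : OneCusped (conjBy φ Γ) := by
  obtain ⟨p, hp, hall⟩ := h
  obtain ⟨p', hp'⟩ := exists_sendsIdeal hφ p
  refine ⟨p', hp.conjBy hφ hp', fun q hq => ?_⟩
  obtain ⟨q', hq'⟩ := exists_sendsIdeal (Isom.inv_mem hφ) q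
  have h1 := hq.conjBy (Isom.inv_mem hφ) hq'
  rw [conjBy_inv_conjBy] at h1
  obtain ⟨g, hg, hgq⟩ := hall q' h1
  exact ⟨φ * g * φ⁻¹, mem_conjBy.2 ⟨g, hg, rfl⟩, (hp'.mul hgq).mul hq'⟩

lemma OneCusped.exists_sendsIdeal {Γ : Subgroup (Equiv.Perm H3)} (h : OneCusped Γ)
    (hΓ : Γ ≤ Isom) {p q : OnePoint ℂ} (hp : IsParabolicFixedPoint Γ p)
    (hq : IsParabolicFixedPoint Γ q) : ∃ γ ∈ Γ, SendsIdeal γ p q := by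
  obtain ⟨r, -, hall⟩ := h
  obtain ⟨g, hg, hgp⟩ := hall p hp
  obtain ⟨g', hg', hgq⟩ := hall q hq
  exact ⟨g'⁻¹ * g, Γ.mul_mem (Γ.inv_mem hg') hg, (hgq.inv (hΓ hg')).mul hgp⟩

lemma isParabolicFixedPoint_infty {Γ : Subgroup (Equiv.Perm H3)} {b : ℂ} (hb : b ≠ 0)
    (h : ext (trans b) ∈ Γ) : IsParabolicFixedPoint Γ ∞ := by
  refine ⟨_, h, fun x hx => hb ?_, sendsIdeal_ext_infty _, fun q hq => ?_⟩
  · simpa using congrArg H3.z hx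
  · induction q using OnePoint.rec with
    | infty => rfl
    | coe w =>
      have h1 := hq.unique (sendsIdeal_ext_coe _ w)
      rw [OnePoint.coe_eq_coe] at h1
      exact absurd (by simpa using h1) hb

/-! ## The two standard tiles -/

/-- The two kinds of tiles. -/
inductive Kind
  | tet
  | oct

instance : Inhabited Kind := ⟨.tet⟩

/-- The tile in standard position. -/
def std : Kind → Set H3
  | .tet => stdTetrahedron
  | .oct => stdOctahedron

/-- The corners of the polygon over which the standard tile lies. -/
def corners : Kind → Set ℂ
  | .tet => {0, 1, omega}
  | .oct => {0, 1, 1 + Complex.I, Complex.I}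

/-- The centre of the polygon. -/
def center : Kind → ℂ
  | .tet => (1 + omega) / 3
  | .oct => (1 + Complex.I) / 2

/-- The squared circumradius of the polygon. -/
def rsq : Kind → ℝ
  | .tet => 1 / 3
  | .oct => 1 / 2

/-- The finite ideal vertices of the standard tile. -/
def vertices : Kind → Set ℂ
  | .tet => {0, 1, omega}
  | .oct => {0, 1, 1 + Complex.I, Complex.I, (1 + Complex.I) / 2}

/-- The polygon over which the standard tile lies. -/
def poly (K : Kind) : Set ℂ := convexHull ℝ (corners K)

@[simp] lemma omega_re : omega.re = 1 / 2 := by simp [omega]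

@[simp] lemma omega_im : omega.im = √3 / 2 := by simp [omega]

lemma sqrt_three_sq : √3 * √3 = (3 : ℝ) := Real.mul_self_sqrt (by norm_num)

@[simp] lemma center_tet_re : (center .tet).re = 1 / 2 := by
  simp only [center, Complex.div_ofNat_re, Complex.add_re, Complex.one_re, omega_re]
  norm_num

@[simp] lemma center_tet_im : (center .tet).im = √3 / 6 := by
  simp only [center, Complex.div_ofNat_im, Complex.add_im, Complex.one_im, omega_im]
  ring

@[simp] lemma center_oct_re : (center .oct).re = 1 / 2 := by
  simp [center, Complex.div_ofNat_re]

@[simp] lemma center_oct_im : (center .oct).im = 1 / 2 := by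
  simp [center, Complex.div_ofNat_im]

/-- The set of points over `A` which lie in the hyperbolic convex hull of `A` and `∞`. -/
def hullInf (A : Set ℂ) : Set H3 :=
  {x | ∀ S : Plane, 0 ≤ S.a → (∀ v ∈ A, 0 ≤ S.eval v 0) → 0 ≤ S.eval x.z x.t}

lemma hasIdeal_infty (S : Plane) : S.HasIdeal ∞ ↔ 0 ≤ S.a := Iff.rfl

lemma hasIdeal_coe (S : Plane) (w : ℂ) : S.HasIdeal w ↔ 0 ≤ S.eval w 0 := Iff.rfl

lemma std_eq (K : Kind) : std K = hullInf (vertices K) := by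
  cases K
  · ext x
    simp only [std, stdTetrahedron, idealHull, hullInf, vertices, mem_insert_iff,
      mem_singleton_iff, forall_eq_or_imp, forall_eq, hasIdeal_infty, hasIdeal_coe,
      Plane.halfSpace, mem_ofPred_eq]
    exact forall_congr' fun S => by tauto
  · ext x
    simp only [std, stdOctahedron, idealHull, hullInf, vertices, mem_insert_iff,
      mem_singleton_iff, forall_eq_or_imp, forall_eq, hasIdeal_infty, hasIdeal_coe,
      Plane.halfSpace, mem_ofPred_eq]
    exact forall_congr' fun S => by tauto

/-- The real affine functions on `ℂ`. -/
def aff (b : ℂ) (c : ℝ) (z : ℂ) : ℝ := 2 * (conj b * z).re + c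

lemma aff_eq (b : ℂ) (c : ℝ) (z : ℂ) : aff b c z = 2 * (b.re * z.re + b.im * z.im) + c := by
  simp [aff, Complex.mul_re]

lemma convex_aff (b : ℂ) (c : ℝ) : Convex ℝ {z | 0 ≤ aff b c z} := by
  intro z hz w hw α β hα hβ hαβ
  simp only [mem_ofPred_eq, aff_eq, Complex.add_re, Complex.add_im, Complex.real_smul,
    Complex.mul_re, Complex.mul_im, Complex.ofReal_re, Complex.ofReal_im] at *
  have h1 := mul_nonneg hα hz
  have h2 := mul_nonneg hβ hw
  have : c = α * c + β * c := by rw [← add_mul, hαβ, one_mul]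
  rw [this]
  linarith

lemma aff_nonneg_of_hull {A : Set ℂ} {b : ℂ} {c : ℝ} (h : ∀ v ∈ A, 0 ≤ aff b c v) :
    ∀ z ∈ convexHull ℝ A, 0 ≤ aff b c z :=
  fun _ hz => convexHull_min (t := {z | 0 ≤ aff b c z}) h (convex_aff b c) hz

lemma sum_three_mem {C : Set ℂ} (hC : Convex ℝ C) {a b c : ℂ} (ha : a ∈ C) (hb : b ∈ C)
    (hc : c ∈ C) {α β γ : ℝ} (hα : 0 ≤ α) (hβ : 0 ≤ β) (hγ : 0 ≤ γ) (h : α + β + γ = 1) :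
    (α : ℂ) * a + β * b + γ * c ∈ C := by
  have := hC.sum_mem (t := Finset.univ) (w := ![α, β, γ]) (z := ![a, b, c])
    (by intro i _; fin_cases i <;> assumption) (by simpa [Fin.sum_univ_three] using h)
    (by intro i _; fin_cases i <;> assumption)
  simpa [Fin.sum_univ_three] using this

lemma mem_poly_tet {z : ℂ} : z ∈ poly .tet ↔ 0 ≤ z.im ∧ z.im ≤ √3 * z.re ∧
    z.im ≤ √3 * (1 - z.re) := by
  have h3 := sqrt_three_sq
  have h3p : 0 < √3 := by positivity
  constructor
  · intro hz
    have h1 := aff_nonneg_of_hull (A := corners .tet) (b := ⟨0, 1 / 2⟩) (c := 0) (by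
      simp only [corners, mem_insert_iff, mem_singleton_iff]
      rintro v (rfl | rfl | rfl) <;> (simp [aff_eq]; try nlinarith)) z hz
    have h2 := aff_nonneg_of_hull (A := corners .tet) (b := ⟨√3 / 2, -1 / 2⟩) (c := 0) (by
      simp only [corners, mem_insert_iff, mem_singleton_iff]
      rintro v (rfl | rfl | rfl) <;> (simp [aff_eq]; try nlinarith)) z hz
    have h4 := aff_nonneg_of_hull (A := corners .tet) (b := ⟨-√3 / 2, -1 / 2⟩) (c := √3) (by
      simp only [corners, mem_insert_iff, mem_singleton_iff]
      rintro v (rfl | rfl | rfl) <;> (simp [aff_eq]; try nlinarith)) z hz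
    simp only [aff_eq] at h1 h2 h4
    refine ⟨by linarith, by linarith, by linarith⟩
  · rintro ⟨h1, h2, h4⟩
    have hw : z = ((1 - z.re - z.im / √3 : ℝ) : ℂ) * 0 + ((z.re - z.im / √3 : ℝ) : ℂ) * 1 +
        ((2 * (z.im / √3) : ℝ) : ℂ) * omega := by
      apply Complex.ext
      · simp
        ring
      · simp
        field_simp
    have hd : z.im / √3 * √3 = z.im := div_mul_cancel₀ _ h3p.ne'
    rw [hw]
    refine sum_three_mem (convex_convexHull ℝ _) (subset_convexHull ℝ _ ?_)
      (subset_convexHull ℝ _ ?_) (subset_convexHull ℝ _ ?_) ?_ ?_ ?_ (by ring)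
    · simp [corners]
    · simp [corners]
    · simp [corners]
    · nlinarith
    · nlinarith
    · positivity

lemma mem_poly_oct {z : ℂ} : z ∈ poly .oct ↔ 0 ≤ z.re ∧ z.re ≤ 1 ∧ 0 ≤ z.im ∧ z.im ≤ 1 := by
  constructor
  · intro hz
    have h1 := aff_nonneg_of_hull (A := corners .oct) (b := ⟨1 / 2, 0⟩) (c := 0) (by
      simp only [corners, mem_insert_iff, mem_singleton_iff]
      rintro v (rfl | rfl | rfl | rfl) <;> (simp [aff_eq]; try nlinarith)) z hz
    have h2 := aff_nonneg_of_hull (A := corners .oct) (b := ⟨-1 / 2, 0⟩) (c := 1) (by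
      simp only [corners, mem_insert_iff, mem_singleton_iff]
      rintro v (rfl | rfl | rfl | rfl) <;> (simp [aff_eq]; try nlinarith)) z hz
    have h3 := aff_nonneg_of_hull (A := corners .oct) (b := ⟨0, 1 / 2⟩) (c := 0) (by
      simp only [corners, mem_insert_iff, mem_singleton_iff]
      rintro v (rfl | rfl | rfl | rfl) <;> (simp [aff_eq]; try nlinarith)) z hz
    have h4 := aff_nonneg_of_hull (A := corners .oct) (b := ⟨0, -1 / 2⟩) (c := 1) (by
      simp only [corners, mem_insert_iff, mem_singleton_iff]
      rintro v (rfl | rfl | rfl | rfl) <;> (simp [aff_eq]; try nlinarith)) z hz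
    simp only [aff_eq] at h1 h2 h3 h4
    refine ⟨by linarith, by linarith, by linarith, by linarith⟩
  · rintro ⟨h1, h2, h3, h4⟩
    have hC : Convex ℝ (poly .oct) := convex_convexHull ℝ _
    have m0 : (0 : ℂ) ∈ poly .oct := subset_convexHull ℝ _ (by simp [corners])
    have m1 : (1 : ℂ) ∈ poly .oct := subset_convexHull ℝ _ (by simp [corners])
    have m2 : (1 + Complex.I : ℂ) ∈ poly .oct := subset_convexHull ℝ _ (by simp [corners])
    have m3 : (Complex.I : ℂ) ∈ poly .oct := subset_convexHull ℝ _ (by simp [corners])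
    have e1 := hC m0 m1 (sub_nonneg.2 h2) h1 (by ring)
    have e2 := hC m3 m2 (sub_nonneg.2 h2) h1 (by ring)
    have e3 := hC e1 e2 (sub_nonneg.2 h4) h3 (by ring)
    convert e3 using 1
    apply Complex.ext
    · simp
      ring
    · simp
      ring

lemma corners_subset_vertices (K : Kind) : corners K ⊆ vertices K := by
  cases K
  · rfl
  · intro x hx
    simp only [corners, vertices, mem_insert_iff, mem_singleton_iff] at *
    tauto

lemma corners_subset_poly (K : Kind) : corners K ⊆ poly K := subset_convexHull ℝ _

lemma center_mem_poly (K : Kind) : center K ∈ poly K := by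
  have h3 := sqrt_three_sq
  have h3p : 0 < √3 := by positivity
  cases K
  · rw [mem_poly_tet]
    simp only [center_tet_re, center_tet_im]
    refine ⟨by positivity, by linarith, by linarith⟩
  · rw [mem_poly_oct]
    simp only [center_oct_re, center_oct_im]
    norm_num

lemma vertices_subset_poly (K : Kind) : vertices K ⊆ poly K := by
  cases K
  · exact subset_convexHull ℝ _
  · intro x hx
    have h : x ∈ corners .oct ∨ x = center .oct := by
      simp only [corners, vertices, center, mem_insert_iff, mem_singleton_iff] at *
      tauto
    rcases h with h | rfl
    · exact subset_convexHull ℝ _ h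
    · exact center_mem_poly _

lemma vertices_finite (K : Kind) : (vertices K).Finite := by
  cases K <;> simp [vertices]

lemma corners_finite (K : Kind) : (corners K).Finite :=
  (vertices_finite K).subset (corners_subset_vertices K)

lemma zero_mem_corners (K : Kind) : (0 : ℂ) ∈ corners K := by cases K <;> simp [corners]

lemma isClosed_poly (K : Kind) : IsClosed (poly K) := (corners_finite K).isClosed_convexHull ℝ

/-- A line that separates `x.z` from the polygon is the trace of a vertical plane, and that plane
has all ideal vertices on one side and `x` on the other. -/
lemma z_mem_poly {K : Kind} {x : H3} (hx : x ∈ std K) : x.z ∈ poly K := by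
  by_contra hz
  obtain ⟨f, u, hf, hu⟩ := geometric_hahn_banach_point_closed (convex_convexHull ℝ (corners K))
    (isClosed_poly K) hz
  have hfe : ∀ z : ℂ, f z = z.re * f 1 + z.im * f Complex.I := by
    intro z
    conv_lhs => rw [show z = z.re • (1 : ℂ) + z.im • Complex.I by simp]
    rw [map_add, _root_.map_smul, _root_.map_smul, smul_eq_mul, smul_eq_mul]
  let b : ℂ := ⟨f 1 / 2, f Complex.I / 2⟩
  have hb : ∀ z, 2 * (conj b * z).re = f z := by
    intro z
    rw [hfe]
    simp only [b, Complex.mul_re, Complex.conj_re, Complex.conj_im]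
    ring
  have hb0 : b ≠ 0 := by
    intro h0
    have h1 := hu 0 (corners_subset_poly K (zero_mem_corners K))
    rw [← hb, h0] at hf h1
    simp at hf h1
    linarith
  rw [std_eq] at hx
  have h1 := hx ⟨0, b, -u, by rw [zero_mul]; positivity⟩ le_rfl (fun v hv => by
    have := hu v (vertices_subset_poly K hv)
    simp only [Plane.eval, hb]
    linarith)
  simp only [Plane.eval, hb] at h1
  linarith

lemma norm_sub_center {K : Kind} {v : ℂ} (hv : v ∈ corners K) :
    ‖v - center K‖ ^ 2 = rsq K := by
  have h3 := sqrt_three_sq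
  rw [← Complex.normSq_eq_norm_sq, Complex.normSq_apply]
  cases K <;> simp only [corners, mem_insert_iff, mem_singleton_iff] at hv
  · rcases hv with rfl | rfl | rfl <;> simp [rsq] <;> nlinarith
  · rcases hv with rfl | rfl | rfl | rfl <;> simp [rsq] <;> norm_num

/-- Splits off `S.a` times the equation of the hemisphere over the circumscribed circle. That term
vanishes at the corners, so what remains is an affine function with the values of `S` there, and its
sign on the polygon is decided at the corners. -/
lemma eval_decomposition (S : Plane) (K : Kind) (z : ℂ) (t : ℝ) :
    S.eval z t = aff (S.b + S.a * center K) (S.c - S.a * (‖center K‖ ^ 2 - rsq K)) z +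
      S.a * (‖z - center K‖ ^ 2 + t ^ 2 - rsq K) := by
  simp only [Plane.eval, aff_eq, ← Complex.normSq_eq_norm_sq, Complex.normSq_apply,
    Complex.mul_re, Complex.mul_im, Complex.conj_re, Complex.conj_im, Complex.add_re,
    Complex.add_im, Complex.sub_re, Complex.sub_im, Complex.ofReal_re, Complex.ofReal_im]
  ring

lemma aff_nonneg_of_hasIdeal {S : Plane} {K : Kind} (hS : ∀ v ∈ corners K, 0 ≤ S.eval v 0) :
    ∀ z ∈ poly K, 0 ≤ aff (S.b + S.a * center K) (S.c - S.a * (‖center K‖ ^ 2 - rsq K)) z := by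
  refine aff_nonneg_of_hull fun v hv => ?_
  have h1 := hS v hv
  rw [eval_decomposition S K, norm_sub_center hv] at h1
  linarith

/-- Over the polygon and above height `√(rsq K)` both terms of `eval_decomposition` are nonnegative.
As `rsq K < 1`, the tile is a full prism from height one on. -/
lemma mem_std {K : Kind} {x : H3} (hz : x.z ∈ poly K) (ht : rsq K ≤ x.t ^ 2) : x ∈ std K := by
  rw [std_eq]
  intro S ha hS
  have h1 := aff_nonneg_of_hasIdeal (S := S) (K := K)
    (fun v hv => hS v (corners_subset_vertices K hv)) x.z hz
  rw [eval_decomposition S K]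
  have : 0 ≤ ‖x.z - center K‖ ^ 2 + x.t ^ 2 - rsq K := by
    have := sq_nonneg ‖x.z - center K‖
    linarith
  positivity

lemma rsq_lt_one (K : Kind) : rsq K < 1 := by cases K <;> norm_num [rsq]

lemma rsq_lt_sq {K : Kind} {t : ℝ} (ht : 1 ≤ t) : rsq K < t ^ 2 := by
  have := rsq_lt_one K
  nlinarith

lemma mem_std_of_one_le {K : Kind} {x : H3} (hz : x.z ∈ poly K) (ht : 1 ≤ x.t) : x ∈ std K :=
  mem_std hz (rsq_lt_sq ht).le

lemma corner_mem_std {K : Kind} {x : H3} (hz : x.z ∈ corners K) : x ∈ std K := by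
  rw [std_eq]
  intro S ha hS
  have h1 := hS _ (corners_subset_vertices K hz)
  have : S.eval x.z x.t = S.eval x.z 0 + S.a * x.t ^ 2 := by
    simp only [Plane.eval]
    ring
  rw [this]
  positivity

/-- The vertical lines over the corners lie in the tile. Along them, `t → ∞` gives the sign of `S.a`
and `t → 0` the sign at the corner. -/
lemma hasIdeal_of_subset {S : Plane} {K : Kind} (hS : std K ⊆ S.halfSpace) :
    0 ≤ S.a ∧ ∀ v ∈ corners K, 0 ≤ S.eval v 0 := by
  have key : ∀ v ∈ corners K, ∀ t > 0, 0 ≤ S.eval v 0 + S.a * t ^ 2 := by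
    intro v hv t ht
    have h1 : 0 ≤ S.eval v t := hS (corner_mem_std (x := pt v t ht) hv)
    have : S.eval v t = S.eval v 0 + S.a * t ^ 2 := by
      simp only [Plane.eval]
      ring
    rwa [← this]
  constructor
  · by_contra! ha
    -- The height `√(m / -S.a)` makes the quadratic term equal to `-m`, which outweighs the value at
    -- the corner.
    let m := |S.eval 0 0| + 1
    have hm : 0 < m := by positivity
    have h1 := key 0 (zero_mem_corners K) (√(m / -S.a))
      (Real.sqrt_pos.2 (div_pos hm (neg_pos.2 ha)))
    rw [Real.sq_sqrt (div_pos hm (neg_pos.2 ha)).le] at h1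
    have h2 : S.a * (m / -S.a) = -m := by
      have := ha.ne
      field_simp
    have := le_abs_self (S.eval 0 0)
    rw [h2] at h1
    simp only [m] at h1
    linarith
  · intro v hv
    have h1 : Tendsto (fun t : ℝ => S.eval v 0 + S.a * t ^ 2) (𝓝[>] 0)
        (𝓝 (S.eval v 0 + S.a * 0 ^ 2)) := by
      have : Continuous fun t : ℝ => S.eval v 0 + S.a * t ^ 2 := by fun_prop
      exact (this.tendsto 0).mono_left nhdsWithin_le_nhds
    have h2 := ge_of_tendsto h1 (eventually_nhdsWithin_of_forall (key v hv))
    simpa using h2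

/-- A face of a standard tile that contains a point high up is vertical. -/
lemma vertical_face {K : Kind} {F : Set H3} (hF : IsFace (std K) F) {x : H3} (hx : x ∈ F)
    (ht : 1 ≤ x.t) : ∃ (b : ℂ) (c : ℝ), b ≠ 0 ∧ (∀ z ∈ poly K, 0 ≤ aff b c z) ∧
      F = {y ∈ std K | aff b c y.z = 0} := by
  obtain ⟨S, hS, rfl⟩ := hF
  obtain ⟨ha, hv⟩ := hasIdeal_of_subset hS
  have h1 := aff_nonneg_of_hasIdeal hv
  have h2 : S.eval x.z x.t = 0 := hx.2
  -- Both terms of `eval_decomposition` are nonnegative at `x` and add up to zero. The factor of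
  -- `S.a` is positive, because `x` lies strictly above the circumscribed hemisphere.
  have ha0 : S.a = 0 := by
    have h3 := h1 x.z (z_mem_poly hx.1)
    rw [eval_decomposition S K] at h2
    have h4 : 0 < ‖x.z - center K‖ ^ 2 + x.t ^ 2 - rsq K := by
      have := sq_nonneg ‖x.z - center K‖
      have := rsq_lt_sq (K := K) ht
      linarith
    by_contra h5
    have := mul_pos (lt_of_le_of_ne ha (Ne.symm h5)) h4
    linarith
  have he : ∀ z t, S.eval z t = aff S.b S.c z := by
    intro z t
    simp [Plane.eval, aff, ha0]
  refine ⟨S.b, S.c, ?_, ?_, ?_⟩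
  · have := S.nondeg
    rw [ha0, zero_mul] at this
    intro h0
    simp [h0] at this
  · simpa [ha0] using h1
  · ext y
    simp only [Plane.carrier, mem_inter_iff, mem_ofPred_eq, he]

/-! ### Supporting lines of the polygons -/

lemma dist_eq_one_iff {z w : ℂ} :
    dist z w = 1 ↔ (z.re - w.re) * (z.re - w.re) + (z.im - w.im) * (z.im - w.im) = 1 := by
  rw [dist_eq_norm, ← sq_eq_sq₀ (norm_nonneg _) zero_le_one, one_pow, ← Complex.normSq_eq_norm_sq,
    Complex.normSq_apply, Complex.sub_re, Complex.sub_im]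

/-- The value at the centre is the mean of the nonnegative values at the corners; if it is zero, the
function vanishes at all corners and is constant. -/
lemma aff_center_ne_zero {K : Kind} {b : ℂ} {c : ℝ} (hb : b ≠ 0)
    (h : ∀ z ∈ poly K, 0 ≤ aff b c z) : aff b c (center K) ≠ 0 := by
  intro h0
  have h3 : 0 < √3 := by positivity
  have h3' := sqrt_three_sq
  apply hb
  cases K
  · have e1 := h 0 (corners_subset_poly _ (by simp [corners]))
    have e2 := h 1 (corners_subset_poly _ (by simp [corners]))
    have e3 := h omega (corners_subset_poly _ (by simp [corners]))
    simp only [aff_eq, center_tet_re, center_tet_im, Complex.zero_re, Complex.zero_im,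
      Complex.one_re, Complex.one_im, omega_re, omega_im] at h0 e1 e2 e3
    have f1 : b.re = 0 := by linarith
    have f2 : b.im * √3 = 0 := by
      rw [f1] at *
      linarith
    exact Complex.ext f1 ((mul_eq_zero.1 f2).resolve_right h3.ne')
  · have e1 := h 0 (corners_subset_poly _ (by simp [corners]))
    have e2 := h 1 (corners_subset_poly _ (by simp [corners]))
    have e3 := h (1 + Complex.I) (corners_subset_poly _ (by simp [corners]))
    have e4 := h Complex.I (corners_subset_poly _ (by simp [corners]))
    simp only [aff_eq, center_oct_re, center_oct_im, Complex.zero_re, Complex.zero_im,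
      Complex.one_re, Complex.one_im, Complex.add_re, Complex.add_im, Complex.I_re,
      Complex.I_im] at h0 e1 e2 e3 e4
    exact Complex.ext (by simp; linarith) (by simp; linarith)

lemma dist_corners_tet {v w : ℂ} (hv : v ∈ corners .tet) (hw : w ∈ corners .tet) (h : v ≠ w) :
    dist v w = 1 := by
  have h3 := sqrt_three_sq
  rw [dist_eq_one_iff]
  simp only [corners, mem_insert_iff, mem_singleton_iff] at hv hw
  rcases hv with rfl | rfl | rfl <;> rcases hw with rfl | rfl | rfl <;>
    first
    | exact absurd rfl h
    | (simp <;> nlinarith)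

lemma dist_le_one_of_mem_tet {y y' : ℂ} (hy : y ∈ poly .tet) (hy' : y' ∈ poly .tet) :
    dist y y' ≤ 1 := by
  obtain ⟨v, hv, w, hw, h⟩ := convexHull_exists_dist_ge2 hy hy'
  refine h.trans ?_
  by_cases hvw : v = w
  · simp [hvw]
  · exact (dist_corners_tet hv hw hvw).le

/-- Along an edge, the function of a supporting line of the square varies with one coordinate
only. -/
lemma supporting_square {b : ℂ} {c : ℝ} (h : ∀ z ∈ poly .oct, 0 ≤ aff b c z) {y : ℂ}
    (hy : y ∈ poly .oct) (h0 : aff b c y = 0) :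
    (b.re = 0 ∨ y.re = 0 ∨ y.re = 1) ∧ (b.im = 0 ∨ y.im = 0 ∨ y.im = 1) ∧
    (0 < b.re → y.re = 0) ∧ (b.re < 0 → y.re = 1) ∧ (0 < b.im → y.im = 0) ∧
    (b.im < 0 → y.im = 1) := by
  rw [mem_poly_oct] at hy
  obtain ⟨h1, h2, h3, h4⟩ := hy
  have e1 := h ⟨0, y.im⟩ (by rw [mem_poly_oct]; simp; exact ⟨h3, h4⟩)
  have e2 := h ⟨1, y.im⟩ (by rw [mem_poly_oct]; simp; exact ⟨h3, h4⟩)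
  have e3 := h ⟨y.re, 0⟩ (by rw [mem_poly_oct]; simp; exact ⟨h1, h2⟩)
  have e4 := h ⟨y.re, 1⟩ (by rw [mem_poly_oct]; simp; exact ⟨h1, h2⟩)
  simp only [aff_eq] at h0 e1 e2 e3 e4
  have a1 : 0 < b.re → y.re = 0 := fun hp => by nlinarith
  have a2 : b.re < 0 → y.re = 1 := fun hp => by nlinarith
  have a3 : 0 < b.im → y.im = 0 := fun hp => by nlinarith
  have a4 : b.im < 0 → y.im = 1 := fun hp => by nlinarith
  refine ⟨?_, ?_, a1, a2, a3, a4⟩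
  · rcases lt_trichotomy b.re 0 with h | h | h
    · exact Or.inr (Or.inr (a2 h))
    · exact Or.inl h
    · exact Or.inr (Or.inl (a1 h))
  · rcases lt_trichotomy b.im 0 with h | h | h
    · exact Or.inr (Or.inr (a4 h))
    · exact Or.inl h
    · exact Or.inr (Or.inl (a3 h))

lemma dist_le_one_of_supporting {K : Kind} {b : ℂ} {c : ℝ} (hb : b ≠ 0)
    (h : ∀ z ∈ poly K, 0 ≤ aff b c z) {y y' : ℂ} (hy : y ∈ poly K) (hy' : y' ∈ poly K)
    (h0 : aff b c y = 0) (h0' : aff b c y' = 0) : dist y y' ≤ 1 := by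
  cases K
  · exact dist_le_one_of_mem_tet hy hy'
  · obtain ⟨-, -, a1, a2, a3, a4⟩ := supporting_square h hy h0
    obtain ⟨-, -, a1', a2', a3', a4'⟩ := supporting_square h hy' h0'
    rw [mem_poly_oct] at hy hy'
    have key : (y.re - y'.re) * (y.re - y'.re) + (y.im - y'.im) * (y.im - y'.im) ≤ 1 := by
      rcases lt_trichotomy b.re 0 with hp | hp | hp
      · rw [a2 hp, a2' hp]
        nlinarith
      · rcases lt_trichotomy b.im 0 with hq | hq | hq
        · rw [a4 hq, a4' hq]
          nlinarith
        · exact absurd (Complex.ext hp hq) hb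
        · rw [a3 hq, a3' hq]
          nlinarith
      · rw [a1 hp, a1' hp]
        nlinarith
    rw [dist_eq_norm, ← sq_le_sq₀ (norm_nonneg _) zero_le_one, one_pow,
      ← Complex.normSq_eq_norm_sq, Complex.normSq_apply]
    exact key

/-- A supporting line meets the polygon in one corner or along an edge, and edges have length 1.
With the upper bound of `dist_le_one_of_supporting`, this makes the length of a common edge
determine the scale of a neighbouring tile. -/
lemma supporting_alternative {K : Kind} {b : ℂ} {c : ℝ}
    (h : ∀ z ∈ poly K, 0 ≤ aff b c z) {z : ℂ} (hz : z ∈ poly K) (h0 : aff b c z = 0) :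
    (z ∈ corners K ∧ ∀ y ∈ poly K, aff b c y = 0 → y = z) ∨
      ∃ y ∈ poly K, ∃ y' ∈ poly K, aff b c y = 0 ∧ aff b c y' = 0 ∧ dist y y' = 1 := by
  cases K
  · have h3p : 0 < √3 := by positivity
    have m1 : (0 : ℂ) ∈ corners .tet := by simp [corners]
    have m2 : (1 : ℂ) ∈ corners .tet := by simp [corners]
    have m3 : omega ∈ corners .tet := by simp [corners]
    have e1 := h 0 (corners_subset_poly _ m1)
    have e2 := h 1 (corners_subset_poly _ m2)
    have e3 := h omega (corners_subset_poly _ m3)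
    have n12 : (0 : ℂ) ≠ 1 := zero_ne_one
    have n13 : (0 : ℂ) ≠ omega := fun h => by simpa using congrArg Complex.re h
    have n23 : (1 : ℂ) ≠ omega := fun h => by
      have := congrArg Complex.re h
      norm_num at this
    -- The value at `y` is the combination of the three corner values with the barycentric
    -- coordinates of `y`. All summands are nonnegative, so each of them vanishes.
    have key : ∀ y ∈ poly .tet, aff b c y = 0 →
        (1 - y.re - y.im / √3) * aff b c 0 = 0 ∧ (y.re - y.im / √3) * aff b c 1 = 0 ∧
          (2 * (y.im / √3)) * aff b c omega = 0 := by
      intro y hy hy0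
      rw [mem_poly_tet] at hy
      have hd : y.im / √3 * √3 = y.im := div_mul_cancel₀ _ h3p.ne'
      have p1 : 0 ≤ (1 - y.re - y.im / √3) * aff b c 0 := mul_nonneg (by nlinarith) e1
      have p2 : 0 ≤ (y.re - y.im / √3) * aff b c 1 := mul_nonneg (by nlinarith) e2
      have p3 : 0 ≤ (2 * (y.im / √3)) * aff b c omega :=
        mul_nonneg (mul_nonneg two_pos.le (div_nonneg hy.1 h3p.le)) e3
      have hs : (1 - y.re - y.im / √3) * aff b c 0 + (y.re - y.im / √3) * aff b c 1 +
          (2 * (y.im / √3)) * aff b c omega = aff b c y := by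
        simp only [aff_eq, Complex.zero_re, Complex.zero_im, Complex.one_re, Complex.one_im,
          omega_re, omega_im]
        field_simp
        ring
      rw [hy0] at hs
      refine ⟨by linarith, by linarith, by linarith⟩
    have pair : ∀ v ∈ corners .tet, ∀ w ∈ corners .tet, v ≠ w → aff b c v = 0 → aff b c w = 0 →
        ∃ y ∈ poly .tet, ∃ y' ∈ poly .tet, aff b c y = 0 ∧ aff b c y' = 0 ∧ dist y y' = 1 :=
      fun v hv w hw hvw h1 h2 => ⟨v, corners_subset_poly _ hv, w, corners_subset_poly _ hw, h1, h2,
        dist_corners_tet hv hw hvw⟩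
    have corner : ∀ v ∈ corners .tet, (∀ y ∈ poly .tet, aff b c y = 0 → y = v) →
        (z ∈ corners .tet ∧ ∀ y ∈ poly .tet, aff b c y = 0 → y = z) := fun v hv hy =>
      ⟨(hy z hz h0).symm ▸ hv, fun y h1 h2 => (hy y h1 h2).trans (hy z hz h0).symm⟩
    have im0 : ∀ y : ℂ, 2 * (y.im / √3) = 0 → y.im = 0 := fun y hy => by
      have hd : y.im / √3 * √3 = y.im := div_mul_cancel₀ _ h3p.ne'
      nlinarith
    by_cases z1 : aff b c 0 = 0
    · by_cases z2 : aff b c 1 = 0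
      · exact Or.inr (pair _ m1 _ m2 n12 z1 z2)
      · by_cases z3 : aff b c omega = 0
        · exact Or.inr (pair _ m1 _ m3 n13 z1 z3)
        · refine Or.inl (corner 0 m1 fun y hy hy0 => ?_)
          obtain ⟨-, k2, k3⟩ := key y hy hy0
          have k2 := (mul_eq_zero.1 k2).resolve_right z2
          have k3 := im0 y ((mul_eq_zero.1 k3).resolve_right z3)
          rw [k3, zero_div] at k2
          exact Complex.ext (by simpa using k2) k3
    · by_cases z2 : aff b c 1 = 0
      · by_cases z3 : aff b c omega = 0
        · exact Or.inr (pair _ m2 _ m3 n23 z2 z3)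
        · refine Or.inl (corner 1 m2 fun y hy hy0 => ?_)
          obtain ⟨k1, -, k3⟩ := key y hy hy0
          have k1 := (mul_eq_zero.1 k1).resolve_right z1
          have k3 := im0 y ((mul_eq_zero.1 k3).resolve_right z3)
          rw [k3, zero_div] at k1
          exact Complex.ext (by simp; linarith) k3
      · refine Or.inl (corner omega m3 fun y hy hy0 => ?_)
        obtain ⟨k1, k2, -⟩ := key y hy hy0
        have k1 := (mul_eq_zero.1 k1).resolve_right z1
        have k2 := (mul_eq_zero.1 k2).resolve_right z2
        have hd : y.im / √3 * √3 = y.im := div_mul_cancel₀ _ h3p.ne'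
        refine Complex.ext (by simp; linarith) ?_
        have : y.im / √3 = 1 / 2 := by linarith
        rw [this] at hd
        simp
        linarith
  · obtain ⟨c1, c2, a1, a2, a3, a4⟩ := supporting_square h hz h0
    have hz' := mem_poly_oct.1 hz
    by_cases hp : b.re = 0
    · right
      refine ⟨⟨0, z.im⟩, ?_, ⟨1, z.im⟩, ?_, ?_, ?_, ?_⟩
      · rw [mem_poly_oct]
        simp [hz'.2.2.1, hz'.2.2.2]
      · rw [mem_poly_oct]
        simp [hz'.2.2.1, hz'.2.2.2]
      · simpa [aff_eq, hp] using h0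
      · simpa [aff_eq, hp] using h0
      · simp [dist_eq_norm, Complex.norm_def, Complex.normSq_apply]
    · by_cases hq : b.im = 0
      · right
        refine ⟨⟨z.re, 0⟩, ?_, ⟨z.re, 1⟩, ?_, ?_, ?_, ?_⟩
        · rw [mem_poly_oct]
          simp [hz'.1, hz'.2.1]
        · rw [mem_poly_oct]
          simp [hz'.1, hz'.2.1]
        · simpa [aff_eq, hq] using h0
        · simpa [aff_eq, hq] using h0
        · simp [dist_eq_norm, Complex.norm_def, Complex.normSq_apply]
      · left
        constructor
        · rcases c1.resolve_left hp with k1 | k1 <;> rcases c2.resolve_left hq with k2 | k2 <;>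
            simp [corners, Complex.ext_iff, k1, k2]
        · intro y hy hy0
          obtain ⟨-, -, b1, b2, b3, b4⟩ := supporting_square h hy hy0
          refine Complex.ext ?_ ?_
          · rcases lt_or_gt_of_ne hp with hp | hp
            · rw [a2 hp, b2 hp]
            · rw [a1 hp, b1 hp]
          · rcases lt_or_gt_of_ne hq with hq | hq
            · rw [a4 hq, b4 hq]
            · rw [a3 hq, b3 hq]

/-! ## Symmetries of the standard tiles -/

lemma ext_hullInf_subset (e : ℂ ≃ᵢ ℂ) (A : Set ℂ) : ext e '' hullInf A ⊆ hullInf (e '' A) := by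
  rintro _ ⟨x, hx, rfl⟩ S ha hS
  obtain ⟨S', hS'⟩ := exists_plane_eval_isometry e S
  -- The values at heights 0 and 1 over one point differ by the leading coefficient. Hence the
  -- condition at `∞` is preserved.
  have h1 : S'.a = S.a := by
    have e1 := hS' 0 0
    have e2 := hS' 0 1
    simp only [Plane.eval] at e1 e2
    linarith
  rw [ext_z, ext_t, hS']
  refine hx S' (h1 ▸ ha) fun v hv => ?_
  rw [← hS']
  exact hS _ (mem_image_of_mem _ hv)

lemma ext_hullInf (e : ℂ ≃ᵢ ℂ) (A : Set ℂ) : ext e '' hullInf A = hullInf (e '' A) := by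
  refine (ext_hullInf_subset e A).antisymm fun x hx => ?_
  have h1 := ext_hullInf_subset e.symm (e '' A) (mem_image_of_mem _ hx)
  rw [← image_comp] at h1
  have h2 : ⇑e.symm ∘ ⇑e = id := by
    ext z
    simp
  rw [h2, image_id] at h1
  exact ⟨_, h1, (ext e).apply_symm_apply x⟩

/-- The inversion permutes the ideal vertices: it exchanges `0` and `∞`, fixes the vertices of norm
1, and for the octahedron exchanges `1 + i` and `(1 + i) / 2`. -/
lemma inv_mem_std {K : Kind} {x : H3} (hx : x ∈ std K) : inv x ∈ std K := by
  rw [std_eq] at *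
  intro S ha hS
  rw [eval_inv]
  refine mul_nonneg (one_div_pos.2 (R_pos x)).le (hx S.swap ?_ ?_)
  · have h0 := hS 0 (corners_subset_vertices K (zero_mem_corners K))
    simpa [Plane.eval, Plane.swap] using h0
  · have h3 := sqrt_three_sq
    have h3p : 0 < √3 := by positivity
    cases K <;> simp only [vertices, mem_insert_iff, mem_singleton_iff, forall_eq_or_imp, forall_eq,
      Plane.eval, Plane.swap, ← Complex.normSq_eq_norm_sq, Complex.normSq_apply, Complex.mul_re,
      Complex.conj_re, Complex.conj_im, Complex.zero_re, Complex.zero_im, Complex.one_re,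
      Complex.one_im, omega_re, omega_im, Complex.add_re, Complex.add_im, Complex.I_re,
      Complex.I_im, Complex.div_ofNat_re, Complex.div_ofNat_im] at hS ⊢
    · obtain ⟨h1, h2, h4⟩ := hS
      refine ⟨by linarith, by linarith, ?_⟩
      have : (1 / 2 * (1 / 2) + √3 / 2 * (√3 / 2) + 0 ^ 2 : ℝ) = 1 := by linarith
      rw [this] at h4 ⊢
      linarith
    · obtain ⟨h1, h2, h4, h5, h6⟩ := hS
      refine ⟨by linarith, by linarith, by linarith, by linarith, by linarith⟩

lemma image_inv_std (K : Kind) : inv '' std K = std K := by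
  refine Subset.antisymm ?_ fun x hx => ⟨inv x, inv_mem_std hx, inv_inv_apply x⟩
  rintro _ ⟨x, hx, rfl⟩
  exact inv_mem_std hx

/-- The isometry `z ↦ u * z + b`. -/
def rotIso (u b : ℂ) (hu : ‖u‖ = 1) : ℂ ≃ᵢ ℂ :=
  IsometryEquiv.mk' (fun z => u * z + b) (fun z => u⁻¹ * (z - b))
    (fun z => by
      have : u ≠ 0 := fun h => by simp [h] at hu
      field_simp
      ring)
    (Isometry.of_dist_eq fun z w => by
      rw [dist_eq_norm, dist_eq_norm, add_sub_add_right_eq_sub, ← mul_sub, norm_mul, hu, one_mul])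

@[simp] lemma rotIso_apply (u b : ℂ) (hu : ‖u‖ = 1) (z : ℂ) : rotIso u b hu z = u * z + b := rfl

/-- The isometry `z ↦ u * conj z + b`. -/
def reflIso (u b : ℂ) (hu : ‖u‖ = 1) : ℂ ≃ᵢ ℂ :=
  IsometryEquiv.mk' (fun z => u * conj z + b) (fun z => conj (u⁻¹ * (z - b)))
    (fun z => by
      have : u ≠ 0 := fun h => by simp [h] at hu
      rw [Complex.conj_conj]
      field_simp
      ring)
    (Isometry.of_dist_eq fun z w => by
      rw [dist_eq_norm, dist_eq_norm, add_sub_add_right_eq_sub, ← mul_sub, norm_mul, hu, one_mul,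
        ← map_sub, RCLike.norm_conj])

@[simp] lemma reflIso_apply (u b : ℂ) (hu : ‖u‖ = 1) (z : ℂ) :
    reflIso u b hu z = u * conj z + b := rfl

lemma norm_eq_one_iff {u : ℂ} : ‖u‖ = 1 ↔ u.re * u.re + u.im * u.im = 1 := by
  rw [← sq_eq_sq₀ (norm_nonneg _) zero_le_one, one_pow, ← Complex.normSq_eq_norm_sq,
    Complex.normSq_apply]

/-- The ideal vertices of the standard tile. -/
def idealVertices (K : Kind) : Set (OnePoint ℂ) := insert ∞ ((↑) '' vertices K)

lemma idealVertices_finite (K : Kind) : (idealVertices K).Finite :=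
  ((vertices_finite K).image _).insert _

lemma corner_symmetry {K : Kind} {v : ℂ} (hv : v ∈ corners K) :
    ∃ e : ℂ ≃ᵢ ℂ, e 0 = v ∧ e '' vertices K = vertices K := by
  have h3 := sqrt_three_sq
  by_cases h0 : v = 0
  · exact ⟨IsometryEquiv.refl ℂ, h0.symm, image_id _⟩
  · cases K <;> simp only [corners, mem_insert_iff, mem_singleton_iff] at hv
    · rcases hv.resolve_left h0 with rfl | rfl
      · refine ⟨reflIso (-1) 1 (by simp), by simp, ?_⟩
        have : (-1 : ℂ) * conj omega + 1 = omega := by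
          apply Complex.ext <;> simp
          norm_num
        simp only [vertices, image_insert_eq, image_singleton, reflIso_apply, this, map_zero,
          map_one]
        norm_num
        exact insert_comm _ _ _
      · have hu : ‖1 - omega‖ = 1 := by
          rw [norm_eq_one_iff]
          simp
          nlinarith
        refine ⟨reflIso (1 - omega) omega hu, by simp, ?_⟩
        · have : (1 - omega) * conj omega + omega = 0 := by
            apply Complex.ext <;> simp <;> nlinarith
          simp only [vertices, image_insert_eq, image_singleton, reflIso_apply, this, map_zero,
            map_one]
          norm_num
          ext z
          simp only [mem_insert_iff, mem_singleton_iff]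
          tauto
    · rcases hv.resolve_left h0 with rfl | rfl | rfl
      · refine ⟨reflIso (-1) 1 (by simp), by simp, ?_⟩
        have e1 : (-1 : ℂ) * conj (1 + Complex.I) + 1 = Complex.I := by
          apply Complex.ext <;> simp
        have e2 : (-1 : ℂ) * conj Complex.I + 1 = 1 + Complex.I := by
          apply Complex.ext <;> simp
        have e3 : (-1 : ℂ) * conj ((1 + Complex.I) / 2) + 1 = (1 + Complex.I) / 2 := by
          apply Complex.ext
          · simp [Complex.conj_ofNat, Complex.div_ofNat_re]
            norm_num
          · simp [Complex.conj_ofNat, Complex.div_ofNat_im]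
            norm_num
        simp only [vertices, image_insert_eq, image_singleton, reflIso_apply, e1, e2, e3, map_zero,
            map_one]
        norm_num
        ext z
        simp only [mem_insert_iff, mem_singleton_iff]
        tauto
      · refine ⟨rotIso (-1) (1 + Complex.I) (by simp), by simp, ?_⟩
        have e1 : (-1 : ℂ) * (1 + Complex.I) + (1 + Complex.I) = 0 := by ring
        have e2 : (-1 : ℂ) * 1 + (1 + Complex.I) = Complex.I := by ring
        have e3 : (-1 : ℂ) * Complex.I + (1 + Complex.I) = 1 := by ring
        have e4 : (-1 : ℂ) * ((1 + Complex.I) / 2) + (1 + Complex.I) = (1 + Complex.I) / 2 := by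
          ring
        simp only [vertices, image_insert_eq, image_singleton, rotIso_apply, e1, e2, e3, e4,
          mul_zero, zero_add]
        ext z
        simp only [mem_insert_iff, mem_singleton_iff]
        tauto
      · refine ⟨reflIso 1 Complex.I (by simp), by simp, ?_⟩
        have e1 : (1 : ℂ) * conj (1 + Complex.I) + Complex.I = 1 := by
          apply Complex.ext <;> simp
        have e2 : (1 : ℂ) * conj Complex.I + Complex.I = 0 := by
          apply Complex.ext <;> simp
        have e3 : (1 : ℂ) * conj ((1 + Complex.I) / 2) + Complex.I = (1 + Complex.I) / 2 := by
          apply Complex.ext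
          · simp [Complex.conj_ofNat, Complex.div_ofNat_re]
          · simp [Complex.conj_ofNat, Complex.div_ofNat_im]
            norm_num
        simp only [vertices, image_insert_eq, image_singleton, reflIso_apply, e1, e2, e3, map_zero,
            map_one, zero_add, mul_zero, mul_one]
        ext z
        simp only [mem_insert_iff, mem_singleton_iff]
        tauto

/-- The symmetries act transitively on the ideal vertices: the inversion takes `∞` to `0`, a
symmetry of the polygon takes `0` to any corner, and the inversion takes the corner `1 + i` to the
remaining vertex of the octahedron. -/
lemma vertex_symmetry {K : Kind} {p : OnePoint ℂ} (hp : p ∈ idealVertices K) :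
    ∃ σ ∈ Isom, σ '' std K = std K ∧ SendsIdeal σ ∞ p := by
  have key : ∀ v ∈ corners K, ∃ σ ∈ Isom, σ '' std K = std K ∧ SendsIdeal σ ∞ v := by
    intro v hv
    obtain ⟨e, he0, he⟩ := corner_symmetry hv
    refine ⟨ext e * inv, Isom.mul_mem (ext_mem e) inv_mem, ?_, ?_⟩
    · rw [Equiv.Perm.coe_mul, image_comp, image_inv_std, std_eq, ext_hullInf, he]
    · rw [← he0]
      exact (sendsIdeal_ext_coe e 0).mul sendsIdeal_inv_infty
  rcases hp with rfl | ⟨v, hv, rfl⟩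
  · exact ⟨1, Isom.one_mem, image_id _, sendsIdeal_one _⟩
  · by_cases hvc : v ∈ corners K
    · exact key v hvc
    · cases K
      · exact absurd hv hvc
      · have hv2 : v = (1 + Complex.I) / 2 := by
          simp only [corners, vertices, mem_insert_iff, mem_singleton_iff] at hv hvc
          tauto
        obtain ⟨σ, h1, h2, h3⟩ := key (1 + Complex.I) (by simp [corners])
        refine ⟨inv * σ, Isom.mul_mem inv_mem h1, ?_, ?_⟩
        · rw [Equiv.Perm.coe_mul, image_comp, h2, image_inv_std]
        · have h4 : (1 + Complex.I) ≠ 0 := fun h => by simpa using congrArg Complex.re h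
          have h5 : ‖1 + Complex.I‖ ^ 2 = 2 := by
            rw [← Complex.normSq_eq_norm_sq, Complex.normSq_apply]
            norm_num
          have h6 := sendsIdeal_inv_coe h4
          rw [h5] at h6
          rw [hv2]
          exact h6.mul h3

/-- Let `w` be the point that goes to `∞`. If it is not an ideal vertex, the tile stays outside the
hemisphere around `w` that reaches to the nearest finite vertex, and the image under the inversion
at `w` has bounded height. -/
lemma bounded_or_vertex (K : Kind) {g : Equiv.Perm H3} (hg : g ∈ Isom) :
    (∃ M, ∀ x ∈ std K, (g x).t ≤ M) ∨ ∃ p ∈ idealVertices K, SendsIdeal g p ∞ := by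
  rcases isometry_classification hg with ⟨k, hk, e, rfl⟩ | ⟨k, hk, e, w, rfl⟩
  · exact Or.inr ⟨∞, Or.inl rfl, (sendsIdeal_dil_infty k hk).mul (sendsIdeal_ext_infty e)⟩
  · by_cases hw : w ∈ vertices K
    · right
      refine ⟨w, Or.inr ⟨w, hw, rfl⟩, (((sendsIdeal_dil_infty k hk).mul
        (sendsIdeal_ext_infty e)).mul sendsIdeal_inv_zero).mul ?_⟩
      simpa using sendsIdeal_ext_coe (trans (-w)) w
    · left
      obtain ⟨v₀, hv₀, hmin⟩ := exists_min_image (vertices K) (fun v => ‖v - w‖ ^ 2)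
        (vertices_finite K) ⟨0, corners_subset_vertices K (zero_mem_corners K)⟩
      have hδ : 0 < ‖v₀ - w‖ ^ 2 := by
        have : v₀ - w ≠ 0 := sub_ne_zero.2 fun h => hw (h ▸ hv₀)
        positivity
      set δ := ‖v₀ - w‖ ^ 2
      refine ⟨k * ((1 / δ + 1) / 2), fun x hx => ?_⟩
      rw [std_eq] at hx
      have hev : ∀ z t, (Plane.mk 1 (-w) (‖w‖ ^ 2 - δ) (by simpa using hδ)).eval z t =
          ‖z - w‖ ^ 2 + t ^ 2 - δ := by
        intro z t
        rw [norm_sub_sq']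
        simp only [Plane.eval, map_neg, neg_mul, Complex.neg_re]
        ring
      have h1 := hx ⟨1, -w, ‖w‖ ^ 2 - δ, by simpa using hδ⟩ zero_le_one (fun v hv => by
        rw [hev]
        have := hmin v hv
        linarith)
      rw [hev] at h1
      have h2 : ((dil k hk * ext e * inv * ext (trans (-w))) x).t =
          k * (x.t / (‖x.z - w‖ ^ 2 + x.t ^ 2)) := by
        change k * (x.t / (ext (trans (-w)) x).R) = _
        simp [H3.R, sub_eq_add_neg]
      rw [h2]
      refine mul_le_mul_of_nonneg_left ?_ hk.le
      set D := ‖x.z - w‖ ^ 2 + x.t ^ 2 with hD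
      have hD0 : δ ≤ D := by linarith
      have hDp : 0 < D := hδ.trans_le hD0
      have h3 : 1 / D ≤ 1 / δ := one_div_le_one_div_of_le hδ hD0
      -- Since `t ≤ (1 + t ^ 2) / 2`; this avoids a square root in the bound.
      have h4 : x.t ≤ (1 + D) / 2 := by nlinarith [sq_nonneg (x.t - 1), sq_nonneg ‖x.z - w‖]
      calc x.t / D ≤ ((1 + D) / 2) / D := by gcongr
        _ = (1 / D + 1) / 2 := by field_simp
        _ ≤ (1 / δ + 1) / 2 := by gcongr

/-- Tiles that reach arbitrarily high are similar to standard ones. -/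
lemma similar_of_unbounded {K : Kind} {g : Equiv.Perm H3} (hg : g ∈ Isom)
    (h : ∀ M, ∃ x ∈ g '' std K, M < x.t) :
    ∃ (k : ℝ) (hk : 0 < k) (e : ℂ ≃ᵢ ℂ), g '' std K = (dil k hk * ext e) '' std K := by
  rcases bounded_or_vertex K hg with ⟨M, hM⟩ | ⟨p, hp, hgp⟩
  · obtain ⟨_, ⟨x, hx, rfl⟩, hx'⟩ := h M
    exact absurd (hM x hx) (not_le.2 hx')
  · obtain ⟨σ, hσ, hσ1, hσ2⟩ := vertex_symmetry hp
    obtain ⟨k, hk, e, he⟩ := similarity_of_sendsIdeal (Isom.mul_mem hg hσ) (hgp.mul hσ2)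
    refine ⟨k, hk, e, ?_⟩
    rw [← he, Equiv.Perm.coe_mul, image_comp, hσ1]

/-! ## Triangles and squares -/

lemma isometry_image_convexHull (e : ℂ ≃ᵢ ℂ) (A : Set ℂ) :
    e '' convexHull ℝ A = convexHull ℝ (e '' A) :=
  AffineMap.image_convexHull (e.toRealAffineIsometryEquiv : ℂ ≃ᵃ[ℝ] ℂ).toAffineMap A

lemma isometry_image_segment (e : ℂ ≃ᵢ ℂ) (a b : ℂ) :
    e '' segment ℝ a b = segment ℝ (e a) (e b) := by
  rw [← convexHull_pair, isometry_image_convexHull, image_pair, convexHull_pair]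

/-- The quotient `w = (c - a) / (b - a)` satisfies `‖w‖ = ‖w - 1‖ = 1`, so it is `omega` or its
conjugate. The orientation decides between a rotation and a reflection. -/
lemma UnitTriangle.exists_isometry {a b c : ℂ} (h : UnitTriangle a b c) :
    ∃ e : ℂ ≃ᵢ ℂ, e 0 = a ∧ e 1 = b ∧ e omega = c := by
  obtain ⟨h1, h2, h3⟩ := h
  have hu : ‖b - a‖ = 1 := by rw [← dist_eq_norm, dist_comm, h1]
  have hu0 : b - a ≠ 0 := fun h => by simp [h] at hu
  set w := (c - a) / (b - a) with hw
  have hc : c = (b - a) * w + a := by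
    rw [hw]
    field_simp
    ring
  have hw1 : w.re * w.re + w.im * w.im = 1 := by
    rw [← norm_eq_one_iff, hw, norm_div, hu, div_one, ← dist_eq_norm, h3]
  have hw2 : (w.re - 1) * (w.re - 1) + w.im * w.im = 1 := by
    have : ‖w - 1‖ = 1 := by
      have e1 : w - 1 = (c - b) / (b - a) := by
        rw [hw]
        field_simp
        ring
      rw [e1, norm_div, hu, div_one, ← dist_eq_norm, dist_comm, h2]
    simpa using norm_eq_one_iff.1 this
  have hre : w.re = 1 / 2 := by linarith
  have him : (w.im - √3 / 2) * (w.im + √3 / 2) = 0 := by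
    have := sqrt_three_sq
    rw [hre] at hw1
    nlinarith
  rcases mul_eq_zero.1 him with h | h
  · refine ⟨rotIso (b - a) a hu, by simp, by simp, ?_⟩
    have : omega = w := Complex.ext (by rw [hre, omega_re]) (by rw [omega_im]; linarith)
    rw [hc, rotIso_apply, this]
  · refine ⟨reflIso (b - a) a hu, by simp, by simp, ?_⟩
    have : conj omega = w := Complex.ext (by rw [hre, Complex.conj_re, omega_re])
      (by rw [Complex.conj_im, omega_im]; linarith)
    rw [hc, reflIso_apply, this]

lemma unitTriangle_std : UnitTriangle 0 1 omega := by
  have := sqrt_three_sq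
  refine ⟨?_, ?_, ?_⟩ <;> rw [dist_eq_one_iff] <;> simp <;> nlinarith

lemma UnitTriangle.map {a b c : ℂ} (h : UnitTriangle a b c) (e : ℂ ≃ᵢ ℂ) :
    UnitTriangle (e a) (e b) (e c) := by
  simpa only [UnitTriangle, e.dist_eq] using h

lemma UnitTriangle.rotate {a b c : ℂ} (h : UnitTriangle a b c) : UnitTriangle b c a :=
  ⟨h.2.1, h.2.2, h.1⟩

lemma UnitTriangle.swap {a b c : ℂ} (h : UnitTriangle a b c) : UnitTriangle b a c := by
  obtain ⟨h1, h2, h3⟩ := h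
  exact ⟨by rwa [dist_comm], by rwa [dist_comm], by rwa [dist_comm]⟩

lemma image_poly_tet (e : ℂ ≃ᵢ ℂ) : e '' poly .tet = convexHull ℝ {e 0, e 1, e omega} := by
  rw [poly, isometry_image_convexHull]
  simp only [corners, image_insert_eq, image_singleton]

lemma isTriangle_iff {s : Set ℂ} : IsTriangle s ↔ ∃ e : ℂ ≃ᵢ ℂ, s = e '' poly .tet := by
  constructor
  · rintro ⟨a, b, c, h, rfl⟩
    obtain ⟨e, rfl, rfl, rfl⟩ := h.exists_isometry
    exact ⟨e, (image_poly_tet e).symm⟩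
  · rintro ⟨e, rfl⟩
    exact ⟨_, _, _, unitTriangle_std.map e, image_poly_tet e⟩

lemma isSquare_iff {s : Set ℂ} : IsSquare s ↔ ∃ e : ℂ ≃ᵢ ℂ, s = e '' poly .oct := by
  constructor
  · rintro ⟨a, u, hu, rfl⟩
    refine ⟨rotIso u a hu, ?_⟩
    rw [poly, isometry_image_convexHull]
    simp only [corners, image_insert_eq, image_singleton, rotIso_apply]
    congr 1
    ring_nf
  · rintro ⟨e, rfl⟩
    rw [poly, isometry_image_convexHull]
    simp only [corners, image_insert_eq, image_singleton]
    obtain ⟨u, b, hu, h | h⟩ := isometry_form e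
    · refine ⟨b, u, hu, ?_⟩
      simp only [h]
      congr 1
      ring_nf
    · refine ⟨u * conj Complex.I + b, u, hu, ?_⟩
      simp only [h]
      congr 1
      simp only [map_add, map_zero, map_one, Complex.conj_I]
      ext z
      simp only [mem_insert_iff, mem_singleton_iff]
      ring_nf
      tauto

/-- The polygon of a kind of tiles. -/
def IsPolygon : Kind → Set ℂ → Prop
  | .tet => IsTriangle
  | .oct => IsSquare

lemma isPolygon_iff {K : Kind} {s : Set ℂ} : IsPolygon K s ↔ ∃ e : ℂ ≃ᵢ ℂ, s = e '' poly K := by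
  cases K
  · exact isTriangle_iff
  · exact isSquare_iff

/-- Points of the unit square at distance `√2` are opposite corners, so their real parts differ by 1
or by -1. Three such differences cannot add up to zero around a cycle. -/
lemma no_triple_oct {x y z : ℂ} (hx : x ∈ poly .oct) (hy : y ∈ poly .oct) (hz : z ∈ poly .oct)
    (hxy : dist x y = √2) (hyz : dist y z = √2) (hzx : dist z x = √2) : False := by
  have key : ∀ u v : ℂ, u ∈ poly .oct → v ∈ poly .oct → dist u v = √2 →
      u.re - v.re = 1 ∨ u.re - v.re = -1 := by
    intro u v hu hv h
    rw [mem_poly_oct] at hu hv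
    have h2 : (u.re - v.re) * (u.re - v.re) + (u.im - v.im) * (u.im - v.im) = 2 := by
      rw [← Complex.sub_re, ← Complex.sub_im, ← Complex.normSq_apply, Complex.normSq_eq_norm_sq,
        ← dist_eq_norm, h, Real.sq_sqrt two_pos.le]
    have h3 : (u.re - v.re - 1) * (u.re - v.re + 1) = 0 := by nlinarith
    rcases mul_eq_zero.1 h3 with h4 | h4
    · exact Or.inl (by linarith)
    · exact Or.inr (by linarith)
  rcases key x y hx hy hxy with h1 | h1 <;> rcases key y z hy hz hyz with h2 | h2 <;>
    rcases key z x hz hx hzx with h3 | h3 <;> linarith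

lemma dist_le_sqrt_two {x y : ℂ} (hx : x ∈ poly .oct) (hy : y ∈ poly .oct) : dist x y ≤ √2 := by
  rw [mem_poly_oct] at hx hy
  rw [dist_eq_norm]
  refine Real.le_sqrt_of_sq_le ?_
  rw [← Complex.normSq_eq_norm_sq, Complex.normSq_apply, Complex.sub_re, Complex.sub_im]
  nlinarith

/-- Compare diameters, 1 for the triangle and `√2` for the square. A triangle has three points whose
mutual distances all equal the diameter, whereas a square has none, so the kinds agree, and then so
do the sizes. -/
lemma poly_similar_unique {K K' : Kind} {k : ℝ} (hk : 0 < k) {f : ℂ → ℂ}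
    (hf : ∀ x y, dist (f x) (f y) = k * dist x y) (h : f '' poly K = poly K') :
    K = K' ∧ k = 1 := by
  have hm : ∀ y ∈ poly K, f y ∈ poly K' := fun y hy => h ▸ mem_image_of_mem f hy
  have hs : ∀ y ∈ poly K', ∃ x ∈ poly K, f x = y := fun y hy => by rwa [← h] at hy
  have m0 : ∀ K, (0 : ℂ) ∈ poly K := fun K => corners_subset_poly K (zero_mem_corners K)
  have m1 : ∀ K, (1 : ℂ) ∈ poly K := fun K => corners_subset_poly K (by cases K <;> simp [corners])
  have mw : omega ∈ poly .tet := corners_subset_poly _ (by simp [corners])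
  have mi : (1 + Complex.I) ∈ poly .oct := corners_subset_poly _ (by simp [corners])
  have d2 : dist (0 : ℂ) (1 + Complex.I) = √2 := by
    rw [dist_zero_left, Complex.norm_def, Complex.normSq_apply]
    norm_num
  have s2 : 0 < √2 := by positivity
  obtain ⟨w1, w2, w3⟩ := unitTriangle_std
  cases K <;> cases K'
  · refine ⟨rfl, le_antisymm ?_ ?_⟩
    · have := dist_le_one_of_mem_tet (hm _ (m0 _)) (hm _ (m1 _))
      rwa [hf, w1, mul_one] at this
    · obtain ⟨x, hx, hx0⟩ := hs 0 (m0 _)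
      obtain ⟨y, hy, hy0⟩ := hs 1 (m1 _)
      have h1 := hf x y
      have h2 := dist_le_one_of_mem_tet hx hy
      rw [hx0, hy0, w1] at h1
      nlinarith
  · exfalso
    obtain ⟨x, hx, hx0⟩ := hs 0 (m0 _)
    obtain ⟨y, hy, hy0⟩ := hs _ mi
    have h1 := hf x y
    have h2 := dist_le_one_of_mem_tet hx hy
    have h3 := dist_le_sqrt_two (hm _ (m0 _)) (hm _ (m1 _))
    rw [hf, w1, mul_one] at h3
    rw [hx0, hy0, d2] at h1
    have hk2 : k = √2 := by nlinarith
    refine no_triple_oct (hm _ (m0 _)) (hm _ (m1 _)) (hm _ mw) ?_ ?_ ?_ <;>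
      rw [hf, hk2]
    · rw [w1, mul_one]
    · rw [w2, mul_one]
    · rw [w3, mul_one]
  · exfalso
    obtain ⟨x, hx, hx0⟩ := hs 0 (m0 _)
    obtain ⟨y, hy, hy0⟩ := hs 1 (m1 _)
    obtain ⟨z, hz, hz0⟩ := hs _ mw
    have h1 := dist_le_one_of_mem_tet (hm _ (m0 _)) (hm _ mi)
    rw [hf, d2] at h1
    have e1 := hf x y
    have e2 := hf y z
    have e3 := hf z x
    rw [hx0, hy0, w1] at e1
    rw [hy0, hz0, w2] at e2
    rw [hz0, hx0, w3] at e3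
    have l1 := dist_le_sqrt_two hx hy
    have l2 := dist_le_sqrt_two hy hz
    have l3 := dist_le_sqrt_two hz hx
    have aux : ∀ d : ℝ, 1 = k * d → d ≤ √2 → d = √2 := by
      intro d hd1 hd2
      refine le_antisymm hd2 (le_of_mul_le_mul_left ?_ hk)
      linarith
    exact no_triple_oct hx hy hz (aux _ e1 l1) (aux _ e2 l2) (aux _ e3 l3)
  · refine ⟨rfl, le_antisymm ?_ ?_⟩
    · have := dist_le_sqrt_two (hm _ (m0 _)) (hm _ mi)
      rw [hf, d2] at this
      nlinarith
    · obtain ⟨x, hx, hx0⟩ := hs 0 (m0 _)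
      obtain ⟨y, hy, hy0⟩ := hs _ mi
      have h1 := hf x y
      have h2 := dist_le_sqrt_two hx hy
      rw [hx0, hy0, d2] at h1
      nlinarith

lemma poly_isometry_unique {K K' : Kind} {e e' : ℂ ≃ᵢ ℂ} (h : e '' poly K = e' '' poly K') :
    K = K' := by
  refine (poly_similar_unique (K := K) (K' := K') one_pos (f := e'.symm ∘ e) (fun x y => ?_) ?_).1
  · simp [IsometryEquiv.dist_eq]
  · rw [image_comp, h, ← image_comp]
    convert image_id _
    ext z
    simp

lemma IsPolygon.unique {K K' : Kind} {s : Set ℂ} (h : IsPolygon K s) (h' : IsPolygon K' s) :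
    K = K' := by
  obtain ⟨e, rfl⟩ := isPolygon_iff.1 h
  obtain ⟨e', h'⟩ := isPolygon_iff.1 h'
  exact poly_isometry_unique h'

/-- The triangle lies in the closed unit disc around `b`, which is strictly convex and has `a` on
its boundary. -/
lemma UnitTriangle.mem_extremePoints {a b c : ℂ} (h : UnitTriangle a b c) :
    a ∈ extremePoints ℝ (convexHull ℝ {a, b, c}) := by
  have hsub : convexHull ℝ {a, b, c} ⊆ Metric.closedBall b 1 := by
    refine convexHull_min ?_ (convex_closedBall b 1)
    rintro x (rfl | rfl | rfl)
    · exact h.1.le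
    · simp
    · rw [Metric.mem_closedBall, dist_comm]
      exact h.2.1.le
  refine _root_.mem_extremePoints.2 ⟨subset_convexHull ℝ _ (by simp), fun x hx y hy ha => ?_⟩
  by_cases hxy : x = y
  · subst hxy
    rw [openSegment_same] at ha
    exact ⟨ha.symm, ha.symm⟩
  · exfalso
    have h1 := (strictConvex_closedBall ℝ b 1).openSegment_subset (hsub hx) (hsub hy) hxy ha
    rw [interior_closedBall _ one_ne_zero, Metric.mem_ball, h.1] at h1
    exact lt_irrefl _ h1

lemma UnitTriangle.extremePoints_eq {a b c : ℂ} (h : UnitTriangle a b c) :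
    extremePoints ℝ (convexHull ℝ {a, b, c}) = {a, b, c} := by
  refine extremePoints_convexHull_subset.antisymm ?_
  rintro x (rfl | rfl | rfl)
  · exact h.mem_extremePoints
  · have := h.rotate.mem_extremePoints
    rwa [show ({x, c, a} : Set ℂ) = {a, x, c} by
      ext z; simp only [mem_insert_iff, mem_singleton_iff]; tauto] at this
  · have := h.rotate.rotate.mem_extremePoints
    rwa [show ({x, a, b} : Set ℂ) = {a, b, x} by
      ext z; simp only [mem_insert_iff, mem_singleton_iff]; tauto] at this

lemma UnitTriangle.notMem_segment {a b c : ℂ} (h : UnitTriangle a b c) : c ∉ segment ℝ a b := by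
  intro hc
  have := dist_add_dist_of_mem_segment hc
  rw [dist_comm a c, h.2.2, dist_comm c b, h.2.1, h.1] at this
  norm_num at this

lemma ext_std_tet (e : ℂ ≃ᵢ ℂ) : ext e '' std .tet = hullInf {e 0, e 1, e omega} := by
  rw [std_eq, ext_hullInf]
  simp only [vertices, image_insert_eq, image_singleton]

/-- The tetrahedron is determined by its three finite ideal vertices, and these are the extreme
points of the triangle. Hence the vertices may be labelled in any order. -/
lemma ext_std_tet_congr {e e' : ℂ ≃ᵢ ℂ} (h : e '' poly .tet = e' '' poly .tet) :
    ext e '' std .tet = ext e' '' std .tet := by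
  rw [image_poly_tet, image_poly_tet] at h
  rw [ext_std_tet, ext_std_tet, ← (unitTriangle_std.map e).extremePoints_eq, h,
    (unitTriangle_std.map e').extremePoints_eq]

/-! ## Cross-sections -/

lemma mem_crossSection {P : Set H3} {w : ℂ} : w ∈ crossSection P ↔ pt w 1 one_pos ∈ P := by
  constructor
  · rintro ⟨x, hx, h1, h2⟩
    rwa [show pt w 1 one_pos = x from H3_ext h1.symm h2.symm]
  · intro h
    exact ⟨_, h, rfl, rfl⟩

lemma crossSection_inter (P Q : Set H3) :
    crossSection (P ∩ Q) = crossSection P ∩ crossSection Q := by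
  ext w
  simp only [mem_crossSection, mem_inter_iff]

lemma crossSection_ext (e : ℂ ≃ᵢ ℂ) (P : Set H3) :
    crossSection (ext e '' P) = e '' crossSection P := by
  ext w
  rw [mem_crossSection]
  constructor
  · rintro ⟨x, hx, h⟩
    have h1 : e x.z = w := congrArg H3.z h
    have h2 : x.t = 1 := congrArg H3.t h
    exact ⟨x.z, ⟨x, hx, rfl, h2⟩, h1⟩
  · rintro ⟨z, ⟨x, hx, rfl, h2⟩, rfl⟩
    exact ⟨x, hx, H3_ext rfl h2⟩

lemma crossSection_std (K : Kind) : crossSection (std K) = poly K := by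
  ext w
  rw [mem_crossSection]
  exact ⟨fun h => z_mem_poly h, fun h => mem_std_of_one_le h le_rfl⟩

/-! ## Faces of the standard tiles under the inversion -/

/-- A vertical plane through `0` is invariant under the inversion. So the faces along the edge from
`0` to `∞` look the same from both of its ends. -/
lemma image_inv_vertical_face {K : Kind} {F : Set H3} (hF : IsFace (std K) F)
    (h0 : pt 0 1 one_pos ∈ F) : inv '' F = F := by
  obtain ⟨b, c, -, -, rfl⟩ := vertical_face hF h0 le_rfl
  have hc : c = 0 := by simpa [aff] using h0.2
  subst hc
  have key : ∀ x ∈ {y ∈ std K | aff b 0 y.z = 0}, inv x ∈ {y ∈ std K | aff b 0 y.z = 0} := by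
    rintro x ⟨hx, hx0⟩
    refine ⟨inv_mem_std hx, ?_⟩
    rw [inv_z]
    simp only [aff, add_zero] at *
    rw [← mul_div_assoc, Complex.div_ofReal_re, ← mul_div_assoc, hx0, zero_div]
  refine Subset.antisymm ?_ fun x hx => ⟨inv x, key x hx, inv_inv_apply x⟩
  rintro _ ⟨x, hx, rfl⟩
  exact key x hx

/-- The highest point of the horizontal face of the standard tetrahedron. -/
def bottom : H3 := pt (center .tet) (√(1 / 3)) (by positivity)

lemma bottom_mem : bottom ∈ std .tet :=
  mem_std (center_mem_poly _) (by simp [bottom, rsq])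

/-- The plane of the horizontal face of the standard tetrahedron. -/
def bottomPlane : Plane := ⟨1, -center .tet, 0, by
  rw [mul_zero]
  have : center .tet ≠ 0 := fun h => by simpa using congrArg Complex.re h
  rw [norm_neg]
  positivity⟩

lemma norm_center_tet : ‖center .tet‖ ^ 2 = 1 / 3 := by
  have := norm_sub_center (zero_mem_corners .tet)
  rwa [zero_sub, norm_neg] at this

lemma bottomPlane_eval (z : ℂ) (t : ℝ) :
    bottomPlane.eval z t = ‖z - center .tet‖ ^ 2 + t ^ 2 - 1 / 3 := by
  rw [norm_sub_sq', norm_center_tet]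
  simp only [bottomPlane, Plane.eval, map_neg, neg_mul, Complex.neg_re]
  ring

lemma std_tet_above {x : H3} (hx : x ∈ std .tet) : 0 ≤ bottomPlane.eval x.z x.t := by
  rw [std_eq] at hx
  refine hx _ zero_le_one fun v hv => ?_
  rw [bottomPlane_eval, norm_sub_center (K := .tet) hv]
  simp [rsq]

lemma std_tet_notMem_nhds_bottom : std .tet ∉ 𝓝 bottom := by
  intro h
  have h0 : (0 : ℝ) < √(1 / 3) := by positivity
  let f : ℝ → H3 := fun s => pt (center .tet) (√(1 / 3) * Real.exp s) (by positivity)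
  have hf : Continuous f := continuous_H3 continuous_const (continuous_const.mul Real.continuous_exp)
  have hf0 : f 0 = bottom := H3_ext rfl (by simp [f, bottom])
  rw [← hf0] at h
  have h2 : ∀ᶠ s in 𝓝[<] (0 : ℝ), s < 0 ∧ f s ∈ std .tet :=
    (eventually_mem_nhdsWithin).and
      (eventually_nhdsWithin_of_eventually_nhds (hf.continuousAt.eventually_mem h))
  obtain ⟨s, hs, hm⟩ := h2.exists
  have h3 := std_tet_above hm
  rw [bottomPlane_eval] at h3
  simp only [f, pt_z, pt_t, sub_self, norm_zero, mul_pow] at h3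
  rw [Real.sq_sqrt (by norm_num)] at h3
  have h4 : Real.exp s ^ 2 < 1 := pow_lt_one₀ (Real.exp_pos s).le (by
    rw [← Real.exp_zero]
    exact Real.exp_lt_exp.2 hs) two_ne_zero
  linarith

/-- At `bottom` the quadratic term of `eval_decomposition` vanishes, so the affine term is zero at
the centre and hence identically zero by `aff_center_ne_zero`. The plane is therefore the
circumscribed hemisphere. -/
lemma bottom_face {F : Set H3} (hF : IsFace (std .tet) F) (hb : bottom ∈ F) :
    F = {x ∈ std .tet | bottomPlane.eval x.z x.t = 0} := by
  obtain ⟨S, hS, rfl⟩ := hF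
  obtain ⟨ha, hv⟩ := hasIdeal_of_subset hS
  have h1 := aff_nonneg_of_hasIdeal hv
  have h2 : S.eval bottom.z bottom.t = 0 := hb.2
  rw [eval_decomposition S .tet] at h2
  simp only [bottom, pt_z, pt_t, sub_self, norm_zero, rsq] at h2
  rw [Real.sq_sqrt (by norm_num)] at h2
  have hb0 : S.b + S.a * center .tet = 0 := by
    by_contra hne
    exact aff_center_ne_zero hne h1 (by simp only [rsq]; linarith)
  have hb : S.b = -(S.a * center .tet) := by linear_combination hb0
  have hc : S.c = 0 := by
    rw [hb0, norm_center_tet] at h2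
    simpa [aff] using h2
  have ha0 : S.a ≠ 0 := by
    intro h0
    have := S.nondeg
    simp [hb, h0] at this
  have he : ∀ z t, S.eval z t = S.a * bottomPlane.eval z t := by
    intro z t
    simp only [Plane.eval, bottomPlane, hb, hc, map_neg, map_mul, Complex.conj_ofReal, neg_mul,
      Complex.neg_re, mul_assoc, Complex.re_ofReal_mul]
    ring
  ext x
  simp only [Plane.carrier, mem_inter_iff, mem_ofPred_eq, he, mul_eq_zero, ha0, false_or]

/-- The hemisphere of the horizontal face passes through `0`; the inversion opens it into the
vertical plane over the opposite edge. -/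
lemma crossSection_inv_bottom_face {F : Set H3} (hF : IsFace (std .tet) F) (hb : bottom ∈ F) :
    crossSection (inv '' F) = segment ℝ 1 omega := by
  have h3 := sqrt_three_sq
  have h3p : 0 < √3 := by positivity
  rw [bottom_face hF hb]
  have key : ∀ w : ℂ, pt w 1 one_pos ∈ inv '' {x ∈ std .tet | bottomPlane.eval x.z x.t = 0} ↔
      w ∈ poly .tet ∧ w.re + √3 / 3 * w.im = 1 := by
    intro w
    have e1 : bottomPlane.swap.eval w 1 = 1 - (w.re + √3 / 3 * w.im) := by
      simp [Plane.eval, Plane.swap, bottomPlane]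
      ring
    have hR := (one_div_pos.2 (R_pos (pt w 1 one_pos))).ne'
    have e2 : bottomPlane.eval (inv (pt w 1 one_pos)).z (inv (pt w 1 one_pos)).t = 0 ↔
        w.re + √3 / 3 * w.im = 1 := by
      rw [eval_inv, mul_eq_zero, or_iff_right hR, pt_z, pt_t, e1, sub_eq_zero, eq_comm]
    constructor
    · rintro ⟨x, ⟨hx, hx0⟩, h⟩
      have hx' : x = inv (pt w 1 one_pos) := by rw [← h, inv_inv_apply]
      have h4 := inv_mem_std hx
      rw [h] at h4
      refine ⟨z_mem_poly h4, e2.1 ?_⟩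
      rw [← hx']
      exact hx0
    · rintro ⟨hw, h⟩
      exact ⟨inv (pt w 1 one_pos), ⟨inv_mem_std (mem_std_of_one_le hw le_rfl), e2.2 h⟩,
        inv_inv_apply _⟩
  ext w
  rw [mem_crossSection, key, mem_poly_tet]
  constructor
  · rintro ⟨⟨h1, h2, h4⟩, h5⟩
    have hd : w.im / √3 * √3 = w.im := div_mul_cancel₀ _ h3p.ne'
    have hd' : √3 / 3 * w.im = w.im / √3 := by
      rw [div_mul_eq_mul_div, div_eq_div_iff three_ne_zero h3p.ne']
      linear_combination w.im * h3
    rw [hd'] at h5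
    refine ⟨1 - 2 * (w.im / √3), 2 * (w.im / √3), ?_, ?_, by ring, ?_⟩
    · nlinarith
    · positivity
    · apply Complex.ext
      · simp
        linarith
      · simp
        linarith
  · rintro ⟨α, β, hα, hβ, hαβ, rfl⟩
    have hα' : α = 1 - β := by linarith
    subst hα'
    simp
    refine ⟨⟨by positivity, by nlinarith, by nlinarith⟩, by nlinarith⟩

/-! ## Tilings under isometries -/

/-- `P` is a tile of the kind `K`. -/
def IsTile (K : Kind) (P : Set H3) : Prop := ∃ g ∈ Isom, P = g '' std K

lemma IsTiling.isTile {𝒬 : Set (Set H3)} (h : IsTiling 𝒬) {P : Set H3} (hP : P ∈ 𝒬) :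
    ∃ K, IsTile K P := by
  rcases h.tile P hP with h | h
  · exact ⟨.tet, h⟩
  · exact ⟨.oct, h⟩

lemma IsTile.map {K : Kind} {P : Set H3} (h : IsTile K P) {g : Equiv.Perm H3} (hg : g ∈ Isom) :
    IsTile K (g '' P) := by
  obtain ⟨f, hf, rfl⟩ := h
  exact ⟨g * f, Isom.mul_mem hg hf, by rw [Equiv.Perm.coe_mul, image_comp]⟩

lemma isTile_tiling {𝒬 : Set (Set H3)} :
    (∀ P ∈ 𝒬, ∃ K, IsTile K P) →
      ∀ P ∈ 𝒬, IsRegularIdealTetrahedron P ∨ IsRegularIdealOctahedron P := by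
  intro h P hP
  obtain ⟨K, hK⟩ := h P hP
  cases K
  · exact Or.inl hK
  · exact Or.inr hK

lemma IsFace.preimage {g : Equiv.Perm H3} (hg : g ∈ Isom) {P F : Set H3} (h : IsFace P F) :
    IsFace (g ⁻¹' P) (g ⁻¹' F) := by
  obtain ⟨S, hS, rfl⟩ := h
  obtain ⟨S', h1, h2⟩ := pullsBackPlanes hg S
  refine ⟨S', ?_, ?_⟩
  · rw [← h1]
    exact preimage_mono hS
  · rw [preimage_inter, h2]

lemma perm_image_eq_preimage (g : Equiv.Perm H3) (A : Set H3) : g '' A = ⇑g⁻¹ ⁻¹' A :=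
  Equiv.image_eq_preimage_symm g A

lemma IsFace.image {g : Equiv.Perm H3} (hg : g ∈ Isom) {P F : Set H3} (h : IsFace P F) :
    IsFace (g '' P) (g '' F) := by
  rw [perm_image_eq_preimage, perm_image_eq_preimage]
  exact h.preimage (Isom.inv_mem hg)

lemma locallyFinite_sets_iff {𝒬 : Set (Set H3)} :
    LocallyFinite (fun P : 𝒬 => (P : Set H3)) ↔
      ∀ x, ∃ N ∈ 𝓝 x, {P | P ∈ 𝒬 ∧ (P ∩ N).Nonempty}.Finite := by
  refine forall_congr' fun x => exists_congr fun N => and_congr_right fun _ => ?_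
  have : {P | P ∈ 𝒬 ∧ (P ∩ N).Nonempty} =
      Subtype.val '' {i : 𝒬 | ((i : Set H3) ∩ N).Nonempty} := by
    ext P
    simp [and_comm]
  rw [this, finite_image_iff Subtype.val_injective.injOn]

lemma IsTiling.map {𝒬 : Set (Set H3)} (h : IsTiling 𝒬) {g : Equiv.Perm H3} (hg : g ∈ Isom) :
    IsTiling ((fun P => g '' P) '' 𝒬) where
  tile := by
    refine isTile_tiling ?_
    rintro _ ⟨P, hP, rfl⟩
    obtain ⟨K, hK⟩ := h.isTile hP
    exact ⟨K, hK.map hg⟩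
  cover := by
    rw [eq_univ_iff_forall]
    intro x
    obtain ⟨P, hP, hx⟩ := (eq_univ_iff_forall.1 h.cover) (g⁻¹ x)
    exact ⟨_, ⟨P, hP, rfl⟩, ⟨_, hx, g.apply_symm_apply x⟩⟩
  locallyFinite := by
    rw [locallyFinite_sets_iff]
    intro x
    obtain ⟨N, hN, hfin⟩ := locallyFinite_sets_iff.1 h.locallyFinite (g⁻¹ x)
    refine ⟨g '' N, ?_, (hfin.image (fun P => g '' P)).subset ?_⟩
    · rw [perm_image_eq_preimage]
      exact (continuous_of_mem_Isom (Isom.inv_mem hg)).continuousAt hN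
    · rintro _ ⟨⟨P, hP, rfl⟩, hne⟩
      rw [← image_inter g.injective] at hne
      exact ⟨P, ⟨hP, hne.of_image⟩, rfl⟩
  faceToFace := by
    rintro _ ⟨P, hP, rfl⟩ _ ⟨Q, hQ, rfl⟩ hne
    have h1 := h.faceToFace P hP Q hQ fun h => hne (by rw [h])
    simp only [← image_inter g.injective]
    exact ⟨h1.1.image hg, h1.2.image hg⟩

/-! ## Tiles that meet the horosphere at height one -/

section Tiling

variable {𝒬 : Set (Set H3)}

lemma isClosed_std (K : Kind) : IsClosed (std K) := by
  rw [std_eq]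
  simp only [hullInf, ofPred_forall]
  refine isClosed_iInter fun S => isClosed_iInter fun _ => isClosed_iInter fun _ => ?_
  have : Continuous fun x : H3 => S.eval x.z x.t := by
    have h1 := continuous_z
    have h2 := continuous_t
    have h3 : Continuous fun x : H3 => (conj S.b * x.z).re :=
      Complex.continuous_re.comp (continuous_const.mul h1)
    unfold Plane.eval
    fun_prop
  exact isClosed_le continuous_const this

lemma IsTile.isClosed {K : Kind} {P : Set H3} (h : IsTile K P) : IsClosed P := by
  obtain ⟨g, hg, rfl⟩ := h
  rw [perm_image_eq_preimage]
  exact (isClosed_std K).preimage (continuous_of_mem_Isom (Isom.inv_mem hg))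

lemma IsTiling.eventually_mem (h : IsTiling 𝒬) (x : H3) :
    ∀ᶠ y in 𝓝 x, ∀ P ∈ 𝒬, y ∈ P → x ∈ P := by
  filter_upwards [h.locallyFinite.eventually_subset
    (fun P => (h.isTile P.2).choose_spec.isClosed) x] with y hy P hP hyP
  exact @hy ⟨P, hP⟩ hyP

lemma IsTiling.exists_mem (h : IsTiling 𝒬) (x : H3) : ∃ P ∈ 𝒬, x ∈ P :=
  eq_univ_iff_forall.1 h.cover x

/-- Near `x` only tiles that contain `x` occur. If `P` were the only one, it would be a
neighbourhood of `x`. -/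
lemma IsTiling.exists_other (h : IsTiling 𝒬) {P : Set H3} {x : H3} (hP : P ∉ 𝓝 x) :
    ∃ Q ∈ 𝒬, Q ≠ P ∧ x ∈ Q := by
  by_contra! hcon
  refine hP ?_
  filter_upwards [h.eventually_mem x] with y hy
  obtain ⟨Q, hQ, hyQ⟩ := h.exists_mem y
  by_cases hQP : Q = P
  · exact hQP ▸ hyQ
  · exact absurd (hy Q hQ hyQ) (hcon Q hQ hQP)

lemma IsTiling.isFace_std (h : IsTiling 𝒬) {K : Kind} {g : Equiv.Perm H3} (hg : g ∈ Isom)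
    {Q : Set H3} (hP : g '' std K ∈ 𝒬) (hQ : Q ∈ 𝒬) (hne : g '' std K ≠ Q) :
    IsFace (std K) (g ⁻¹' (g '' std K ∩ Q)) := by
  have h1 := (h.faceToFace _ hP _ hQ hne).1.preimage hg
  rwa [preimage_image_eq _ g.injective] at h1

/-- A common face with such a point would be vertical and lie over a supporting line through the
centre of the polygon, which does not exist. -/
lemma IsTiling.eq_of_mem_center (h : IsTiling 𝒬) {K : Kind} {g : Equiv.Perm H3} (hg : g ∈ Isom)
    {Q : Set H3} (hP : g '' std K ∈ 𝒬) (hQ : Q ∈ 𝒬) {t : ℝ} (ht : 1 ≤ t)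
    (hx : g (pt (center K) t (one_pos.trans_le ht)) ∈ Q) : g '' std K = Q := by
  by_contra hne
  obtain ⟨b, c, hb, hnn, hF⟩ := vertical_face (h.isFace_std hg hP hQ hne)
    (x := pt (center K) t (one_pos.trans_le ht))
    ⟨mem_image_of_mem _ (mem_std_of_one_le (center_mem_poly K) ht), hx⟩ ht
  have h1 : pt (center K) t (one_pos.trans_le ht) ∈ g ⁻¹' (g '' std K ∩ Q) :=
    ⟨mem_image_of_mem _ (mem_std_of_one_le (center_mem_poly K) ht), hx⟩
  rw [hF] at h1
  exact aff_center_ne_zero hb hnn h1.2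

/-- `P` has the ideal vertex `∞` and the size of a standard tile. -/
def IsUnitTile (P : Set H3) : Prop := ∃ (K : Kind) (e : ℂ ≃ᵢ ℂ), P = ext e '' std K

lemma mem_ext_std {K : Kind} {e : ℂ ≃ᵢ ℂ} {x : H3} (ht : 1 ≤ x.t) :
    x ∈ ext e '' std K ↔ e.symm x.z ∈ poly K := by
  constructor
  · rintro ⟨y, hy, rfl⟩
    simpa using z_mem_poly hy
  · intro h
    exact ⟨ext e.symm x, mem_std_of_one_le h ht, (ext e).apply_symm_apply x⟩

lemma mem_similar_std {K : Kind} {e : ℂ ≃ᵢ ℂ} {k : ℝ} (hk : 0 < k) {x : H3} (ht : k ≤ x.t) :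
    x ∈ (dil k hk * ext e) '' std K ↔ e.symm ((k⁻¹ : ℝ) * x.z) ∈ poly K := by
  have e1 : ((dil k hk * ext e)⁻¹ x).z = e.symm ((k⁻¹ : ℝ) * x.z) := rfl
  have e2 : ((dil k hk * ext e)⁻¹ x).t = k⁻¹ * x.t := rfl
  rw [← e1]
  constructor
  · rintro ⟨y, hy, rfl⟩
    rw [show (dil k hk * ext e)⁻¹ ((dil k hk * ext e) y) = y from
      (dil k hk * ext e).symm_apply_apply y]
    exact z_mem_poly hy
  · intro h
    refine ⟨_, mem_std_of_one_le h ?_, (dil k hk * ext e).apply_symm_apply x⟩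
    rw [e2, le_inv_mul_iff₀ hk, mul_one]
    exact ht

lemma dil_ext_mem (k : ℝ) (hk : 0 < k) (e : ℂ ≃ᵢ ℂ) : dil k hk * ext e ∈ Isom :=
  Isom.mul_mem (dil_mem k hk) (ext_mem e)

lemma dist_scaled {k : ℝ} (hk : 0 < k) (e e' : ℂ ≃ᵢ ℂ) (x y : ℂ) :
    dist (e.symm (k * e' x)) (e.symm (k * e' y)) = k * dist x y := by
  rw [e.symm.dist_eq, dist_eq_norm, ← mul_sub, norm_mul, Complex.norm_real,
    Real.norm_of_nonneg hk.le, ← dist_eq_norm, e'.dist_eq]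

/-- Tiles that share a vertical face have the same size. -/
lemma IsTiling.isUnitTile_of_mem (h : IsTiling 𝒬) {K : Kind} {e : ℂ ≃ᵢ ℂ} {P' : Set H3}
    (hP : ext e '' std K ∈ 𝒬) (hP' : P' ∈ 𝒬) {z : ℂ} (hz : z ∈ poly K) (hzc : z ∉ corners K)
    (hzP' : pt (e z) 1 one_pos ∈ P') : IsUnitTile P' := by
  by_cases hne : ext e '' std K = P'
  · exact ⟨K, e, hne.symm⟩
  have hmem : ∀ {y t} (ht : 1 ≤ t), y ∈ poly K →
      pt (e y) t (one_pos.trans_le ht) ∈ ext e '' std K := fun ht hy =>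
    ⟨_, mem_std_of_one_le (x := pt _ _ (one_pos.trans_le ht)) hy ht, rfl⟩
  -- The common face is vertical and contains a whole ray up to `∞`. So `P'` reaches arbitrarily
  -- high and is a copy of a standard tile scaled by some `k`.
  obtain ⟨b, c, hb, hnn, hF⟩ := vertical_face (h.isFace_std (ext_mem e) hP hP' hne)
    (x := pt z 1 one_pos) ⟨hmem le_rfl hz, hzP'⟩ le_rfl
  have hz0 : aff b c z = 0 := by
    have : pt z 1 one_pos ∈ ext e ⁻¹' (ext e '' std K ∩ P') := ⟨hmem le_rfl hz, hzP'⟩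
    rw [hF] at this
    exact this.2
  have hF1 : ∀ y ∈ poly K, aff b c y = 0 → ∀ t (ht : 1 ≤ t),
      pt (e y) t (one_pos.trans_le ht) ∈ P' := by
    intro y hy hy0 t ht
    have : pt y t (one_pos.trans_le ht) ∈ {x ∈ std K | aff b c x.z = 0} :=
      ⟨mem_std_of_one_le hy ht, hy0⟩
    rw [← hF] at this
    exact this.2
  obtain ⟨K', g, hg, hPg⟩ := h.isTile hP'
  obtain ⟨k, hk, e', he'⟩ := similar_of_unbounded (K := K') hg (fun M =>
    ⟨_, hPg ▸ hF1 z hz hz0 (max 1 (M + 1)) (le_max_left _ _), by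
      rw [pt_t]
      exact (lt_add_one M).trans_le (le_max_right _ _)⟩)
  rw [← hPg] at he'
  subst he'
  -- At height `T` both tiles are prisms over their polygons. The maps `m` and `n` below translate
  -- horizontal positions from the coordinates of one polygon to those of the other; they scale by
  -- `k⁻¹` and `k`.
  set T := max 1 k
  have hT1 : 1 ≤ T := le_max_left _ _
  have hTk : k ≤ T := le_max_right _ _
  have hT0 : 0 < T := one_pos.trans_le hT1
  have hTk' : 1 ≤ k⁻¹ * T := by rwa [le_inv_mul_iff₀ hk, mul_one]
  let m : ℂ → ℂ := fun y => e'.symm ((k⁻¹ : ℝ) * e y)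
  have hm : ∀ x : ℂ, pt (e x) T hT0 = (dil k hk * ext e')
      (pt (m x) (k⁻¹ * T) (one_pos.trans_le hTk')) := by
    intro x
    have hkc : (k : ℂ) ≠ 0 := by exact_mod_cast hk.ne'
    refine H3_ext ?_ ?_
    · change e x = k * e' (e'.symm ((k⁻¹ : ℝ) * e x))
      rw [IsometryEquiv.apply_symm_apply]
      push_cast
      field_simp
    · change T = k * (k⁻¹ * T)
      field_simp
  have hx0 : pt (m z) (k⁻¹ * T) (one_pos.trans_le hTk') ∈
      (dil k hk * ext e') ⁻¹' ((dil k hk * ext e') '' std K' ∩ ext e '' std K) := by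
    rw [mem_preimage, ← hm]
    exact ⟨hF1 z hz hz0 T hT1, hmem hT1 hz⟩
  obtain ⟨b', c', hb', hnn', hF'⟩ := vertical_face
    (h.isFace_std (dil_ext_mem k hk e') hP' hP (Ne.symm hne)) hx0 hTk'
  have hm1 : ∀ y ∈ poly K, aff b c y = 0 → m y ∈ poly K' ∧ aff b' c' (m y) = 0 := by
    intro y hy hy0
    have : pt (m y) (k⁻¹ * T) (one_pos.trans_le hTk') ∈
        (dil k hk * ext e') ⁻¹' ((dil k hk * ext e') '' std K' ∩ ext e '' std K) := by
      rw [mem_preimage, ← hm]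
      exact ⟨hF1 y hy hy0 T hT1, hmem hT1 hy⟩
    rw [hF'] at this
    exact ⟨z_mem_poly this.1, this.2⟩
  let n : ℂ → ℂ := fun y => e.symm (k * e' y)
  have hn1 : ∀ y ∈ poly K', aff b' c' y = 0 → n y ∈ poly K ∧ aff b c (n y) = 0 := by
    intro y hy hy0
    have h1 : pt y (k⁻¹ * T) (one_pos.trans_le hTk') ∈ {x ∈ std K' | aff b' c' x.z = 0} :=
      ⟨mem_std_of_one_le hy hTk', hy0⟩
    rw [← hF', mem_preimage] at h1
    have h2 : pt (n y) T hT0 ∈ ext e ⁻¹' (ext e '' std K ∩ (dil k hk * ext e') '' std K') := by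
      rw [mem_preimage, show ext e (pt (n y) T hT0) = (dil k hk * ext e')
        (pt y (k⁻¹ * T) (one_pos.trans_le hTk')) from ?_]
      · exact ⟨h1.2, h1.1⟩
      · refine H3_ext ?_ ?_
        · change e (e.symm (k * e' y)) = k * e' y
          rw [IsometryEquiv.apply_symm_apply]
        · change T = k * (k⁻¹ * T)
          field_simp
    rw [hF] at h2
    exact ⟨z_mem_poly h2.1, h2.2⟩
  -- As `z` is not a corner, the supporting line contains two points at distance 1. In the polygon
  -- of `P'` they lie on a supporting line at distance `k⁻¹`, which is at most 1. The converse
  -- comparison gives `k ≤ 1`; there the corner alternative fails since two distinct points are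
  -- available.
  obtain ⟨hzc', -⟩ | ⟨y, hy, y', hy', hy0, hy0', hd⟩ := supporting_alternative hnn hz hz0
  · exact absurd hzc' hzc
  have dm : dist (m y) (m y') = k⁻¹ := by
    have := dist_scaled (inv_pos.2 hk) e' e y y'
    rwa [hd, mul_one] at this
  have k1 : 1 ≤ k := by
    have := dist_le_one_of_supporting hb' hnn' (hm1 y hy hy0).1 (hm1 y' hy' hy0').1
      (hm1 y hy hy0).2 (hm1 y' hy' hy0').2
    rw [dm] at this
    exact (inv_le_one₀ hk).1 this
  have k2 : k ≤ 1 := by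
    obtain ⟨-, huniq⟩ | ⟨u, hu, u', hu', hu0, hu0', hd'⟩ :=
      supporting_alternative hnn' (hm1 y hy hy0).1 (hm1 y hy hy0).2
    · have := huniq _ (hm1 y' hy' hy0').1 (hm1 y' hy' hy0').2
      rw [this, dist_self] at dm
      exact absurd dm (inv_pos.2 hk).ne
    · have := dist_le_one_of_supporting hb hnn (hn1 u hu hu0).1 (hn1 u' hu' hu0').1
        (hn1 u hu hu0).2 (hn1 u' hu' hu0').2
      rwa [dist_scaled hk, hd', mul_one] at this
  obtain rfl : k = 1 := le_antisymm k2 k1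
  refine ⟨K', e', ?_⟩
  rw [dil_one, one_mul]

/-! ### Unit tiles cover the horosphere at height one -/

lemma continuous_horosphere : Continuous fun z : ℂ => pt z 1 one_pos :=
  continuous_H3 continuous_id continuous_const

instance : SecondCountableTopology H3 :=
  inferInstanceAs (SecondCountableTopology {p : ℂ × ℝ // 0 < p.2})

instance : LocallyCompactSpace H3 :=
  (isOpen_lt continuous_const continuous_snd).locallyCompactSpace

lemma IsTile.nonempty {K : Kind} {P : Set H3} (h : IsTile K P) : P.Nonempty := by
  obtain ⟨g, -, rfl⟩ := h
  exact ⟨_, mem_image_of_mem g (mem_std_of_one_le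
    (x := pt (center K) 1 one_pos) (center_mem_poly K) le_rfl)⟩

lemma IsTiling.countable (h : IsTiling 𝒬) : 𝒬.Countable := by
  have := h.locallyFinite.countable_univ fun P => (h.isTile P.2).choose_spec.nonempty
  exact countable_univ_iff.1 this

/-- If there is one tile of unit size at `∞`, such tiles cover the horosphere at height one. -/
lemma IsTiling.exists_unitTile_mem (h : IsTiling 𝒬) (hu : ∃ P ∈ 𝒬, IsUnitTile P) (z : ℂ) :
    ∃ P ∈ 𝒬, IsUnitTile P ∧ pt z 1 one_pos ∈ P := by
  classical
  let ι := {P : Set H3 // P ∈ 𝒬 ∧ IsUnitTile P}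
  have : Countable ι := (h.countable.mono (s₁ := {P | P ∈ 𝒬 ∧ IsUnitTile P}) fun _ hP => hP.1).to_subtype
  choose K e he using fun P : ι => P.2.2
  -- At a corner the size of adjacent tiles is not controlled directly. The corners form a countable
  -- set, and its complement in the plane is connected and dense.
  let W : Set ℂ := ⋃ P : ι, e P '' corners (K P)
  have hW : W.Countable := countable_iUnion fun P => ((corners_finite _).image _).countable
  let U : Set ℂ := {z | ∃ P ∈ 𝒬, IsUnitTile P ∧ pt z 1 one_pos ∈ P}
  have hclosed : IsClosed U := by
    have h1 : IsClosed (⋃ P : ι, (P : Set H3)) := by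
      have hlf : LocallyFinite fun P : ι => (P : Set H3) :=
        h.locallyFinite.comp_injective (g := fun P : ι => (⟨P.1, P.2.1⟩ : 𝒬))
          fun P Q hPQ => Subtype.ext (congrArg (fun x : 𝒬 => (x : Set H3)) hPQ)
      exact hlf.isClosed_iUnion fun P => (h.isTile P.2.1).choose_spec.isClosed
    convert h1.preimage continuous_horosphere using 1
    ext w
    simp [U, ι, and_assoc]
  -- Tiles at nearby points also contain `z`, so it suffices that all tiles at `z` have unit size.
  have hnhds : ∀ z, (∀ P ∈ 𝒬, pt z 1 one_pos ∈ P → IsUnitTile P) → z ∈ interior U := by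
    intro z hz
    rw [mem_interior_iff_mem_nhds]
    filter_upwards [continuous_horosphere.continuousAt.eventually (h.eventually_mem _)] with w hw
    obtain ⟨P, hP, hwP⟩ := h.exists_mem (pt w 1 one_pos)
    exact ⟨P, hP, hz P hP (hw P hP hwP), hwP⟩
  have hopen : ∀ z ∈ U, z ∉ W → z ∈ interior U := by
    rintro z ⟨P, hP, hPu, hzP⟩ hzW
    refine hnhds z fun P' hP' hzP' => ?_
    have heP := he ⟨P, hP, hPu⟩
    simp only at heP
    set f := e ⟨P, hP, hPu⟩ with hf
    rw [heP] at hzP hP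
    refine h.isUnitTile_of_mem (z := f.symm z) hP hP' ((mem_ext_std le_rfl).1 hzP) (fun hc => ?_)
      (by rwa [IsometryEquiv.apply_symm_apply])
    exact hzW (mem_iUnion.2 ⟨⟨P, ‹_›, hPu⟩, ⟨_, hc, f.apply_symm_apply z⟩⟩)
  have hne : (Wᶜ ∩ interior U).Nonempty := by
    obtain ⟨P, hP, K, e, rfl⟩ := hu
    have hc : e (center K) ∈ interior U := hnhds _ fun P' hP' hcP' => by
      rw [← h.eq_of_mem_center (ext_mem e) hP hP' le_rfl hcP']
      exact ⟨K, e, rfl⟩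
    have := (hW.dense_compl ℝ).inter_open_nonempty _ isOpen_interior ⟨_, hc⟩
    rwa [inter_comm]
  have hconn : IsPreconnected Wᶜ :=
    (hW.isConnected_compl_of_one_lt_rank (by rw [Complex.rank_real_complex]; norm_num)).isPreconnected
  -- Away from the corners the covered set is both open and closed, and it is not empty; so it is
  -- everything, and its closedness recovers the corners.
  have hsub : Wᶜ ⊆ interior U := by
    refine hconn.subset_left_of_subset_union isOpen_interior hclosed.isOpen_compl ?_ ?_ hne
    · exact disjoint_compl_right.mono_left interior_subset
    · intro w hw
      by_cases hwU : w ∈ U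
      · exact Or.inl (hopen w hwU hw)
      · exact Or.inr hwU
  have huniv : closure U = univ := ((hW.dense_compl ℝ).mono (hsub.trans interior_subset)).closure_eq
  rw [hclosed.closure_eq] at huniv
  exact eq_univ_iff_forall.1 huniv z

/-- Similar copies of the standard tiles in the tiling have unit size. -/
lemma IsTiling.scale_eq_one (h : IsTiling 𝒬) (hu : ∃ P ∈ 𝒬, IsUnitTile P) {K : Kind} {k : ℝ}
    {hk : 0 < k} {e : ℂ ≃ᵢ ℂ} (hP : (dil k hk * ext e) '' std K ∈ 𝒬) : k = 1 := by
  set T := max 1 k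
  have hT1 : 1 ≤ T := le_max_left _ _
  have hTk : k ≤ T := le_max_right _ _
  have hT0 : 0 < T := one_pos.trans_le hT1
  have hTk' : 1 ≤ k⁻¹ * T := by rwa [le_inv_mul_iff₀ hk, mul_one]
  have hkT : k * (k⁻¹ * T) = T := by field_simp
  -- A unit tile over the centre of the scaled polygon also contains the point at height `T` there,
  -- so by `IsTiling.eq_of_mem_center` it is the given tile. Its two descriptions as a prism at
  -- height `T` then force `k = 1`.
  obtain ⟨P, hPQ, ⟨K', e', rfl⟩, hz⟩ := h.exists_unitTile_mem hu (k * e (center K))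
  rw [mem_ext_std le_rfl] at hz
  have h1 := h.eq_of_mem_center (dil_ext_mem k hk e) hP hPQ hTk' ((mem_ext_std (by
    change 1 ≤ k * (k⁻¹ * T)
    rwa [hkT])).2 hz)
  refine (poly_similar_unique hk (f := fun y => e'.symm (k * e y)) (K := K) (K' := K')
    (dist_scaled hk e' e) ?_).2
  have hkc : (k : ℂ) ≠ 0 := by exact_mod_cast hk.ne'
  ext w
  have h2 : e' w ∈ (fun y => k * e y) '' poly K ↔ w ∈ poly K' := by
    have h3 := mem_similar_std (K := K) (e := e) hk (x := pt (e' w) T hT0) hTk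
    rw [h1, mem_ext_std (x := pt (e' w) T hT0) hT1, pt_z, IsometryEquiv.symm_apply_apply] at h3
    rw [h3]
    constructor
    · rintro ⟨y, hy, hyw⟩
      simp only at hyw
      rw [← hyw]
      push_cast
      rw [inv_mul_cancel_left₀ hkc, IsometryEquiv.symm_apply_apply]
      exact hy
    · intro hy
      refine ⟨_, hy, ?_⟩
      simp only [IsometryEquiv.apply_symm_apply]
      push_cast
      rw [mul_inv_cancel_left₀ hkc]
  rw [← h2]
  constructor
  · rintro ⟨y, hy, rfl⟩
    exact ⟨y, hy, by simp⟩
  · rintro ⟨y, hy, hyw⟩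
    exact ⟨y, hy, by simp only at hyw ⊢; rw [hyw, IsometryEquiv.symm_apply_apply]⟩

/-- Tiles that meet the horosphere at height one have unit size. -/
lemma IsTiling.exists_eq_ext (h : IsTiling 𝒬) (hu : ∃ P ∈ 𝒬, IsUnitTile P) {K : Kind} {P : Set H3}
    (hP : P ∈ 𝒬) (hK : IsTile K P) (hne : (crossSection P).Nonempty) :
    ∃ e : ℂ ≃ᵢ ℂ, P = ext e '' std K := by
  obtain ⟨z, hz⟩ := hne
  rw [mem_crossSection] at hz
  obtain ⟨_, hPQ, ⟨K', e', rfl⟩, hz'⟩ := h.exists_unitTile_mem hu z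
  -- `P` meets some unit tile at height one, either as the same tile or in a vertical face, so it
  -- contains the ray upwards and is a similar copy of a standard tile.
  have hray : ∀ t (ht : 1 ≤ t), pt z t (one_pos.trans_le ht) ∈ P := by
    intro t ht
    have hzp := (mem_ext_std le_rfl).1 hz'
    by_cases heq : ext e' '' std K' = P
    · rw [← heq]
      exact (mem_ext_std (x := pt z t (one_pos.trans_le ht)) ht).2 hzp
    · have hx : pt (e'.symm z) 1 one_pos ∈ ext e' ⁻¹' (ext e' '' std K' ∩ P) := by
        have e1 : ext e' (pt (e'.symm z) 1 one_pos) = pt z 1 one_pos := H3_ext (by simp) rfl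
        rw [mem_preimage, e1]
        exact ⟨hz', hz⟩
      obtain ⟨b, c, hb, hnn, hF⟩ := vertical_face (h.isFace_std (ext_mem e') hPQ hP heq) hx le_rfl
      rw [hF] at hx
      have h2 : pt (e'.symm z) t (one_pos.trans_le ht) ∈ {y ∈ std K' | aff b c y.z = 0} :=
        ⟨mem_std_of_one_le hzp ht, hx.2⟩
      rw [← hF, mem_preimage] at h2
      have e1 : ext e' (pt (e'.symm z) t (one_pos.trans_le ht)) =
        pt z t (one_pos.trans_le ht) := H3_ext (by simp) rfl
      rw [e1] at h2
      exact h2.2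
  obtain ⟨g, hg, rfl⟩ := hK
  obtain ⟨k, hk, e, he⟩ := similar_of_unbounded hg (fun M =>
    ⟨_, hray (max 1 (M + 1)) (le_max_left _ _), by
      rw [pt_t]
      exact (lt_add_one M).trans_le (le_max_right _ _)⟩)
  rw [he] at hP ⊢
  obtain rfl := h.scale_eq_one hu hP
  exact ⟨e, by rw [dil_one, one_mul]⟩

lemma crossSection_ext_std (K : Kind) (e : ℂ ≃ᵢ ℂ) :
    crossSection (ext e '' std K) = e '' poly K := by
  rw [crossSection_ext, crossSection_std]

/-- Two tiles that meet at height one share a vertical face, and the cross-section of that face lies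
on a line. -/
lemma IsTiling.interior_inter_eq_empty (h : IsTiling 𝒬) (hu : ∃ P ∈ 𝒬, IsUnitTile P)
    {P Q : Set H3} (hP : P ∈ 𝒬) (hQ : Q ∈ 𝒬) (hne : P ≠ Q) :
    interior (crossSection P ∩ crossSection Q) = ∅ := by
  by_contra hcon
  obtain ⟨w, hw⟩ := nonempty_iff_ne_empty.2 hcon
  obtain ⟨K, hK⟩ := h.isTile hP
  obtain ⟨e, rfl⟩ := h.exists_eq_ext hu hP hK ⟨w, (interior_subset hw).1⟩
  have hmem : ∀ y : ℂ, e y ∈ crossSection (ext e '' std K) ∩ crossSection Q →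
      pt y 1 one_pos ∈ ext e ⁻¹' (ext e '' std K ∩ Q) := by
    intro y hy
    rwa [← crossSection_inter, mem_crossSection] at hy
  have hw0 := hmem (e.symm w) (by
    rw [IsometryEquiv.apply_symm_apply]
    exact interior_subset hw)
  obtain ⟨b, c, hb, -, hF⟩ := vertical_face (h.isFace_std (ext_mem e) hP hQ hne) hw0 le_rfl
  have hzero : ∀ y : ℂ, e y ∈ crossSection (ext e '' std K) ∩ crossSection Q →
      aff b c y = 0 := by
    intro y hy
    have := hmem y hy
    rw [hF] at this
    exact this.2
  -- Moving from `w` in the direction of the gradient `b` leaves the line at once.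
  have hc : ContinuousAt (fun s : ℝ => e (e.symm w + s * b)) 0 := by
    refine (e.continuous.comp ?_).continuousAt
    fun_prop
  have h1 := hc.eventually_mem (s := interior (crossSection (ext e '' std K) ∩ crossSection Q))
    (by simpa using isOpen_interior.mem_nhds hw)
  obtain ⟨s, hs0, hs⟩ := ((eventually_mem_nhdsWithin (a := (0 : ℝ)) (s := Ioi 0)).and
    (eventually_nhdsWithin_of_eventually_nhds h1)).exists
  have a1 := hzero _ (interior_subset hs)
  have a0 := hzero (e.symm w) (by
    rw [IsometryEquiv.apply_symm_apply]
    exact interior_subset hw)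
  have hb2 : 0 < b.re * b.re + b.im * b.im := by
    rw [← Complex.normSq_apply]
    exact Complex.normSq_pos.2 hb
  have hs0' : 0 < s := hs0
  simp only [aff_eq, Complex.add_re, Complex.add_im, Complex.re_ofReal_mul,
    Complex.im_ofReal_mul] at a0 a1
  have := mul_pos hs0' hb2
  nlinarith

end Tiling

/-! ## Invariant tilings with finitely many orbits of tiles -/

/-- `𝒬` is a tiling invariant under the group of isometries `Γ`, with finitely many orbits. -/
structure Config (Γ : Subgroup (Equiv.Perm H3)) (𝒬 : Set (Set H3)) : Prop where
  tiling : IsTiling 𝒬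
  isometries : Γ ≤ Isom
  invariant : ∀ γ ∈ Γ, ∀ P ∈ 𝒬, γ '' P ∈ 𝒬
  finite : ∃ R : Set (Set H3), R.Finite ∧ R ⊆ 𝒬 ∧ ∀ P ∈ 𝒬, ∃ γ ∈ Γ, ∃ P₀ ∈ R, γ '' P₀ = P

lemma image_image_inv (φ : Equiv.Perm H3) (P : Set H3) : ⇑φ⁻¹ '' (φ '' P) = P :=
  φ.symm_image_image P

lemma Config.map {Γ : Subgroup (Equiv.Perm H3)} {𝒬 : Set (Set H3)} (h : Config Γ 𝒬)
    {φ : Equiv.Perm H3} (hφ : φ ∈ Isom) : Config (conjBy φ Γ) ((fun P => φ '' P) '' 𝒬) where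
  tiling := h.tiling.map hφ
  isometries := conjBy_le hφ h.isometries
  invariant := by
    rintro g hg _ ⟨P, hP, rfl⟩
    obtain ⟨γ, hγ, rfl⟩ := mem_conjBy.1 hg
    refine ⟨γ '' P, h.invariant γ hγ P hP, ?_⟩
    simp only [Equiv.Perm.coe_mul, image_comp, image_image_inv]
  finite := by
    obtain ⟨R, hR, hRQ, hall⟩ := h.finite
    refine ⟨(fun P => φ '' P) '' R, hR.image _, image_mono hRQ, ?_⟩
    rintro _ ⟨P, hP, rfl⟩
    obtain ⟨γ, hγ, P₀, hP₀, rfl⟩ := hall P hP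
    refine ⟨_, mem_conjBy.2 ⟨γ, hγ, rfl⟩, _, ⟨P₀, hP₀, rfl⟩, ?_⟩
    simp only [Equiv.Perm.coe_mul, image_comp, image_image_inv]

lemma exists_finite_representatives {α β : Type*} (f : α → β) (S : Set α) (h : (f '' S).Finite) :
    ∃ R ⊆ S, R.Finite ∧ ∀ x ∈ S, ∃ y ∈ R, f y = f x := by
  obtain ⟨R, hRS, hR⟩ := exists_subset_bijOn S f
  refine ⟨R, hRS, ?_, fun x hx => ?_⟩
  · rw [← hR.image_eq] at h
    exact h.of_finite_image hR.injOn
  · have : f x ∈ f '' R := by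
      rw [hR.image_eq]
      exact mem_image_of_mem f hx
    exact this

lemma IsMixedTiling.config {Γ : Subgroup (Equiv.Perm H3)} {𝒬 : Set (Set H3)} (hΓ : Γ ≤ Isom)
    (h : IsMixedTiling Γ 𝒬) : Config Γ 𝒬 where
  tiling := h.tiling
  isometries := hΓ
  invariant := fun γ hγ P hP => h.invariant ⟨γ, hγ⟩ P hP
  finite := by
    obtain ⟨n₁, n₂, -, -, h1, h2⟩ := h.orbits
    obtain ⟨R₁, hS₁, hR₁, hall₁⟩ := exists_finite_representatives _ _
      (finite_of_encard_eq_coe h1)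
    obtain ⟨R₂, hS₂, hR₂, hall₂⟩ := exists_finite_representatives _ _
      (finite_of_encard_eq_coe h2)
    refine ⟨R₁ ∪ R₂, hR₁.union hR₂, union_subset (fun P hP => (hS₁ hP).1)
      (fun P hP => (hS₂ hP).1), fun P hP => ?_⟩
    have key : ∀ P₀, MulAction.orbit Γ P₀ = MulAction.orbit Γ P → ∃ γ ∈ Γ, γ '' P₀ = P := by
      intro P₀ h0
      have : P ∈ MulAction.orbit Γ P₀ := h0 ▸ MulAction.mem_orbit_self P
      obtain ⟨γ, hγ⟩ := this
      exact ⟨γ, γ.2, hγ⟩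
    rcases h.tiling.tile P hP with hP' | hP'
    · obtain ⟨P₀, hP₀, h0⟩ := hall₁ P ⟨hP, hP'⟩
      obtain ⟨γ, hγ, hγP⟩ := key P₀ h0
      exact ⟨γ, hγ, P₀, Or.inl hP₀, hγP⟩
    · obtain ⟨P₀, hP₀, h0⟩ := hall₂ P ⟨hP, hP'⟩
      obtain ⟨γ, hγ, hγP⟩ := key P₀ h0
      exact ⟨γ, hγ, P₀, Or.inr hP₀, hγP⟩

/-! ## The point at infinity is a parabolic fixed point -/

/-- A group of isometries of the plane without translations has bounded orbits. -/
lemma bounded_orbit_of_no_translation {Γ : Subgroup (Equiv.Perm H3)}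
    (hno : ∀ b, b ≠ 0 → ext (trans b) ∉ Γ) (z : ℂ) :
    ∃ M, ∀ e : ℂ ≃ᵢ ℂ, ext e ∈ Γ → ‖e z‖ ≤ M := by
  -- The orientation-preserving elements have a common fixed point: the centre of some nontrivial
  -- rotation if there is one. Otherwise only the identity remains, and any point will do.
  have step1 : ∃ c : ℂ, ∀ e : ℂ ≃ᵢ ℂ, ext e ∈ Γ → (∃ u b : ℂ, ∀ z, e z = u * z + b) →
      e c = c := by
    by_cases h1 : ∃ e₁ : ℂ ≃ᵢ ℂ, ext e₁ ∈ Γ ∧ ∃ u b : ℂ, u ≠ 1 ∧ ∀ z, e₁ z = u * z + b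
    · obtain ⟨e₁, he₁, u₁, b₁, hu₁, h₁⟩ := h1
      have hu₁' : 1 - u₁ ≠ 0 := sub_ne_zero.2 (Ne.symm hu₁)
      refine ⟨b₁ / (1 - u₁), ?_⟩
      rintro e he ⟨u, b, hub⟩
      -- The commutator with the rotation `e₁` has trivial linear part, so it is a translation,
      -- hence trivial. This is exactly the equation saying that `e` fixes the centre of `e₁`.
      have hcomm : ext e * ext e₁ * (ext e₁ * ext e)⁻¹ =
          ext (trans ((u * b₁ + b) - (u₁ * b + b₁))) := by
        rw [mul_inv_eq_iff_eq_mul]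
        ext x : 1
        refine H3_ext ?_ rfl
        simp only [Equiv.Perm.mul_apply, ext_z, hub, h₁, IsometryEquiv.addRight_apply]
        ring
      have hmem : ext e * ext e₁ * (ext e₁ * ext e)⁻¹ ∈ Γ :=
        Γ.mul_mem (Γ.mul_mem he he₁) (Γ.inv_mem (Γ.mul_mem he₁ he))
      rw [hcomm] at hmem
      have hd : (u * b₁ + b) - (u₁ * b + b₁) = 0 := by
        by_contra hd
        exact hno _ hd hmem
      rw [hub]
      field_simp
      linear_combination hd
    · push Not at h1
      refine ⟨0, ?_⟩
      rintro e he ⟨u, b, hub⟩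
      have hu : u = 1 := by
        by_contra hu
        obtain ⟨w, hw⟩ := h1 e he u b hu
        exact hw (hub w)
      have hb : b = 0 := by
        by_contra hb
        refine hno b hb ?_
        have : ext (trans b) = ext e := by
          ext x : 1
          exact H3_ext (by simp [hub, hu]) rfl
        rwa [this]
      rw [hub, hb]
      simp
  obtain ⟨c, hc⟩ := step1
  have aux : ∀ (e : ℂ ≃ᵢ ℂ) (y : ℂ), e y = c → ‖e z‖ ≤ ‖z - y‖ + ‖c‖ := by
    intro e y hy
    have h1 : ‖e z - c‖ = ‖z - y‖ := by
      rw [← hy, ← dist_eq_norm, e.dist_eq, dist_eq_norm]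
    have h2 := norm_add_le (e z - c) c
    rw [sub_add_cancel, h1] at h2
    exact h2
  by_cases hop : ∀ e : ℂ ≃ᵢ ℂ, ext e ∈ Γ → ∃ u b : ℂ, ∀ z, e z = u * z + b
  · exact ⟨‖z - c‖ + ‖c‖, fun e he => aux e c (hc e he (hop e he))⟩
  · push Not at hop
    obtain ⟨σ, hσ, hσn⟩ := hop
    have hσ' : ∃ u b : ℂ, ∀ z, σ z = u * conj z + b := by
      obtain ⟨u, b, -, h | h⟩ := isometry_form σ
      · obtain ⟨w, hw⟩ := hσn u b
        exact absurd (h w) hw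
      · exact ⟨u, b, h⟩
    obtain ⟨u₀, b₀, h₀⟩ := hσ'
    refine ⟨max (‖z - c‖ + ‖c‖) (‖z - σ c‖ + ‖c‖), fun e he => ?_⟩
    obtain ⟨u, b, -, h | h⟩ := isometry_form e
    · exact (aux e c (hc e he ⟨u, b, h⟩)).trans (le_max_left _ _)
    -- The product of two orientation-reversing elements fixes `c`, so `e` sends `σ c` to `c`. Thus
    -- every element sends `c` or `σ c` to `c`.
    · refine (aux e (σ c) (hc (σ.trans e) (Γ.mul_mem he hσ) ⟨u * conj u₀, u * conj b₀ + b,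
        fun w => ?_⟩)).trans (le_max_right _ _)
      simp only [IsometryEquiv.trans_apply, h, h₀, map_add, map_mul, Complex.conj_conj]
      ring

lemma isBounded_poly (K : Kind) : Bornology.IsBounded (poly K) :=
  isBounded_convexHull.2 (corners_finite K).isBounded

/-- Finitely many bounded polygons cannot cover the plane. -/
lemma IsTiling.infinite_unitTiles {𝒬 : Set (Set H3)} (h : IsTiling 𝒬)
    (hu : ∃ P ∈ 𝒬, IsUnitTile P) : {P | P ∈ 𝒬 ∧ IsUnitTile P}.Infinite := by
  intro hfin
  have hb : Bornology.IsBounded (⋃ P ∈ {P | P ∈ 𝒬 ∧ IsUnitTile P}, crossSection P) := by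
    refine (Bornology.isBounded_biUnion hfin).2 ?_
    rintro _ ⟨-, K, e, rfl⟩
    rw [crossSection_ext_std]
    exact (Isometry.lipschitz e.isometry).isBounded_image (isBounded_poly K)
  have huniv : (⋃ P ∈ {P | P ∈ 𝒬 ∧ IsUnitTile P}, crossSection P) = univ := by
    rw [eq_univ_iff_forall]
    intro z
    obtain ⟨P, hP, hPu, hz⟩ := h.exists_unitTile_mem hu z
    exact mem_biUnion (show P ∈ {P | P ∈ 𝒬 ∧ IsUnitTile P} from ⟨hP, hPu⟩) (mem_crossSection.2 hz)
  rw [huniv] at hb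
  exact NormedSpace.unbounded_univ ℝ ℂ hb

lemma unbounded_ext_std (K : Kind) (e : ℂ ≃ᵢ ℂ) (M : ℝ) : ∃ x ∈ ext e '' std K, M < x.t := by
  have h1 : (1 : ℝ) ≤ max 1 (M + 1) := le_max_left _ _
  refine ⟨_, ⟨pt (center K) (max 1 (M + 1)) (one_pos.trans_le h1),
    mem_std_of_one_le (center_mem_poly K) h1, rfl⟩, ?_⟩
  exact (lt_add_one M).trans_le (le_max_right _ _)

section Cusp

variable {Γ : Subgroup (Equiv.Perm H3)} {𝒬 : Set (Set H3)}

/-- Group elements that fix `∞` and move a unit tile are isometries of the plane. -/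
lemma Config.eq_ext_of_sendsIdeal (h : Config Γ 𝒬) (hu : ∃ P ∈ 𝒬, IsUnitTile P)
    {g : Equiv.Perm H3} (hg : g ∈ Isom) (hgi : SendsIdeal g ∞ ∞) {K : Kind} {e : ℂ ≃ᵢ ℂ}
    (hP : g '' (ext e '' std K) ∈ 𝒬) : ∃ e', g = ext e' := by
  obtain ⟨k, hk, e', rfl⟩ := similarity_of_sendsIdeal hg hgi
  rw [← image_comp, ← Equiv.Perm.coe_mul, mul_assoc, ext_mul] at hP
  obtain rfl := h.tiling.scale_eq_one hu hP
  exact ⟨e', by rw [dil_one, one_mul]⟩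

/-- Suppose that `Γ` contains no translation. There are infinitely many unit tiles but finitely many
classes of them, so infinitely many are moved into each other by planar isometries in `Γ`. Those
have bounded orbits, so infinitely many tiles meet a compact set, against local finiteness. -/
theorem Config.isParabolicFixedPoint_infty (h : Config Γ 𝒬) (hu : ∃ P ∈ 𝒬, IsUnitTile P) :
    IsParabolicFixedPoint Γ ∞ := by
  by_contra hpar
  have hno : ∀ b, b ≠ 0 → ext (trans b) ∉ Γ := fun b hb hmem =>
    hpar (MixedPlatonic.isParabolicFixedPoint_infty hb hmem)
  obtain ⟨R, hR, hRQ, hall⟩ := h.finite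
  choose! K g hg hPg using fun P₀ (hP₀ : P₀ ∈ R) => h.tiling.isTile (hRQ hP₀)
  -- The class of a tile at `∞` records its orbit representative and which ideal vertex of the
  -- corresponding standard tile arrives at `∞`.
  let A : Set H3 × OnePoint ℂ → Set (Set H3) := fun i =>
    {P | (P ∈ 𝒬 ∧ IsUnitTile P) ∧ ∃ γ ∈ Γ, γ '' i.1 = P ∧ SendsIdeal (γ * g i.1) i.2 ∞}
  let I : Set (Set H3 × OnePoint ℂ) := ⋃ P₀ ∈ R, (fun p => (P₀, p)) '' idealVertices (K P₀)
  have hI : I.Finite := hR.biUnion fun P₀ _ => (idealVertices_finite _).image _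
  have hcover : {P | P ∈ 𝒬 ∧ IsUnitTile P} ⊆ ⋃ i ∈ I, A i := by
    rintro P ⟨hP, hPu⟩
    obtain ⟨γ, hγ, P₀, hP₀, hγP⟩ := hall P hP
    have hg' : γ * g P₀ ∈ Isom := Isom.mul_mem (h.isometries hγ) (hg P₀ hP₀)
    have himg : (γ * g P₀) '' std (K P₀) = P := by
      rw [Equiv.Perm.coe_mul, image_comp, ← hPg P₀ hP₀, hγP]
    rcases bounded_or_vertex (K P₀) hg' with ⟨M, hM⟩ | ⟨p, hp, hgp⟩
    · exfalso
      obtain ⟨K', e, rfl⟩ := hPu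
      obtain ⟨x, hx, hxM⟩ := unbounded_ext_std K' e M
      rw [← himg] at hx
      obtain ⟨y, hy, rfl⟩ := hx
      exact absurd (hM y hy) (not_le.2 hxM)
    · refine mem_biUnion (x := (P₀, p)) (mem_biUnion hP₀ ⟨p, hp, rfl⟩) ?_
      exact ⟨⟨hP, hPu⟩, γ, hγ, hγP, hgp⟩
  obtain ⟨i, hi, hAi⟩ : ∃ i ∈ I, (A i).Infinite := by
    by_contra! hcon
    exact h.tiling.infinite_unitTiles hu ((hI.biUnion fun i hi => hcon i hi).subset
      hcover)
  have hi1 : i.1 ∈ R := by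
    obtain ⟨P₀, hP₀, p, -, rfl⟩ := mem_iUnion₂.1 hi
    exact hP₀
  obtain ⟨P₁, ⟨⟨hP₁, K₁, e₁, hP₁e⟩, γ₁, hγ₁, hγP₁, hs₁⟩⟩ := hAi.nonempty
  -- Within one class the same vertex is sent to `∞`, so the element relating two tiles fixes `∞`;
  -- as it preserves their size, it is a planar isometry.
  have hmove : ∀ P ∈ A i, ∃ e : ℂ ≃ᵢ ℂ, ext e ∈ Γ ∧ ext e '' P₁ = P := by
    rintro P ⟨⟨hP, hPu⟩, γ, hγ, hγP, hs⟩
    have hmem : γ * γ₁⁻¹ ∈ Γ := Γ.mul_mem hγ (Γ.inv_mem hγ₁)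
    have himg : (γ * γ₁⁻¹) '' P₁ = P := by
      rw [Equiv.Perm.coe_mul, image_comp, ← hγP₁, image_image_inv, hγP]
    have hsend : SendsIdeal (γ * γ₁⁻¹) ∞ ∞ := by
      have h1 := hs.mul (hs₁.inv (Isom.mul_mem (h.isometries hγ₁) (hg i.1 hi1)))
      rwa [show γ * g i.1 * (γ₁ * g i.1)⁻¹ = γ * γ₁⁻¹ by group] at h1
    obtain ⟨e, he⟩ := h.eq_ext_of_sendsIdeal hu (h.isometries hmem) hsend (K := K₁) (e := e₁)
      (by rwa [← hP₁e, himg])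
    rw [he] at hmem himg
    exact ⟨e, hmem, himg⟩
  obtain ⟨M, hM⟩ := bounded_orbit_of_no_translation hno (e₁ (center K₁))
  have hcomp : IsCompact ((fun z : ℂ => pt z 1 one_pos) '' Metric.closedBall 0 M) :=
    (isCompact_closedBall 0 M).image continuous_horosphere
  have hfin := h.tiling.locallyFinite.finite_nonempty_inter_compact hcomp
  refine hAi ((hfin.image Subtype.val).subset fun P hP => ?_)
  obtain ⟨e, he, rfl⟩ := hmove P hP
  refine ⟨⟨_, hP.1.1⟩, ⟨pt (e (e₁ (center K₁))) 1 one_pos, ?_, _, ?_, rfl⟩, rfl⟩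
  · change _ ∈ ext e '' P₁
    rw [hP₁e]
    exact ⟨_, ⟨pt (center K₁) 1 one_pos, mem_std_of_one_le (center_mem_poly _) le_rfl, rfl⟩, rfl⟩
  · rw [mem_closedBall_zero_iff]
    exact hM e he

/-! ## From one vertex of a tetrahedron to another -/

/-- Both `∞` and the ideal vertex `e 0` of the tetrahedron are parabolic fixed points, so some `γ ∈
Γ` takes `e 0` to `∞`. Precomposed with the symmetry that exchanges the two vertices, it fixes `∞`
and maps the standard tetrahedron to a tile, so it is a planar isometry without scaling. -/
lemma Config.exists_move (h : Config Γ 𝒬) (hcusp : OneCusped Γ) {e : ℂ ≃ᵢ ℂ}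
    (hP : ext e '' std .tet ∈ 𝒬) : ∃ γ ∈ Γ, ∃ e' : ℂ ≃ᵢ ℂ, γ * ext e = ext e' * inv := by
  have hu : ∃ P ∈ 𝒬, IsUnitTile P := ⟨_, hP, _, _, rfl⟩
  set ψ := ext e * inv with hψdef
  have hψ : ψ ∈ Isom := Isom.mul_mem (ext_mem e) inv_mem
  have hψstd : ψ '' std .tet = ext e '' std .tet := by
    rw [hψdef, Equiv.Perm.coe_mul, image_comp, image_inv_std]
  have hψs : SendsIdeal ψ ∞ (e 0) := (sendsIdeal_ext_coe e 0).mul sendsIdeal_inv_infty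
  have h' := h.map (Isom.inv_mem hψ)
  -- After conjugation by `ψ⁻¹` the tiling contains the standard tetrahedron, the point `e 0` has
  -- become `∞`, and `Config.isParabolicFixedPoint_infty` applies.
  have hpar : IsParabolicFixedPoint Γ (e 0) := by
    have h1 := h'.isParabolicFixedPoint_infty
      ⟨std .tet, ⟨_, hP, by simp only [← hψstd, image_image_inv]⟩, .tet, IsometryEquiv.refl ℂ,
        (image_id _).symm⟩
    have h2 := h1.conjBy hψ hψs
    rwa [conjBy_conjBy, mul_inv_cancel, conjBy_one] at h2
  obtain ⟨γ, hγ, hγs⟩ := hcusp.exists_sendsIdeal h.isometries hpar (h.isParabolicFixedPoint_infty hu)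
  obtain ⟨e', he'⟩ := h.eq_ext_of_sendsIdeal hu (Isom.mul_mem (h.isometries hγ) hψ)
    (hγs.mul hψs) (K := .tet) (e := IsometryEquiv.refl ℂ) (by
      rw [ext_refl, Equiv.Perm.coe_one, image_id, Equiv.Perm.coe_mul, image_comp, hψstd]
      exact h.invariant γ hγ _ hP)
  refine ⟨γ, hγ, e', ?_⟩
  rw [← he', hψdef, mul_assoc, mul_assoc, inv_mul_inv, mul_one]

/-- In `𝒯`, the tile `s` abuts a polygon of kind `K` along its edge from `a` to `b`. -/
def Abuts (K : Kind) (𝒯 : Set (Set ℂ)) (s : Set ℂ) (a b : ℂ) : Prop :=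
  ∃ s' ∈ 𝒯, s' ≠ s ∧ IsPolygon K s' ∧ s ∩ s' = segment ℝ a b

lemma Abuts.symm {K : Kind} {𝒯 : Set (Set ℂ)} {s : Set ℂ} {a b : ℂ} (h : Abuts K 𝒯 s a b) :
    Abuts K 𝒯 s b a := by
  obtain ⟨s', h1, h2, h3, h4⟩ := h
  exact ⟨s', h1, h2, h3, by rw [h4, segment_symm]⟩

lemma mem_induced {P : Set H3} (hP : P ∈ 𝒬) (hne : (crossSection P).Nonempty) :
    crossSection P ∈ induced 𝒬 := ⟨hne, P, hP, rfl⟩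

lemma IsTiling.isPolygon_crossSection (h : IsTiling 𝒬) (hu : ∃ P ∈ 𝒬, IsUnitTile P) {K : Kind}
    {P : Set H3} (hP : P ∈ 𝒬) (hK : IsTile K P) (hne : (crossSection P).Nonempty) :
    IsPolygon K (crossSection P) := by
  obtain ⟨e, rfl⟩ := h.exists_eq_ext hu hP hK hne
  exact isPolygon_iff.2 ⟨e, crossSection_ext_std K e⟩

lemma IsTiling.isTile_of_isPolygon (h : IsTiling 𝒬) (hu : ∃ P ∈ 𝒬, IsUnitTile P) {K : Kind}
    {P : Set H3} (hP : P ∈ 𝒬) (hK : IsPolygon K (crossSection P))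
    (hne : (crossSection P).Nonempty) : IsTile K P := by
  obtain ⟨K', hK'⟩ := h.isTile hP
  rwa [hK.unique (h.isPolygon_crossSection hu hP hK' hne)]

/-- Since `γ * ext e = ext e' * inv`, the face shared with `Q`, read in standard coordinates and
inverted, is what `e'` places along the edge of the new triangle. -/
lemma Config.abuts_move (h : Config Γ 𝒬) {e e' : ℂ ≃ᵢ ℂ} (hP : ext e '' std .tet ∈ 𝒬)
    {γ : Equiv.Perm H3} (hγ : γ ∈ Γ) (he' : γ * ext e = ext e' * inv) {K : Kind} {Q : Set H3}
    (hQ : Q ∈ 𝒬) (hK : IsTile K Q) {a b c : ℂ}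
    (habc : UnitTriangle a b c) (hs : poly .tet = convexHull ℝ {a, b, c})
    (hseg : crossSection (inv '' (ext e ⁻¹' (ext e '' std .tet ∩ Q))) = segment ℝ a b) :
    Abuts K (induced 𝒬) (e' '' poly .tet) (e' a) (e' b) := by
  have hu : ∃ P ∈ 𝒬, IsUnitTile P := ⟨_, hP, _, _, rfl⟩
  have himg : γ '' (ext e '' std .tet) = ext e' '' std .tet := by
    rw [← image_comp, ← Equiv.Perm.coe_mul, he', Equiv.Perm.coe_mul, image_comp, image_inv_std]
  have hinter : e' '' poly .tet ∩ crossSection (γ '' Q) = segment ℝ (e' a) (e' b) := by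
    rw [← crossSection_ext_std, ← himg, ← crossSection_inter, ← image_inter γ.injective,
      ← isometry_image_segment, ← hseg, ← crossSection_ext]
    congr 1
    rw [← image_comp, ← Equiv.Perm.coe_mul, ← he', Equiv.Perm.coe_mul, image_comp,
      image_preimage_eq _ (ext e).surjective]
  have hne : (crossSection (γ '' Q)).Nonempty :=
    ⟨e' a, ((Set.ext_iff.1 hinter _).2 (left_mem_segment ℝ _ _)).2⟩
  have hγQ := h.invariant γ hγ Q hQ
  refine ⟨_, mem_induced hγQ hne, fun heq => ?_,
    h.tiling.isPolygon_crossSection hu hγQ (hK.map (h.isometries hγ)) hne, hinter⟩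
  -- If the neighbour were the triangle itself, the edge would be the whole triangle and contain the
  -- opposite vertex.
  rw [heq, inter_self, hs, isometry_image_convexHull] at hinter
  refine (habc.map e').notMem_segment ?_
  rw [← hinter]
  exact subset_convexHull ℝ _ (mem_image_of_mem _ (by simp))

lemma isometry_center_tet (e : ℂ ≃ᵢ ℂ) : e (center .tet) = (e 0 + e 1 + e omega) / 3 := by
  obtain ⟨u, b, -, h | h⟩ := isometry_form e
  · simp only [h, center]
    ring
  · simp only [h, center, map_div₀, map_add, map_zero, map_one, Complex.conj_ofNat]
    ring

/-- The highest point of the horizontal face of the tetrahedron over the triangle `a`, `b`, `c`. -/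
def bottomOf (a b c : ℂ) : H3 := pt ((a + b + c) / 3) (√(1 / 3)) (by positivity)

lemma ext_bottom (e : ℂ ≃ᵢ ℂ) : ext e bottom = bottomOf (e 0) (e 1) (e omega) :=
  H3_ext (isometry_center_tet e) rfl

/-- The labelling of the vertices is free, so any chosen one can play the role of `0`, the vertex
that will be moved to `∞`. -/
lemma IsTiling.exists_tetrahedron (h : IsTiling 𝒬) (hu : ∃ P ∈ 𝒬, IsUnitTile P) {P : Set H3}
    (hP : P ∈ 𝒬) {a b c : ℂ} (habc : UnitTriangle a b c)
    (hcs : crossSection P = convexHull ℝ {a, b, c}) :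
    ∃ e : ℂ ≃ᵢ ℂ, e 0 = a ∧ e 1 = b ∧ e omega = c ∧ P = ext e '' std .tet := by
  have hne : (crossSection P).Nonempty := by
    rw [hcs]
    exact ⟨a, subset_convexHull ℝ _ (by simp)⟩
  have hK := h.isTile_of_isPolygon hu hP (K := .tet) ⟨a, b, c, habc, hcs⟩ hne
  obtain ⟨e₀, rfl⟩ := h.exists_eq_ext hu hP hK hne
  obtain ⟨e, rfl, rfl, rfl⟩ := habc.exists_isometry
  refine ⟨e, rfl, rfl, rfl, ext_std_tet_congr ?_⟩
  rw [← crossSection_ext_std, hcs, image_poly_tet]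

/-- The types of the edges seen from the vertex `a` of a tetrahedron over `a`, `b`, `c`. -/
lemma Config.exists_triangle (h : Config Γ 𝒬) (hcusp : OneCusped Γ)
    (hu : ∃ P ∈ 𝒬, IsUnitTile P) {P Q : Set H3} (hP : P ∈ 𝒬) {a b c : ℂ}
    (habc : UnitTriangle a b c) (hcs : crossSection P = convexHull ℝ {a, b, c}) (hQ : Q ∈ 𝒬)
    (hQP : Q ≠ P) {X K₁ K₂ : Kind} (hX : IsTile X Q) (hbot : bottomOf a b c ∈ Q)
    (h₁ : Abuts K₁ (induced 𝒬) (crossSection P) a b)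
    (h₂ : Abuts K₂ (induced 𝒬) (crossSection P) a c) :
    ∃ a' b' c', UnitTriangle a' b' c' ∧ convexHull ℝ {a', b', c'} ∈ induced 𝒬 ∧
      Abuts K₁ (induced 𝒬) (convexHull ℝ {a', b', c'}) a' b' ∧
      Abuts K₂ (induced 𝒬) (convexHull ℝ {a', b', c'}) a' c' ∧
      Abuts X (induced 𝒬) (convexHull ℝ {a', b', c'}) b' c' := by
  obtain ⟨e, rfl, rfl, rfl, rfl⟩ := h.tiling.exists_tetrahedron hu hP habc hcs
  obtain ⟨γ, hγ, e', he'⟩ := h.exists_move hcusp hP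
  have himg : γ '' (ext e '' std .tet) = ext e' '' std .tet := by
    rw [← image_comp, ← Equiv.Perm.coe_mul, he', Equiv.Perm.coe_mul, image_comp, image_inv_std]
  have hcs' : crossSection (ext e' '' std .tet) = convexHull ℝ {e' 0, e' 1, e' omega} := by
    rw [crossSection_ext_std, image_poly_tet]
  -- The two vertical faces through the edge from `0` to `∞` are invariant under the inversion, so
  -- they keep their position and their neighbours.
  have vertical : ∀ {K : Kind} {v : ℂ},
      Abuts K (induced 𝒬) (crossSection (ext e '' std .tet)) (e 0) (e v) →
      ∃ Q ∈ 𝒬, IsTile K Q ∧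
        crossSection (inv '' (ext e ⁻¹' (ext e '' std .tet ∩ Q))) = segment ℝ 0 v := by
    rintro K v ⟨_, ⟨hne, Q, hQ, rfl⟩, hsne, hpoly, hseg⟩
    refine ⟨Q, hQ, h.tiling.isTile_of_isPolygon hu hQ hpoly hne, ?_⟩
    have hne' : ext e '' std .tet ≠ Q := fun h => hsne (by rw [h])
    have hF : crossSection (ext e ⁻¹' (ext e '' std .tet ∩ Q)) = segment ℝ 0 v := by
      have h1 : ext e ⁻¹' (ext e '' std .tet ∩ Q) = ext e.symm '' (ext e '' std .tet ∩ Q) := by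
        rw [perm_image_eq_preimage (ext e.symm)]
        rfl
      rw [h1, crossSection_ext, crossSection_inter, hseg, isometry_image_segment,
        IsometryEquiv.symm_apply_apply, IsometryEquiv.symm_apply_apply]
    rw [image_inv_vertical_face (h.tiling.isFace_std (ext_mem e) hP hQ hne'), hF]
    rw [← mem_crossSection, hF]
    exact left_mem_segment ℝ _ _
  obtain ⟨Q₁, hQ₁, hK₁, hs₁⟩ := vertical h₁
  obtain ⟨Q₂, hQ₂, hK₂, hs₂⟩ := vertical h₂
  -- The hidden face becomes the vertical face over the edge opposite to `0`.
  have hs : crossSection (inv '' (ext e ⁻¹' (ext e '' std .tet ∩ Q))) = segment ℝ 1 omega := by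
    refine crossSection_inv_bottom_face (h.tiling.isFace_std (ext_mem e) hP hQ (Ne.symm hQP)) ?_
    refine ⟨mem_image_of_mem _ bottom_mem, ?_⟩
    rwa [ext_bottom]
  refine ⟨e' 0, e' 1, e' omega, unitTriangle_std.map e', ?_, ?_, ?_, ?_⟩
  · rw [← hcs']
    refine mem_induced (himg ▸ h.invariant γ hγ _ hP) ?_
    rw [hcs']
    exact ⟨e' 0, subset_convexHull ℝ _ (by simp)⟩
  · rw [← image_poly_tet]
    exact h.abuts_move hP hγ he' hQ₁ hK₁ unitTriangle_std rfl hs₁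
  · rw [← image_poly_tet]
    refine h.abuts_move hP hγ he' hQ₂ hK₂ (c := 1) unitTriangle_std.rotate.rotate.swap ?_ hs₂
    rw [poly, corners, pair_comm]
  · rw [← image_poly_tet]
    refine h.abuts_move hP hγ he' hQ hX (c := 0) unitTriangle_std.rotate ?_ hs
    rw [poly, corners]
    congr 1
    ext z
    simp only [mem_insert_iff, mem_singleton_iff]
    tauto

/-- The point `bottom` is on the boundary of the tetrahedron: directly below it the tetrahedron is
left. -/
lemma IsTiling.exists_bottom (h : IsTiling 𝒬) (hu : ∃ P ∈ 𝒬, IsUnitTile P) {P : Set H3}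
    (hP : P ∈ 𝒬) {a b c : ℂ} (habc : UnitTriangle a b c)
    (hcs : crossSection P = convexHull ℝ {a, b, c}) :
    ∃ Q ∈ 𝒬, Q ≠ P ∧ bottomOf a b c ∈ Q ∧ ∃ X, IsTile X Q := by
  obtain ⟨e, rfl, rfl, rfl, rfl⟩ := h.exists_tetrahedron hu hP habc hcs
  have hn : ext e '' std .tet ∉ 𝓝 (ext e bottom) := by
    intro hmem
    have h1 := (continuous_ext e).continuousAt hmem
    rw [mem_map, preimage_image_eq _ (ext e).injective] at h1
    exact std_tet_notMem_nhds_bottom h1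
  obtain ⟨Q, hQ, hQP, hb⟩ := h.exists_other hn
  rw [ext_bottom] at hb
  exact ⟨Q, hQ, hQP, hb, h.isTile hQ⟩

/-! ### The two implications between types of triangles -/

lemma hull_rotate (a b c : ℂ) : convexHull ℝ {a, b, c} = convexHull ℝ ({b, c, a} : Set ℂ) := by
  congr 1
  ext z
  simp only [mem_insert_iff, mem_singleton_iff]
  tauto

lemma hull_swap (a b c : ℂ) : convexHull ℝ {a, b, c} = convexHull ℝ ({b, a, c} : Set ℂ) := by
  rw [insert_comm]

lemma bottomOf_rotate (a b c : ℂ) : bottomOf a b c = bottomOf b c a :=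
  H3_ext (by simp only [bottomOf, pt_z]; ring) rfl

/-- The squares lie on the edges `ab` and `bc`. If the hidden neighbour is a tetrahedron, the view
from `c` shows one square and two triangles; if it is an octahedron, the view from `b` shows three
squares. -/
theorem Config.of_isOOT (h : Config Γ 𝒬) (hcusp : OneCusped Γ) (hu : ∃ P ∈ 𝒬, IsUnitTile P)
    (hs : ∃ s, IsOOT (induced 𝒬) s) :
    (∃ s, IsOOO (induced 𝒬) s) ∨ ∃ s, IsOTT (induced 𝒬) s := by
  obtain ⟨_, ⟨-, P, hP, rfl⟩, a, b, c, habc, hcs, hab, hbc, hca⟩ := hs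
  obtain ⟨Q, hQ, hQP, hbot, X, hX⟩ := h.tiling.exists_bottom hu hP habc hcs
  have hab : Abuts .oct (induced 𝒬) (crossSection P) a b := hab
  have hbc : Abuts .oct (induced 𝒬) (crossSection P) b c := hbc
  have hca : Abuts .tet (induced 𝒬) (crossSection P) c a := hca
  cases X
  · right
    obtain ⟨a', b', c', h1, h2, h3, h4, h5⟩ := h.exists_triangle hcusp hu hP habc.rotate.rotate
      (by rw [hcs, hull_rotate, hull_rotate]) hQ hQP hX
      (by rwa [← bottomOf_rotate, ← bottomOf_rotate]) hca hbc.symm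
    exact ⟨_, h2, c', a', b', h1.rotate.rotate, by rw [← hull_rotate, ← hull_rotate],
      h4.symm, h3, h5⟩
  · left
    obtain ⟨a', b', c', h1, h2, h3, h4, h5⟩ := h.exists_triangle hcusp hu hP habc.rotate
      (by rw [hcs, hull_rotate]) hQ hQP hX (by rwa [← bottomOf_rotate]) hbc hab.symm
    exact ⟨_, h2, a', b', c', h1, rfl, h3, h5, h4.symm⟩

/-- The square lies on `ab`. If the hidden neighbour is a tetrahedron, the view from `c` shows three
triangles; if it is an octahedron, the view from `a` shows two squares and a triangle. -/
theorem Config.of_isOTT (h : Config Γ 𝒬) (hcusp : OneCusped Γ) (hu : ∃ P ∈ 𝒬, IsUnitTile P)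
    (hs : ∃ s, IsOTT (induced 𝒬) s) :
    (∃ s, IsOOT (induced 𝒬) s) ∨ ∃ s, IsTTT (induced 𝒬) s := by
  obtain ⟨_, ⟨-, P, hP, rfl⟩, a, b, c, habc, hcs, hab, hbc, hca⟩ := hs
  obtain ⟨Q, hQ, hQP, hbot, X, hX⟩ := h.tiling.exists_bottom hu hP habc hcs
  have hab : Abuts .oct (induced 𝒬) (crossSection P) a b := hab
  have hbc : Abuts .tet (induced 𝒬) (crossSection P) b c := hbc
  have hca : Abuts .tet (induced 𝒬) (crossSection P) c a := hca
  cases X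
  · right
    obtain ⟨a', b', c', h1, h2, h3, h4, h5⟩ := h.exists_triangle hcusp hu hP habc.rotate.rotate
      (by rw [hcs, hull_rotate, hull_rotate]) hQ hQP hX
      (by rwa [← bottomOf_rotate, ← bottomOf_rotate]) hca hbc.symm
    exact ⟨_, h2, a', b', c', h1, rfl, h3, h5, h4.symm⟩
  · left
    obtain ⟨a', b', c', h1, h2, h3, h4, h5⟩ := h.exists_triangle hcusp hu hP habc hcs hQ hQP hX
      hbot hab hca.symm
    exact ⟨_, h2, a', b', c', h1, rfl, h3, h5, h4.symm⟩

end Cusp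

/-! ## Types of the edges are unique -/

lemma center_mem_interior_poly (K : Kind) : center K ∈ interior (poly K) := by
  have h3 := sqrt_three_sq
  have h3p : 0 < √3 := by positivity
  rw [mem_interior]
  cases K
  · refine ⟨{z | 0 < z.im ∧ z.im < √3 * z.re ∧ z.im < √3 * (1 - z.re)}, ?_, ?_, ?_⟩
    · rintro z ⟨h1, h2, h4⟩
      exact mem_poly_tet.2 ⟨h1.le, h2.le, h4.le⟩
    · exact (isOpen_lt continuous_const Complex.continuous_im).inter
        ((isOpen_lt Complex.continuous_im (by fun_prop)).inter
          (isOpen_lt Complex.continuous_im (by fun_prop)))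
    · simp only [mem_ofPred_eq, center_tet_re, center_tet_im]
      refine ⟨by positivity, by linarith, by linarith⟩
  · refine ⟨{z | (0 < z.re ∧ z.re < 1) ∧ 0 < z.im ∧ z.im < 1}, ?_, ?_, ?_⟩
    · rintro z ⟨⟨h1, h2⟩, h3, h4⟩
      exact mem_poly_oct.2 ⟨h1.le, h2.le, h3.le, h4.le⟩
    · exact ((isOpen_lt continuous_const Complex.continuous_re).inter
        (isOpen_lt Complex.continuous_re continuous_const)).inter
        ((isOpen_lt continuous_const Complex.continuous_im).inter
          (isOpen_lt Complex.continuous_im continuous_const))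
    · simp only [mem_ofPred_eq, center_oct_re, center_oct_im]
      norm_num

/-- Points between an interior point and a point of the edge are interior; those used here lie
straight above or below the midpoint of the edge. -/
lemma mem_interior_of_edge {B : Set ℂ} (hB : Convex ℝ B) (h0 : (0 : ℂ) ∈ B) (h1 : (1 : ℂ) ∈ B)
    {y : ℂ} (hy : y ∈ interior B) :
    ∃ δ > 0, ∀ ε, 0 < ε → ε < δ → (⟨1 / 2, ε * y.im⟩ : ℂ) ∈ interior B := by
  refine ⟨1 / (2 * (|y.re| + 1)), by positivity, fun ε hε hεδ => ?_⟩
  rw [lt_div_iff₀ (by positivity)] at hεδ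
  have ha := abs_nonneg y.re
  have ha1 := le_abs_self y.re
  have ha2 := neg_abs_le y.re
  have hε1 : 0 < 1 - ε := by nlinarith
  -- Solves `(1 - ε) * q + ε * y.re = 1 / 2`; the bound on `ε` keeps `q` on the edge.
  let q : ℝ := (1 / 2 - ε * y.re) / (1 - ε)
  have hq0 : 0 ≤ q := div_nonneg (by nlinarith) hε1.le
  have hq1 : q ≤ 1 := by
    rw [div_le_one hε1]
    nlinarith
  have hqB : (q : ℂ) ∈ B := by
    have := hB h0 h1 (sub_nonneg.2 hq1) hq0 (by ring)
    simpa using this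
  refine hB.openSegment_self_interior_subset_interior hqB hy ⟨1 - ε, ε, hε1, hε, by ring, ?_⟩
  have hq : (1 - ε) * q = 1 / 2 - ε * y.re := mul_div_cancel₀ _ hε1.ne'
  apply Complex.ext
  · simp only [Complex.add_re, Complex.real_smul, Complex.re_ofReal_mul, Complex.ofReal_re]
    linarith
  · simp

/-- Near the midpoint of the common edge both interiors contain short vertical segments on the same
side. The parameters for `y` and `y'` are chosen in the ratio that gives one common point. -/
lemma overlap_of_same_side {B C : Set ℂ} (hB : Convex ℝ B) (hB0 : (0 : ℂ) ∈ B)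
    (hB1 : (1 : ℂ) ∈ B) (hC : Convex ℝ C) (hC0 : (0 : ℂ) ∈ C) (hC1 : (1 : ℂ) ∈ C) {y y' : ℂ}
    (hy : y ∈ interior B) (hy' : y' ∈ interior C) (hs : 0 < y.im * y'.im) :
    (interior (B ∩ C)).Nonempty := by
  have hyi : y.im ≠ 0 := fun h => by simp [h] at hs
  obtain ⟨δ, hδ, h⟩ := mem_interior_of_edge hB hB0 hB1 hy
  obtain ⟨δ', hδ', h'⟩ := mem_interior_of_edge hC hC0 hC1 hy'
  have hr : 0 < y'.im / y.im := by
    rw [← mul_div_mul_left _ _ hyi]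
    exact div_pos hs (mul_self_pos.2 hyi)
  obtain ⟨ε, hε, hεm⟩ := exists_between (lt_min hδ' (div_pos hδ hr))
  have e1 : ε * (y'.im / y.im) < δ := by
    rw [← lt_div_iff₀ hr]
    exact hεm.trans_le (min_le_right _ _)
  have m1 := h _ (mul_pos hε hr) e1
  have m2 := h' ε hε (hεm.trans_le (min_le_left _ _))
  rw [mul_assoc, div_mul_cancel₀ _ hyi] at m1
  rw [interior_inter]
  exact ⟨_, m1, m2⟩

lemma exists_mem_interior_im_ne {B : Set ℂ} (h : (interior B).Nonempty) :
    ∃ y ∈ interior B, y.im ≠ 0 := by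
  obtain ⟨x, hx⟩ := h
  by_cases hx0 : x.im = 0
  · have hc : ContinuousAt (fun s : ℝ => x + s * Complex.I) 0 := by fun_prop
    have h1 := hc.eventually_mem (s := interior B) (by simpa using isOpen_interior.mem_nhds hx)
    obtain ⟨s, hs0, hs⟩ := ((eventually_mem_nhdsWithin (a := (0 : ℝ)) (s := Ioi 0)).and
      (eventually_nhdsWithin_of_eventually_nhds h1)).exists
    exact ⟨_, hs, by simpa [hx0] using (ne_of_gt hs0 : s ≠ 0)⟩
  · exact ⟨x, hx, hx0⟩

lemma IsPolygon.convex {K : Kind} {s : Set ℂ} (h : IsPolygon K s) : Convex ℝ s := by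
  obtain ⟨e, rfl⟩ := isPolygon_iff.1 h
  rw [poly, isometry_image_convexHull]
  exact convex_convexHull ℝ _

lemma isometry_interior (e : ℂ ≃ᵢ ℂ) (s : Set ℂ) : e '' interior s = interior (e '' s) :=
  e.toHomeomorph.image_interior s

lemma IsPolygon.interior_nonempty {K : Kind} {s : Set ℂ} (h : IsPolygon K s) :
    (interior s).Nonempty := by
  obtain ⟨e, rfl⟩ := isPolygon_iff.1 h
  rw [← isometry_interior]
  exact ⟨_, mem_image_of_mem e (center_mem_interior_poly K)⟩

lemma IsPolygon.map {K : Kind} {s : Set ℂ} (h : IsPolygon K s) (e : ℂ ≃ᵢ ℂ) :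
    IsPolygon K (e '' s) := by
  obtain ⟨f, rfl⟩ := isPolygon_iff.1 h
  rw [← image_comp]
  exact isPolygon_iff.2 ⟨f.trans e, rfl⟩

section Planar

variable {𝒬 : Set (Set H3)}

/-- Tiles of the tiling do not overlap, so any tile along the edge lies on the side away from the
triangle. Two tiles there would overlap each other, and one polygon cannot be both a triangle and a
square. -/
lemma IsTiling.abuts_unique (h : IsTiling 𝒬) (hu : ∃ P ∈ 𝒬, IsUnitTile P) {a b c : ℂ}
    (habc : UnitTriangle a b c) (hs : convexHull ℝ {a, b, c} ∈ induced 𝒬) {K K' : Kind}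
    (hK : Abuts K (induced 𝒬) (convexHull ℝ {a, b, c}) a b)
    (hK' : Abuts K' (induced 𝒬) (convexHull ℝ {a, b, c}) a b) : K = K' := by
  have hdisj : ∀ s ∈ induced 𝒬, ∀ t ∈ induced 𝒬, s ≠ t → interior (s ∩ t) = ∅ := by
    rintro _ ⟨-, P, hP, rfl⟩ _ ⟨-, Q, hQ, rfl⟩ hne
    exact h.interior_inter_eq_empty hu hP hQ fun h => hne (by rw [h])
  obtain ⟨e, rfl, rfl, rfl⟩ := habc.exists_isometry
  rw [← image_poly_tet] at *
  have main : ∀ {L : Kind} {t : Set ℂ}, t ∈ induced 𝒬 → t ≠ e '' poly .tet → IsPolygon L t →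
      e '' poly .tet ∩ t = segment ℝ (e 0) (e 1) → (0 : ℂ) ∈ e.symm '' t ∧ (1 : ℂ) ∈ e.symm '' t ∧
        ∃ y ∈ interior (e.symm '' t), y.im < 0 := by
    intro L t ht htne hL hseg
    have hm : ∀ x ∈ segment ℝ (e 0) (e 1), e.symm x ∈ e.symm '' t := fun x hx => by
      rw [← hseg] at hx
      exact mem_image_of_mem _ hx.2
    have h0 := hm _ (left_mem_segment ℝ _ _)
    have h1 := hm _ (right_mem_segment ℝ _ _)
    rw [IsometryEquiv.symm_apply_apply] at h0 h1
    refine ⟨h0, h1, ?_⟩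
    obtain ⟨y, hy, hy0⟩ := exists_mem_interior_im_ne (hL.map e.symm).interior_nonempty
    refine ⟨y, hy, lt_of_le_of_ne (not_lt.1 fun hpos => ?_) hy0⟩
    have h3p : 0 < √3 := by positivity
    have hne := overlap_of_same_side (convex_convexHull ℝ (corners .tet))
      (corners_subset_poly .tet (by simp [corners])) (corners_subset_poly .tet (by simp [corners]))
      (hL.map e.symm).convex h0 h1 (center_mem_interior_poly .tet) hy (by
        rw [center_tet_im]
        positivity)
    have himg := hne.image e
    rw [isometry_interior, image_inter e.injective, ← image_comp e e.symm] at himg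
    have hid : ⇑e ∘ ⇑e.symm = id := by
      ext x
      simp
    rw [hid, image_id] at himg
    exact himg.ne_empty (hdisj _ hs t ht htne.symm)
  obtain ⟨t, ht, htne, hL, hseg⟩ := hK
  obtain ⟨t', ht', htne', hL', hseg'⟩ := hK'
  obtain ⟨a0, a1, y, hy, hyn⟩ := main ht htne hL hseg
  obtain ⟨b0, b1, y', hy', hyn'⟩ := main ht' htne' hL' hseg'
  by_cases htt : t = t'
  · subst htt
    exact hL.unique hL'
  · exfalso
    have hne := overlap_of_same_side (hL.map e.symm).convex a0 a1 (hL'.map e.symm).convex b0 b1 hy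
      hy' (mul_pos_of_neg_of_neg hyn hyn')
    rw [← image_inter e.symm.injective, ← isometry_interior, hdisj t ht t' ht' htt, image_empty]
      at hne
    exact not_nonempty_empty hne

/-- The number of squares among the neighbours. -/
def Kind.weight : Kind → ℕ
  | .tet => 0
  | .oct => 1

/-- The vertices are the extreme points of the triangle, so the two labellings differ by a
permutation, and `IsTiling.abuts_unique` applies edge by edge. This makes the type independent of
the labelling. -/
lemma IsTiling.weight_eq (h : IsTiling 𝒬) (hu : ∃ P ∈ 𝒬, IsUnitTile P) {a b c p q r : ℂ}
    (habc : UnitTriangle a b c) (hpqr : UnitTriangle p q r)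
    (heq : convexHull ℝ {a, b, c} = convexHull ℝ ({p, q, r} : Set ℂ))
    (hs : convexHull ℝ {a, b, c} ∈ induced 𝒬) {K₁ K₂ K₃ L₁ L₂ L₃ : Kind}
    (hab : Abuts K₁ (induced 𝒬) (convexHull ℝ {a, b, c}) a b)
    (hbc : Abuts K₂ (induced 𝒬) (convexHull ℝ {a, b, c}) b c)
    (hca : Abuts K₃ (induced 𝒬) (convexHull ℝ {a, b, c}) c a)
    (hpq : Abuts L₁ (induced 𝒬) (convexHull ℝ {a, b, c}) p q)
    (hqr : Abuts L₂ (induced 𝒬) (convexHull ℝ {a, b, c}) q r)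
    (hrp : Abuts L₃ (induced 𝒬) (convexHull ℝ {a, b, c}) r p) :
    K₁.weight + K₂.weight + K₃.weight = L₁.weight + L₂.weight + L₃.weight := by
  have u1 : ∀ {K K'}, Abuts K (induced 𝒬) (convexHull ℝ {a, b, c}) a b →
      Abuts K' (induced 𝒬) (convexHull ℝ {a, b, c}) a b → K = K' := h.abuts_unique hu habc hs
  have u2 : ∀ {K K'}, Abuts K (induced 𝒬) (convexHull ℝ {a, b, c}) b c →
      Abuts K' (induced 𝒬) (convexHull ℝ {a, b, c}) b c → K = K' := by
    rw [hull_rotate] at hs ⊢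
    exact h.abuts_unique hu habc.rotate hs
  have u3 : ∀ {K K'}, Abuts K (induced 𝒬) (convexHull ℝ {a, b, c}) c a →
      Abuts K' (induced 𝒬) (convexHull ℝ {a, b, c}) c a → K = K' := by
    rw [hull_rotate, hull_rotate] at hs ⊢
    exact h.abuts_unique hu habc.rotate.rotate hs
  have hset : ({a, b, c} : Set ℂ) = {p, q, r} := by
    rw [← habc.extremePoints_eq, heq, hpqr.extremePoints_eq]
  have hne : ∀ {x y z : ℂ}, UnitTriangle x y z → x ≠ y ∧ y ≠ z ∧ z ≠ x := by
    rintro x y z ⟨h1, h2, h3⟩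
    refine ⟨?_, ?_, ?_⟩ <;> rintro rfl <;> simp_all
  obtain ⟨n1, n2, n3⟩ := hne hpqr
  have hp : p = a ∨ p = b ∨ p = c := by simpa using hset.symm.subset (mem_insert p _)
  have hq : q = a ∨ q = b ∨ q = c := by simpa using hset.symm.subset (show q ∈ _ by simp)
  have hr : r = a ∨ r = b ∨ r = c := by simpa using hset.symm.subset (show r ∈ _ by simp)
  -- Of the 27 assignments, those with a repetition are absurd; the six permutations match the edges
  -- cyclically, with or without reversal.
  rcases hp with rfl | rfl | rfl <;> rcases hq with rfl | rfl | rfl <;>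
    rcases hr with rfl | rfl | rfl <;>
    first
    | exact absurd rfl n1
    | exact absurd rfl n2
    | exact absurd rfl n3
    | (rw [u1 hab hpq, u2 hbc hqr, u3 hca hrp])
    | (rw [u1 hab hqr, u2 hbc hrp, u3 hca hpq]; ring)
    | (rw [u1 hab hrp, u2 hbc hpq, u3 hca hqr]; ring)
    | (rw [u1 hab hpq.symm, u2 hbc hrp.symm, u3 hca hqr.symm]; ring)
    | (rw [u1 hab hqr.symm, u2 hbc hpq.symm, u3 hca hrp.symm]; ring)
    | (rw [u1 hab hrp.symm, u2 hbc hqr.symm, u3 hca hpq.symm]; ring)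

end Planar

/-! ## Explicit tiles of the plane -/

/-- The triangle to the left of the edge from `a` to `a + u`. -/
def tri (a u : ℂ) : Set ℂ := convexHull ℝ {a, a + u, a + omega * u}

/-- The square to the left of the edge from `a` to `a + u`. -/
def sq (a u : ℂ) : Set ℂ := convexHull ℝ {a, a + u, a + u + Complex.I * u, a + Complex.I * u}

/-- The tile of kind `K` to the left of the edge from `a` to `a + u`. -/
def tile : Kind → ℂ → ℂ → Set ℂ
  | .tet => tri
  | .oct => sq

lemma omega_sq : omega * omega = omega - 1 := by
  have := sqrt_three_sq
  apply Complex.ext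
  · simp
    nlinarith
  · simp
    ring

lemma tri_rotate (a u : ℂ) : tri a u = tri (a + u) (omega * omega * u) := by
  have e1 : a + u + omega * omega * u = a + omega * u := by rw [omega_sq]; ring
  have e2 : a + u + omega * (omega * omega * u) = a := by
    linear_combination (omega * u + u) * omega_sq
  rw [tri, tri, e1, e2, hull_rotate]

lemma sq_rotate (a u : ℂ) : sq a u = sq (a + u) (Complex.I * u) := by
  have e1 : a + u + Complex.I * u + Complex.I * (Complex.I * u) = a + Complex.I * u := by
    linear_combination u * Complex.I_mul_I
  have e2 : a + u + Complex.I * (Complex.I * u) = a := by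
    linear_combination u * Complex.I_mul_I
  rw [sq, sq, e1, e2]
  congr 1
  ext z
  simp only [mem_insert_iff, mem_singleton_iff]
  tauto

lemma translate_tile (K : Kind) (a u v : ℂ) :
    (fun z => z + v) '' tile K a u = tile K (a + v) u := by
  have h : ∀ B : Set ℂ, (fun z => z + v) '' convexHull ℝ B =
      convexHull ℝ ((fun z => z + v) '' B) := isometry_image_convexHull (IsometryEquiv.addRight v)
  cases K
  · simp only [tile, tri, h, image_insert_eq, image_singleton, add_right_comm _ _ v]
  · simp only [tile, sq, h, image_insert_eq, image_singleton, add_right_comm _ _ v]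

lemma isPolygon_tile (K : Kind) (a : ℂ) {u : ℂ} (hu : ‖u‖ = 1) : IsPolygon K (tile K a u) := by
  cases K
  · refine isTriangle_iff.2 ⟨rotIso u a hu, ?_⟩
    rw [image_poly_tet]
    simp only [tile, tri, rotIso_apply]
    ring_nf
  · exact ⟨a, u, hu, rfl⟩

lemma unitTriangle_tri (a : ℂ) {u : ℂ} (hu : ‖u‖ = 1) :
    UnitTriangle a (a + u) (a + omega * u) := by
  have := unitTriangle_std.map (rotIso u a hu)
  simp only [rotIso_apply] at this
  rw [mul_zero, zero_add, mul_one, add_comm u a, add_comm (u * omega) a, mul_comm u omega] at this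
  exact this

lemma poly_tet_inter_below {B : Set ℂ} (hB : ∀ z ∈ B, z.im ≤ 0) (h0 : (0 : ℂ) ∈ B)
    (h1 : (1 : ℂ) ∈ B) : poly .tet ∩ convexHull ℝ B = segment ℝ 0 1 := by
  have h3p : 0 < √3 := by positivity
  apply Subset.antisymm
  · rintro z ⟨hz, hzB⟩
    rw [mem_poly_tet] at hz
    have hz0 : z.im ≤ 0 := by
      have := aff_nonneg_of_hull (A := B) (b := ⟨0, -1 / 2⟩) (c := 0)
        (fun v hv => by
          rw [aff_eq]
          have := hB v hv
          linarith) z hzB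
      rw [aff_eq] at this
      linarith
    have him : z.im = 0 := le_antisymm hz0 hz.1
    rw [him] at hz
    have hr0 : 0 ≤ z.re := nonneg_of_mul_nonneg_right hz.2.1 h3p
    have hr1 : 0 ≤ 1 - z.re := nonneg_of_mul_nonneg_right hz.2.2 h3p
    refine ⟨1 - z.re, z.re, hr1, hr0, by ring, ?_⟩
    apply Complex.ext
    · simp
    · simp [him]
  · refine subset_inter ?_ ?_
    · exact (convex_convexHull ℝ _).segment_subset (corners_subset_poly .tet (by simp [corners]))
        (corners_subset_poly .tet (by simp [corners]))
    · exact (convex_convexHull ℝ _).segment_subset (subset_convexHull ℝ _ h0)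
        (subset_convexHull ℝ _ h1)

lemma tri_inter_tile (K : Kind) (a : ℂ) {u : ℂ} (hu : ‖u‖ = 1) :
    tri a u ∩ tile K (a + u) (-u) = segment ℝ a (a + u) := by
  have h3p : 0 < √3 := by positivity
  let e := rotIso u a hu
  have e1 : tri a u = e '' poly .tet := by
    rw [image_poly_tet]
    simp only [e, tri, rotIso_apply]
    ring_nf
  have e2 : tile K (a + u) (-u) = e '' tile K 1 (-1) := by
    cases K
    · simp only [e, tile, tri, isometry_image_convexHull, image_insert_eq, image_singleton,
        rotIso_apply]
      ring_nf
    · simp only [e, tile, sq, isometry_image_convexHull, image_insert_eq, image_singleton,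
        rotIso_apply]
      ring_nf
  have e3 : poly .tet ∩ tile K 1 (-1) = segment ℝ 0 1 := by
    cases K
    · refine poly_tet_inter_below ?_ (by simp) (by simp)
      rintro z (rfl | rfl | rfl)
      · simp
      · simp
      · simp
        positivity
    · refine poly_tet_inter_below ?_ (by simp) (by simp)
      rintro z (rfl | rfl | rfl | rfl)
      · simp
      · simp
      · simp
      · simp
  rw [e1, e2, ← image_inter e.injective, e3, isometry_image_segment]
  simp only [e, rotIso_apply]
  ring_nf

lemma abuts_tri {𝒯 : Set (Set ℂ)} {K : Kind} {a u : ℂ} (hu : ‖u‖ = 1)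
    (h : tile K (a + u) (-u) ∈ 𝒯) : Abuts K 𝒯 (tri a u) a (a + u) := by
  refine ⟨_, h, fun heq => ?_, isPolygon_tile K _ (by rwa [norm_neg]), tri_inter_tile K a hu⟩
  have h1 := tri_inter_tile K a hu
  rw [heq, inter_self] at h1
  refine (unitTriangle_tri a hu).notMem_segment ?_
  rw [← h1]
  exact subset_convexHull ℝ _ (by simp)

/-- The tiles next to the three edges of `tri a u` are of the kinds `K₁`, `K₂` and `K₃`. -/
structure Neighbours (𝒯 : Set (Set ℂ)) (K₁ K₂ K₃ : Kind) (a u : ℂ) : Prop where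
  norm : ‖u‖ = 1
  mem : tri a u ∈ 𝒯
  first : tile K₁ (a + u) (-u) ∈ 𝒯
  second : tile K₂ (a + omega * u) (-(omega * omega * u)) ∈ 𝒯
  third : tile K₃ a (omega * u) ∈ 𝒯

lemma norm_omega : ‖omega‖ = 1 := by
  rw [norm_eq_one_iff]
  have := sqrt_three_sq
  simp
  linarith

/-- The edges of `tri a u` have the directions `u`, `ω² u` and `ω⁴ u = -ω u`; each neighbour lies to
the left of the reversed edge. Two rotations of the labels reduce the other edges to the first. -/
lemma Neighbours.abuts {𝒯 : Set (Set ℂ)} {K₁ K₂ K₃ : Kind} {a u : ℂ}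
    (h : Neighbours 𝒯 K₁ K₂ K₃ a u) : Abuts K₁ 𝒯 (tri a u) a (a + u) ∧
      Abuts K₂ 𝒯 (tri a u) (a + u) (a + omega * u) ∧ Abuts K₃ 𝒯 (tri a u) (a + omega * u) a := by
  have hu := h.norm
  have e1 : a + u + omega * omega * u = a + omega * u := by rw [omega_sq]; ring
  have e2 : a + omega * u + omega * omega * (omega * omega * u) = a := by
    linear_combination (u * omega * omega + omega * u) * omega_sq
  have e3 : -(omega * omega * (omega * omega * u)) = omega * u := by
    linear_combination -(u * omega * omega + omega * u) * omega_sq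
  refine ⟨abuts_tri hu h.first, ?_, ?_⟩
  · have h1 := abuts_tri (𝒯 := 𝒯) (K := K₂) (a := a + u) (u := omega * omega * u)
      (by simp [hu, norm_omega]) (by rw [e1]; exact h.second)
    rwa [← tri_rotate, e1] at h1
  · have h1 := abuts_tri (𝒯 := 𝒯) (K := K₃) (a := a + omega * u)
      (u := omega * omega * (omega * omega * u))
      (by simp [hu, norm_omega]) (by rw [e2, e3]; exact h.third)
    have h2 : tri (a + omega * u) (omega * omega * (omega * omega * u)) = tri a u := by
      rw [tri_rotate a u, tri_rotate (a + u), e1]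
    rwa [h2, e2] at h1

lemma mem_latticeTranslates {μ l : ℂ} {D : Set (Set ℂ)} {K : Kind} {a u : ℂ} (h : tile K a u ∈ D)
    (m n : ℤ) : tile K (a + (m * μ + n * l)) u ∈ latticeTranslates μ l D :=
  ⟨m, n, _, h, (translate_tile K a u _).symm⟩

lemma latticeTranslates_translate {μ l : ℂ} {D : Set (Set ℂ)} {K : Kind} {a u : ℂ}
    (h : tile K a u ∈ latticeTranslates μ l D) (m n : ℤ) :
    tile K (a + (m * μ + n * l)) u ∈ latticeTranslates μ l D := by
  obtain ⟨m', n', d, hd, hs⟩ := h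
  refine ⟨m + m', n + n', d, hd, ?_⟩
  rw [← translate_tile, hs, ← image_comp]
  congr 1
  ext z
  simp only [Function.comp_apply]
  push_cast
  ring

lemma Neighbours.translate {μ l : ℂ} {D : Set (Set ℂ)} {K₁ K₂ K₃ : Kind} {a u : ℂ}
    (h : Neighbours (latticeTranslates μ l D) K₁ K₂ K₃ a u) (m n : ℤ) :
    Neighbours (latticeTranslates μ l D) K₁ K₂ K₃ (a + (m * μ + n * l)) u where
  norm := h.norm
  mem := latticeTranslates_translate (K := .tet) h.mem m n
  first := by
    have := latticeTranslates_translate h.first m n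
    rwa [add_right_comm] at this
  second := by
    have := latticeTranslates_translate h.second m n
    rwa [add_right_comm] at this
  third := latticeTranslates_translate h.third m n

/-! ## The two periodic tilings -/

lemma ofReal_sqrt_three_sq : ((√3 : ℝ) : ℂ) ^ 2 = 3 := by
  rw [pow_two, ← Complex.ofReal_mul, sqrt_three_sq]
  norm_num

lemma I_eq_zeta_pow : Complex.I = zeta ^ 3 := by
  have h := ofReal_sqrt_three_sq
  have hI := Complex.I_sq
  rw [zeta]
  grind

/-- The relation of a primitive twelfth root of unity. As `i`, `ω`, `√3` and the conjugate of `ζ`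
are polynomials in `ζ`, positions in both tilings can be compared by polynomial algebra modulo this
relation. -/
lemma zeta_pow_four : zeta ^ 4 = zeta ^ 2 - 1 := by
  have h := ofReal_sqrt_three_sq
  have hI := Complex.I_sq
  rw [zeta]
  grind

lemma omega_eq_zeta_pow : omega = zeta ^ 2 := by
  have h := ofReal_sqrt_three_sq
  have hI := Complex.I_sq
  rw [zeta, omega]
  grind

lemma conj_zeta : conj zeta = zeta - zeta ^ 3 := by
  rw [← I_eq_zeta_pow, zeta, map_div₀, map_add, Complex.conj_ofReal, Complex.conj_I,
    Complex.conj_ofNat]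
  ring

lemma sqrt_three_eq_zeta : ((√3 : ℝ) : ℂ) = 2 * zeta - zeta ^ 3 := by
  rw [← I_eq_zeta_pow, zeta]
  ring

lemma norm_zeta : ‖zeta‖ = 1 := by
  have h : ‖zeta‖ ^ 2 = 1 := by rw [← norm_pow, ← omega_eq_zeta_pow, norm_omega]
  exact (pow_eq_one_iff_of_nonneg (norm_nonneg _) two_ne_zero).1 h

/-- The factor by which the direction changes from one edge of a tile to the next. -/
def Kind.turn : Kind → ℂ
  | .tet => omega * omega
  | .oct => Complex.I

lemma tile_mem_rotate {𝒯 : Set (Set ℂ)} {K : Kind} {a u : ℂ} (h : tile K a u ∈ 𝒯) :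
    tile K (a + u) (K.turn * u) ∈ 𝒯 := by
  cases K
  · change tri _ _ ∈ 𝒯
    rwa [Kind.turn, ← tri_rotate]
  · change sq _ _ ∈ 𝒯
    rwa [Kind.turn, ← sq_rotate]

lemma tile_mem_of_eq {𝒯 : Set (Set ℂ)} {K : Kind} {a u a' u' : ℂ} (h : tile K a u ∈ 𝒯)
    (ha : a' = a) (hu : u' = u) : tile K a' u' ∈ 𝒯 := by
  rwa [ha, hu]

lemma hull_eq_tri {p q r a u : ℂ} (hp : p = a) (hq : q = a + u) (hr : r = a + omega * u) :
    convexHull ℝ {p, q, r} = tri a u := by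
  rw [hp, hq, hr, tri]

lemma hull_eq_tri_swap {p q r a u : ℂ} (hp : p = a) (hq : q = a + omega * u) (hr : r = a + u) :
    convexHull ℝ {p, q, r} = tri a u := by
  rw [hp, hq, hr, hull_rotate, hull_rotate, hull_swap, tri, ← hull_rotate]

lemma hull_eq_sq {p q r s a u : ℂ} (hp : p = a) (hq : q = a + u)
    (hr : r = a + u + Complex.I * u) (hs : s = a + Complex.I * u) :
    convexHull ℝ {p, q, r, s} = sq a u := by
  rw [hp, hq, hr, hs, sq]

lemma mem_latticeTranslates_zero {μ l : ℂ} {D : Set (Set ℂ)} {K : Kind} {a u : ℂ}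
    (h : tile K a u ∈ D) : tile K a u ∈ latticeTranslates μ l D :=
  tile_mem_of_eq (mem_latticeTranslates h 0 0) (by simp) rfl

/-- If every tile of a fundamental set is a square or a triangle with neighbours as required, then
so is every triangle of the periodic tiling. -/
lemma exists_neighbours {μ l : ℂ} {D : Set (Set ℂ)} (p : ℕ → Prop)
    (hD : ∀ d ∈ D, (∃ a u, ‖u‖ = 1 ∧ d = sq a u) ∨
      ∃ K₁ K₂ K₃ a u, Neighbours (latticeTranslates μ l D) K₁ K₂ K₃ a u ∧ d = tri a u ∧
        p (K₁.weight + K₂.weight + K₃.weight))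
    {s : Set ℂ} (hs : s ∈ latticeTranslates μ l D) (ht : IsPolygon .tet s) :
    ∃ K₁ K₂ K₃ a u, Neighbours (latticeTranslates μ l D) K₁ K₂ K₃ a u ∧ s = tri a u ∧
      p (K₁.weight + K₂.weight + K₃.weight) := by
  obtain ⟨m, n, d, hd, rfl⟩ := hs
  rcases hD d hd with ⟨a, u, hu, rfl⟩ | ⟨K₁, K₂, K₃, a, u, h, rfl, hp⟩
  · rw [show sq a u = tile .oct a u from rfl, translate_tile] at ht
    exact absurd (ht.unique (isPolygon_tile .oct _ hu)) (by simp)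
  · exact ⟨K₁, K₂, K₃, _, u, h.translate m n, translate_tile .tet a u _, hp⟩

/-! ### The tiling with hexagons -/

lemma omega_pow_six : omega ^ 6 = 1 := by
  have h := zeta_pow_four
  rw [omega_eq_zeta_pow]
  grind

lemma omega_pow_mod (k : ℕ) : omega ^ k = omega ^ (k % 6) := by
  conv_lhs => rw [← Nat.mod_add_div k 6, pow_add, pow_mul, omega_pow_six, one_pow, mul_one]

lemma tri_omega_mem (k : ℕ) : tile .tet 0 (omega ^ k) ∈ hexagonTiling := by
  rw [omega_pow_mod]
  refine mem_latticeTranslates_zero (Or.inl (Or.inl ⟨k % 6, Nat.mod_lt _ (by norm_num), ?_⟩))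
  exact (hull_eq_tri rfl (by ring) (by ring)).symm

lemma sq_omega_mem_fundamental {k : ℕ} (hk : k < 3) :
    tile .oct (omega * omega ^ k) (-(omega * omega * omega ^ k)) ∈
      ({s | ∃ k < 3, s = convexHull ℝ {omega ^ k, omega ^ (k + 1),
        omega ^ (k + 1) + zeta * omega ^ k, omega ^ k + zeta * omega ^ k}} : Set (Set ℂ)) := by
  have hz := zeta_pow_four
  have hI := I_eq_zeta_pow
  have ho := omega_eq_zeta_pow
  refine ⟨k, hk, ?_⟩
  change sq _ _ = _
  rw [sq_rotate, ← hull_eq_sq (p := omega ^ k) (q := omega ^ k + zeta * omega ^ k)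
    (r := omega ^ (k + 1) + zeta * omega ^ k) (s := omega ^ (k + 1))]
  · congr 1
    ext z
    simp only [mem_insert_iff, mem_singleton_iff]
    tauto
  · generalize omega ^ k = x at *
    grind
  · generalize omega ^ k = x at *
    grind
  · rw [pow_succ]
    generalize omega ^ k = x at *
    grind
  · rw [pow_succ]
    generalize omega ^ k = x at *
    grind

/-- The fundamental set has squares on three consecutive sides of the hexagon only. Those on the
other three sides are lattice translates of the opposite ones, started from the opposite edge by two
turns. -/
lemma sq_omega_mem (k : ℕ) :
    tile .oct (omega * omega ^ k) (-(omega * omega * omega ^ k)) ∈ hexagonTiling := by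
  have hz := zeta_pow_four
  have hI := I_eq_zeta_pow
  have ho := omega_eq_zeta_pow
  have hc := conj_zeta
  have h3 := sqrt_three_eq_zeta
  rw [omega_pow_mod]
  have hlt : k % 6 < 6 := Nat.mod_lt _ (by norm_num)
  generalize k % 6 = j at hlt
  have key : ∀ i < 3, tile .oct (omega * omega ^ i) (-(omega * omega * omega ^ i)) ∈
      hexagonTiling := fun i hi =>
    mem_latticeTranslates_zero (Or.inl (Or.inr (sq_omega_mem_fundamental hi)))
  have opp : ∀ i < 3, tile .oct _ _ ∈ hexagonTiling := fun i hi =>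
    tile_mem_rotate (tile_mem_rotate (key i hi))
  by_cases h : j < 3
  · exact key j h
  have h' : j = 3 ∨ j = 4 ∨ j = 5 := by omega
  rcases h' with rfl | rfl | rfl
  · refine tile_mem_of_eq (latticeTranslates_translate (opp 0 (by norm_num)) 0 (-1)) ?_ ?_
    · simp only [Kind.turn]
      push_cast
      grind
    · simp only [Kind.turn]
      grind
  · refine tile_mem_of_eq (latticeTranslates_translate (opp 1 (by norm_num)) 1 (-1)) ?_ ?_
    · simp only [Kind.turn]
      push_cast
      grind
    · simp only [Kind.turn]
      grind
  · refine tile_mem_of_eq (latticeTranslates_translate (opp 2 (by norm_num)) 1 0) ?_ ?_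
    · simp only [Kind.turn]
      push_cast
      grind
    · simp only [Kind.turn]
      grind

lemma norm_omega_pow (k : ℕ) : ‖omega ^ k‖ = 1 := by
  rw [norm_pow, norm_omega, one_pow]

lemma norm_conj_zeta : ‖conj zeta‖ = 1 := by
  rw [Complex.norm_conj, norm_zeta]

lemma neighbours_tri_omega (k : ℕ) : Neighbours hexagonTiling .tet .oct .tet 0 (omega ^ k) where
  norm := norm_omega_pow k
  mem := tri_omega_mem k
  first := by
    have ho := omega_sq
    -- Since `ω ^ 6 = 1`, the index `k + 5` denotes the preceding triangle around `0`.
    refine tile_mem_of_eq (tile_mem_rotate (tile_mem_rotate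
      (tri_omega_mem (k + 5)))) ?_ ?_
    · simp only [Kind.turn, pow_add]
      generalize omega ^ k = x
      grind
    · simp only [Kind.turn, pow_add]
      generalize omega ^ k = x
      grind
  second := by
    rw [zero_add]
    exact sq_omega_mem k
  third := tile_mem_of_eq (tri_omega_mem (k + 1)) rfl (pow_succ' _ _).symm

/-- This triangle fills the gap between two squares of the hexagon around `0` and one of the hexagon
around a neighbouring lattice point. -/
lemma neighbours_hexagon_right : Neighbours hexagonTiling .oct .oct .oct 1 (conj zeta) := by
  have hz := zeta_pow_four
  have hI := I_eq_zeta_pow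
  have ho := omega_eq_zeta_pow
  have hc := conj_zeta
  have h3 := sqrt_three_eq_zeta
  have e : tri 1 (conj zeta) = convexHull ℝ {1, 1 + zeta, 1 + conj zeta} :=
    (hull_eq_tri_swap rfl (by grind) rfl).symm
  refine ⟨norm_conj_zeta, mem_latticeTranslates_zero (K := .tet) (Or.inr (Or.inl e)), ?_, ?_, ?_⟩
  · refine tile_mem_of_eq (tile_mem_rotate (tile_mem_rotate
      (tile_mem_rotate (sq_omega_mem 5)))) ?_ ?_
    · simp only [Kind.turn]
      grind
    · simp only [Kind.turn]
      grind
  · refine tile_mem_of_eq (latticeTranslates_translate (tile_mem_rotate (tile_mem_rotate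
      (tile_mem_rotate (sq_omega_mem 1)))) 1 0) ?_ ?_
    · simp only [Kind.turn]
      push_cast
      grind
    · simp only [Kind.turn]
      grind
  · refine tile_mem_of_eq (tile_mem_rotate (sq_omega_mem 0)) ?_ ?_
    · grind
    · simp only [Kind.turn]
      grind

lemma neighbours_hexagon_left : Neighbours hexagonTiling .oct .oct .oct omega zeta := by
  have hz := zeta_pow_four
  have hI := I_eq_zeta_pow
  have ho := omega_eq_zeta_pow
  have hc := conj_zeta
  have h3 := sqrt_three_eq_zeta
  have e : tri omega zeta = convexHull ℝ {omega, omega + zeta, omega + Complex.I} :=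
    (hull_eq_tri rfl rfl (by grind)).symm
  refine ⟨norm_zeta, mem_latticeTranslates_zero (K := .tet) (Or.inr (Or.inr e)), ?_, ?_, ?_⟩
  · refine tile_mem_of_eq (tile_mem_rotate (tile_mem_rotate
      (tile_mem_rotate (sq_omega_mem 0)))) ?_ ?_
    · simp only [Kind.turn]
      grind
    · simp only [Kind.turn]
      grind
  · refine tile_mem_of_eq (latticeTranslates_translate (tile_mem_rotate (tile_mem_rotate
      (tile_mem_rotate (sq_omega_mem 2)))) 0 1) ?_ ?_
    · simp only [Kind.turn]
      push_cast
      grind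
    · simp only [Kind.turn]
      grind
  · refine tile_mem_of_eq (tile_mem_rotate (sq_omega_mem 1)) ?_ ?_
    · grind
    · simp only [Kind.turn]
      grind

/-- The triangles in a hexagon abut one square, those between squares abut three. Parity is all that
is needed: it excludes both OOT and TTT. -/
lemma hexagon_neighbours {s : Set ℂ} (hs : s ∈ hexagonTiling) (ht : IsPolygon .tet s) :
    ∃ K₁ K₂ K₃ a u, Neighbours hexagonTiling K₁ K₂ K₃ a u ∧ s = tri a u ∧
      Odd (K₁.weight + K₂.weight + K₃.weight) := by
  have hz := zeta_pow_four
  have hI := I_eq_zeta_pow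
  have ho := omega_eq_zeta_pow
  have hc := conj_zeta
  refine exists_neighbours _ ?_ hs ht
  rintro d ((⟨k, hk, rfl⟩ | ⟨k, hk, rfl⟩) | rfl | rfl)
  · exact Or.inr ⟨_, _, _, _, _, neighbours_tri_omega k,
      hull_eq_tri rfl (by ring) (by ring), by decide⟩
  · refine Or.inl ⟨omega ^ k, zeta * omega ^ k, by rw [norm_mul, norm_zeta, norm_omega_pow, one_mul],
      ?_⟩
    rw [← hull_eq_sq (p := omega ^ k) (q := omega ^ k + zeta * omega ^ k)
      (r := omega ^ (k + 1) + zeta * omega ^ k) (s := omega ^ (k + 1))]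
    · congr 1
      ext z
      simp only [mem_insert_iff, mem_singleton_iff]
      tauto
    · rfl
    · rfl
    · rw [pow_succ]
      generalize omega ^ k = x at *
      grind
    · rw [pow_succ]
      generalize omega ^ k = x at *
      grind
  · exact Or.inr ⟨_, _, _, _, _, neighbours_hexagon_right,
      hull_eq_tri_swap rfl (by grind) rfl, by decide⟩
  · exact Or.inr ⟨_, _, _, _, _, neighbours_hexagon_left,
      hull_eq_tri rfl rfl (by grind), by decide⟩

lemma exists_isOTT_hexagon : ∃ s, IsOTT hexagonTiling s := by
  have h := neighbours_tri_omega 0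
  obtain ⟨h1, h2, h3⟩ := h.abuts
  exact ⟨_, h.mem, _, _, _, (unitTriangle_tri _ h.norm).rotate,
    by rw [tri, hull_rotate], h2, h3, h1⟩

/-! ### The snub square tiling -/

lemma snub_square_mem : tile .oct 0 1 ∈ snubSquareTiling :=
  mem_latticeTranslates_zero (Or.inl (hull_eq_sq rfl (by ring) (by ring) (by ring)).symm)

lemma snub_square'_mem : tile .oct (1 + Complex.I) zeta ∈ snubSquareTiling :=
  mem_latticeTranslates_zero (Or.inr (Or.inl
    (hull_eq_sq rfl (by ring) (by ring) (by ring)).symm))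

lemma snub_triangle_eq : convexHull ℝ {Complex.I, Complex.I * (1 + zeta),
    1 + Complex.I * (1 + zeta)} = tri Complex.I omega := by
  have hz := zeta_pow_four
  have hI := I_eq_zeta_pow
  have ho := omega_eq_zeta_pow
  exact hull_eq_tri_swap rfl (by grind) (by grind)

lemma snub_triangle'_eq : convexHull ℝ {Complex.I, 1 + Complex.I * (1 + zeta),
    1 + Complex.I} = tri Complex.I 1 := by
  have hz := zeta_pow_four
  have hI := I_eq_zeta_pow
  have ho := omega_eq_zeta_pow
  exact hull_eq_tri_swap rfl (by grind) (by grind)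

lemma snub_triangle''_eq : convexHull ℝ {1 + Complex.I, 1 + zeta + Complex.I,
    1 + zeta} = tri (1 + Complex.I) (conj zeta) := by
  have hz := zeta_pow_four
  have hI := I_eq_zeta_pow
  have ho := omega_eq_zeta_pow
  have hc := conj_zeta
  exact hull_eq_tri_swap rfl (by grind) (by grind)

lemma snub_triangle'''_eq : convexHull ℝ {1, 1 + zeta, 1 + Complex.I} = tri 1 zeta := by
  have hz := zeta_pow_four
  have hI := I_eq_zeta_pow
  have ho := omega_eq_zeta_pow
  exact hull_eq_tri rfl rfl (by grind)

lemma snub_triangle_mem : tile .tet Complex.I omega ∈ snubSquareTiling :=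
  mem_latticeTranslates_zero (by simp [tile, ← snub_triangle_eq])

lemma snub_triangle'_mem : tile .tet Complex.I 1 ∈ snubSquareTiling :=
  mem_latticeTranslates_zero (by simp [tile, ← snub_triangle'_eq])

lemma snub_triangle''_mem : tile .tet (1 + Complex.I) (conj zeta) ∈ snubSquareTiling :=
  mem_latticeTranslates_zero (by simp [tile, ← snub_triangle''_eq])

lemma snub_triangle'''_mem : tile .tet 1 zeta ∈ snubSquareTiling :=
  mem_latticeTranslates_zero (by simp [tile, ← snub_triangle'''_eq])

lemma neighbours_snub_triangle :
    Neighbours snubSquareTiling .tet .oct .oct Complex.I omega := by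
  have hz := zeta_pow_four
  have hI := I_eq_zeta_pow
  have ho := omega_eq_zeta_pow
  refine ⟨norm_omega, snub_triangle_mem, ?_, ?_, ?_⟩
  · refine tile_mem_of_eq (tile_mem_rotate (tile_mem_rotate snub_triangle'_mem)) ?_ ?_
    · simp only [Kind.turn]
      grind
    · simp only [Kind.turn]
      grind
  · refine tile_mem_of_eq (latticeTranslates_translate snub_square_mem 0 1) ?_ ?_
    · push_cast
      grind
    · grind
  · refine tile_mem_of_eq (latticeTranslates_translate
      (tile_mem_rotate snub_square'_mem) (-1) 0) ?_ ?_
    · push_cast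
      grind
    · simp only [Kind.turn]
      grind

lemma neighbours_snub_triangle' :
    Neighbours snubSquareTiling .oct .oct .tet Complex.I 1 := by
  have hz := zeta_pow_four
  have hI := I_eq_zeta_pow
  have ho := omega_eq_zeta_pow
  refine ⟨norm_one, snub_triangle'_mem, ?_, ?_, ?_⟩
  · refine tile_mem_of_eq (tile_mem_rotate (tile_mem_rotate snub_square_mem)) ?_ ?_
    · simp only [Kind.turn]
      grind
    · simp only [Kind.turn]
      grind
  · refine tile_mem_of_eq (tile_mem_rotate (tile_mem_rotate
      (tile_mem_rotate snub_square'_mem))) ?_ ?_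
    · simp only [Kind.turn]
      grind
    · simp only [Kind.turn]
      grind
  · exact tile_mem_of_eq snub_triangle_mem rfl (mul_one _)

lemma neighbours_snub_triangle'' :
    Neighbours snubSquareTiling .tet .oct .oct (1 + Complex.I) (conj zeta) := by
  have hz := zeta_pow_four
  have hI := I_eq_zeta_pow
  have ho := omega_eq_zeta_pow
  have hc := conj_zeta
  refine ⟨norm_conj_zeta, snub_triangle''_mem, ?_, ?_, ?_⟩
  · refine tile_mem_of_eq (tile_mem_rotate snub_triangle'''_mem) ?_ ?_
    · grind
    · simp only [Kind.turn]
      grind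
  · refine tile_mem_of_eq (latticeTranslates_translate (tile_mem_rotate (tile_mem_rotate
      (tile_mem_rotate snub_square_mem))) 1 0) ?_ ?_
    · simp only [Kind.turn]
      push_cast
      grind
    · simp only [Kind.turn]
      grind
  · exact tile_mem_of_eq snub_square'_mem rfl (by grind)

lemma neighbours_snub_triangle''' :
    Neighbours snubSquareTiling .oct .tet .oct 1 zeta := by
  have hz := zeta_pow_four
  have hI := I_eq_zeta_pow
  have ho := omega_eq_zeta_pow
  have hc := conj_zeta
  refine ⟨norm_zeta, snub_triangle'''_mem, ?_, ?_, ?_⟩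
  · refine tile_mem_of_eq (latticeTranslates_translate (tile_mem_rotate (tile_mem_rotate
      snub_square'_mem)) 0 (-1)) ?_ ?_
    · simp only [Kind.turn]
      push_cast
      grind
    · simp only [Kind.turn]
      grind
  · exact tile_mem_of_eq snub_triangle''_mem (by grind) (by grind)
  · refine tile_mem_of_eq (tile_mem_rotate snub_square_mem) ?_ ?_
    · grind
    · simp only [Kind.turn]
      grind

/-- All four triangles of the fundamental set are of type OOT, which leaves neither OOO nor OTT. -/
lemma snub_neighbours {s : Set ℂ} (hs : s ∈ snubSquareTiling) (ht : IsPolygon .tet s) :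
    ∃ K₁ K₂ K₃ a u, Neighbours snubSquareTiling K₁ K₂ K₃ a u ∧ s = tri a u ∧
      K₁.weight + K₂.weight + K₃.weight = 2 := by
  refine exists_neighbours (· = 2) ?_ hs ht
  rintro d (rfl | rfl | rfl | rfl | rfl | rfl)
  · exact Or.inl ⟨0, 1, norm_one, hull_eq_sq rfl (by ring) (by ring) (by ring)⟩
  · exact Or.inl ⟨1 + Complex.I, zeta, norm_zeta, hull_eq_sq rfl (by ring) (by ring) (by ring)⟩
  · exact Or.inr ⟨_, _, _, _, _, neighbours_snub_triangle, snub_triangle_eq, rfl⟩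
  · exact Or.inr ⟨_, _, _, _, _, neighbours_snub_triangle', snub_triangle'_eq, rfl⟩
  · exact Or.inr ⟨_, _, _, _, _, neighbours_snub_triangle'', snub_triangle''_eq, rfl⟩
  · exact Or.inr ⟨_, _, _, _, _, neighbours_snub_triangle''', snub_triangle'''_eq, rfl⟩

lemma exists_isOOT_snub : ∃ s, IsOOT snubSquareTiling s := by
  have h := neighbours_snub_triangle'
  obtain ⟨h1, h2, h3⟩ := h.abuts
  exact ⟨_, h.mem, _, _, _, unitTriangle_tri _ h.norm, rfl, h1, h2, h3⟩

/-! ## Peripheral tilings -/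

lemma InStandardPosition.exists_isUnitTile {𝒬 : Set (Set H3)} (h : InStandardPosition 𝒬) :
    ∃ P ∈ 𝒬, IsUnitTile P := by
  have hstd : ∀ K, IsUnitTile (std K) := fun K =>
    ⟨K, IsometryEquiv.refl ℂ, by rw [ext_refl, Equiv.Perm.coe_one, image_id]⟩
  rcases h with h | h
  · exact ⟨_, h, hstd .tet⟩
  · exact ⟨_, h, hstd .oct⟩

lemma exists_config {Γ : Subgroup (Equiv.Perm H3)} (hΓ : Γ ≤ Isom) (hcusp : OneCusped Γ)
    {𝒯 : Set (Set ℂ)} (h : IsPeripheralTiling Γ 𝒯) : ∃ Γ' 𝒬, Config Γ' 𝒬 ∧ OneCusped Γ' ∧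
      (∃ P ∈ 𝒬, IsUnitTile P) ∧ 𝒯 = induced 𝒬 := by
  obtain ⟨φ, hφ, 𝒬, hQ, hst, rfl⟩ := h
  exact ⟨conjBy φ Γ, 𝒬, hQ.config (conjBy_le hφ hΓ), hcusp.conjBy hφ, hst.exists_isUnitTile, rfl⟩

lemma induced_image_ext (e : ℂ ≃ᵢ ℂ) (𝒬 : Set (Set H3)) :
    induced ((fun P => ext e '' P) '' 𝒬) = (fun s => e '' s) '' induced 𝒬 := by
  ext s
  constructor
  · rintro ⟨hne, _, ⟨P, hP, rfl⟩, rfl⟩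
    simp only [crossSection_ext] at hne ⊢
    exact ⟨_, mem_induced hP hne.of_image, rfl⟩
  · rintro ⟨_, ⟨hne, P, hP, rfl⟩, rfl⟩
    exact ⟨hne.image e, _, ⟨P, hP, rfl⟩, (crossSection_ext e P).symm⟩

/-- The planar isometry extends to hyperbolic space, and conjugation by its inverse removes it. The
moved tiling need not have a tile in standard position, but it still has a unit tile, which
suffices. -/
lemma exists_config_of_isometry {Γ : Subgroup (Equiv.Perm H3)} (hΓ : Γ ≤ Isom)
    (hcusp : OneCusped Γ) {𝒯 : Set (Set ℂ)} {e : ℂ ≃ᵢ ℂ}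
    (h : IsPeripheralTiling Γ ((fun s => e '' s) '' 𝒯)) : ∃ Γ' 𝒬, Config Γ' 𝒬 ∧ OneCusped Γ' ∧
      (∃ P ∈ 𝒬, IsUnitTile P) ∧ 𝒯 = induced 𝒬 := by
  obtain ⟨Γ', 𝒬, hc, hcusp', ⟨P, hP, K, f, rfl⟩, heq⟩ := exists_config hΓ hcusp h
  refine ⟨_, _, hc.map (ext_mem e.symm), hcusp'.conjBy (ext_mem e.symm),
    ⟨_, ⟨_, hP, rfl⟩, K, f.trans e.symm, ?_⟩, ?_⟩
  · rw [← ext_mul, Equiv.Perm.coe_mul, image_comp]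
  · rw [induced_image_ext, ← heq, ← image_comp]
    convert (image_id 𝒯).symm using 2
    ext s : 1
    simp [← image_comp]

/-- The number of squares that a triangle abuts can be read off from its neighbours. -/
lemma IsTiling.weight_eq_of_neighbours {𝒬 : Set (Set H3)} (h : IsTiling 𝒬)
    (hu : ∃ P ∈ 𝒬, IsUnitTile P) {p : ℕ → Prop}
    (hn : ∀ s ∈ induced 𝒬, IsPolygon .tet s → ∃ K₁ K₂ K₃ a u,
      Neighbours (induced 𝒬) K₁ K₂ K₃ a u ∧ s = tri a u ∧
        p (K₁.weight + K₂.weight + K₃.weight))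
    {a b c : ℂ} (habc : UnitTriangle a b c) (hs : convexHull ℝ {a, b, c} ∈ induced 𝒬)
    {K₁ K₂ K₃ : Kind}
    (hab : Abuts K₁ (induced 𝒬) (convexHull ℝ {a, b, c}) a b)
    (hbc : Abuts K₂ (induced 𝒬) (convexHull ℝ {a, b, c}) b c)
    (hca : Abuts K₃ (induced 𝒬) (convexHull ℝ {a, b, c}) c a) :
    p (K₁.weight + K₂.weight + K₃.weight) := by
  obtain ⟨L₁, L₂, L₃, q, u, hN, heq, hp⟩ := hn _ hs ⟨a, b, c, habc, rfl⟩
  obtain ⟨h1, h2, h3⟩ := hN.abuts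
  rw [← heq] at h1 h2 h3
  rwa [h.weight_eq hu habc (unitTriangle_tri q hN.norm) heq hs hab hbc hca h1 h2 h3]

end

end MixedPlatonic

/-! ### The main theorem -/

theorem mainTheorem11 (Γ : Subgroup (Equiv.Perm MixedPlatonic.H3))
    (hΓ : MixedPlatonic.IsMixedPlatonic Γ) (hcusp : MixedPlatonic.OneCusped Γ) :
    (∀ 𝒯 : Set (Set ℂ), MixedPlatonic.IsPeripheralTiling Γ 𝒯 →
      ((∃ s, MixedPlatonic.IsOOT 𝒯 s) →
        (∃ s, MixedPlatonic.IsOOO 𝒯 s) ∨ (∃ s, MixedPlatonic.IsOTT 𝒯 s)) ∧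
      ((∃ s, MixedPlatonic.IsOTT 𝒯 s) →
        (∃ s, MixedPlatonic.IsOOT 𝒯 s) ∨ (∃ s, MixedPlatonic.IsTTT 𝒯 s))) ∧
    (∀ e : ℂ ≃ᵢ ℂ,
      ¬ MixedPlatonic.IsPeripheralTiling Γ ((fun s => e '' s) '' MixedPlatonic.hexagonTiling) ∧
      ¬ MixedPlatonic.IsPeripheralTiling Γ
        ((fun s => e '' s) '' MixedPlatonic.snubSquareTiling)) := by
  refine ⟨fun 𝒯 h => ?_, fun e => ⟨fun h => ?_, fun h => ?_⟩⟩
  · obtain ⟨Γ', 𝒬, hc, hcusp', hu, rfl⟩ := MixedPlatonic.exists_config hΓ.isometries hcusp h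
    exact ⟨hc.of_isOOT hcusp' hu, hc.of_isOTT hcusp' hu⟩
  · obtain ⟨Γ', 𝒬, hc, hcusp', hu, heq⟩ :=
      MixedPlatonic.exists_config_of_isometry hΓ.isometries hcusp h
    have hn := @MixedPlatonic.hexagon_neighbours
    have hx := MixedPlatonic.exists_isOTT_hexagon
    rw [heq] at hn hx
    have hw := @MixedPlatonic.IsTiling.weight_eq_of_neighbours _ hc.tiling hu _ fun s => hn
    -- OTT would force a triangle with two squares or with none, but the number of squares is always
    -- odd.
    rcases hc.of_isOTT hcusp' hu hx with ⟨_, hs, a, b, c, habc, rfl, h1, h2, h3⟩ |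
      ⟨_, hs, a, b, c, habc, rfl, h1, h2, h3⟩
    · exact absurd (hw habc hs (K₁ := .oct) (K₂ := .oct) (K₃ := .tet) h1 h2 h3) (by decide)
    · exact absurd (hw habc hs (K₁ := .tet) (K₂ := .tet) (K₃ := .tet) h1 h2 h3) (by decide)
  · obtain ⟨Γ', 𝒬, hc, hcusp', hu, heq⟩ :=
      MixedPlatonic.exists_config_of_isometry hΓ.isometries hcusp h
    have hn := @MixedPlatonic.snub_neighbours
    have hx := MixedPlatonic.exists_isOOT_snub
    rw [heq] at hn hx
    have hw := @MixedPlatonic.IsTiling.weight_eq_of_neighbours _ hc.tiling hu (· = 2) fun s => hn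
    -- OOT would force a triangle with three squares or with one, but the number of squares is
    -- always two.
    rcases hc.of_isOOT hcusp' hu hx with ⟨_, hs, a, b, c, habc, rfl, h1, h2, h3⟩ |
      ⟨_, hs, a, b, c, habc, rfl, h1, h2, h3⟩
    · exact absurd (hw habc hs (K₁ := .oct) (K₂ := .oct) (K₃ := .oct) h1 h2 h3) (by decide)
    · exact absurd (hw habc hs (K₁ := .oct) (K₂ := .tet) (K₃ := .tet) h1 h2 h3) (by decide)
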